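/- For an $n$-vertex undirected graph $G$ and an integer $k\ge 0$, Dual Coloring asks whether $G$ has a proper coloring with at most $n-k$ colors (the answer is no if $k>n$). Dual Coloring can be solved in randomized $O^*(2^{3k/2})$ time, where $O^*(f(k))$ denotes $f(k)\cdot\mathrm{poly}(n)$. That is, for every constant $c\ge 0$ there are a randomized algorithm, i.e. a fixed program for a coin-tossing random access machine under the logarithmic cost criterion, and constants $A$ and $d$ such that on every $n$-vertex graph $G$, given by its adjacency matrix, and every integer $k\ge 0$, the algorithm halts within time $A\,(n+1)^d\,2^{3k/2}$ for every outcome of its coin tosses, and with probability at least $1-(n+2)^{-c}$ it answers correctly whether $G$ has a proper coloring with at most $n-k$ colors. -/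

import Mathlib

open MeasureTheory

/-! Random access machines with integer registers, an integer-addressed memory, a coin-tossing
instruction and the logarithmic cost criterion, programmed in a structured (`while`) language. -/

namespace RAM

/-- Arithmetic and comparison operations on integers. -/
inductive BinOp where
  | add | sub | mul | div | mod | lt | eq

/-- Division and remainder are the integer (Euclidean) ones, with `a / 0 = 0` and `a % 0 = a`;
comparisons return `1` for true and `0` for false. -/
def BinOp.apply : BinOp → ℤ → ℤ → ℤ
  | .add, a, b => a + b
  | .sub, a, b => a - b
  | .mul, a, b => a * b
  | .div, a, b => a / b
  | .mod, a, b => a % b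
  | .lt, a, b => if a < b then 1 else 0
  | .eq, a, b => if a = b then 1 else 0

/-- Expressions: integer constants, registers, memory reads at a computed address, operations. -/
inductive Expr where
  | const (z : ℤ)
  | reg (x : ℕ)
  | load (a : Expr)
  | bin (o : BinOp) (e₁ e₂ : Expr)

/-- Programs. A program is a finite piece of syntax; it mentions finitely many registers. -/
inductive Prog where
  | skip
  /-- `x := e` -/
  | assign (x : ℕ) (e : Expr)
  /-- `mem[a] := e` -/
  | store (a e : Expr)
  /-- `x :=` a fresh fair random bit -/
  | flip (x : ℕ)
  | seq (p q : Prog)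
  /-- `if e ≠ 0 then p else q` -/
  | ite (e : Expr) (p q : Prog)
  /-- `while e ≠ 0 do p` -/
  | loop (e : Expr) (p : Prog)

/-- Machine states: registers, memory, and the number of random bits read so far. -/
structure State where
  reg : ℕ → ℤ
  mem : ℤ → ℤ
  pos : ℕ

/-- The length of an integer: the number of binary digits of `|z|`, plus one for the sign. -/
def len (z : ℤ) : ℕ := Nat.size z.natAbs + 1

/-- The value of an expression. -/
def Expr.eval (s : State) : Expr → ℤ
  | .const z => z
  | .reg x => s.reg x
  | .load a => s.mem (a.eval s)
  | .bin o e₁ e₂ => o.apply (e₁.eval s) (e₂.eval s)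

/-- The logarithmic cost of evaluating an expression: every operation is charged the lengths of
the integers it handles, and a memory access also the length of the address. -/
def Expr.cost (s : State) : Expr → ℕ
  | .const z => len z
  | .reg x => len (s.reg x)
  | .load a => a.cost s + len (a.eval s) + len (s.mem (a.eval s))
  | .bin _ e₁ e₂ => e₁.cost s + e₂.cost s + len (e₁.eval s) + len (e₂.eval s)

/-- `Exec ω p s t s'`: on the sequence `ω` of random bits, the program `p` started in the state `s`
halts in the state `s'` after time exactly `t` (logarithmic cost). A computation that does not
halt has no such `t` and `s'`. -/
inductive Exec (ω : ℕ → Bool) : Prog → State → ℕ → State → Prop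
  | skip (s : State) : Exec ω .skip s 1 s
  | assign (s : State) (x : ℕ) (e : Expr) :
      Exec ω (.assign x e) s (e.cost s + len (e.eval s))
        { s with reg := Function.update s.reg x (e.eval s) }
  | store (s : State) (a e : Expr) :
      Exec ω (.store a e) s (a.cost s + e.cost s + len (a.eval s) + len (e.eval s))
        { s with mem := Function.update s.mem (a.eval s) (e.eval s) }
  | flip (s : State) (x : ℕ) :
      Exec ω (.flip x) s 1
        { s with reg := Function.update s.reg x (if ω s.pos then 1 else 0), pos := s.pos + 1 }
  | seq {p q : Prog} {s s' s'' : State} {t t' : ℕ} :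
      Exec ω p s t s' → Exec ω q s' t' s'' → Exec ω (.seq p q) s (t + t') s''
  | ite_true {e : Expr} {p q : Prog} {s s' : State} {t : ℕ} :
      e.eval s ≠ 0 → Exec ω p s t s' → Exec ω (.ite e p q) s (e.cost s + 1 + t) s'
  | ite_false {e : Expr} {p q : Prog} {s s' : State} {t : ℕ} :
      e.eval s = 0 → Exec ω q s t s' → Exec ω (.ite e p q) s (e.cost s + 1 + t) s'
  | loop_true {e : Expr} {p : Prog} {s s' s'' : State} {t t' : ℕ} :
      e.eval s ≠ 0 → Exec ω p s t s' → Exec ω (.loop e p) s' t' s'' →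
        Exec ω (.loop e p) s (e.cost s + 1 + t + t') s''
  | loop_false {e : Expr} {p : Prog} {s : State} :
      e.eval s = 0 → Exec ω (.loop e p) s (e.cost s + 1) s

/-- A run is determined by the program, the initial state and the random bits. -/
theorem Exec.unique {ω : ℕ → Bool} {p : Prog} {s s₁ s₂ : State} {t₁ t₂ : ℕ}
    (h₁ : Exec ω p s t₁ s₁) (h₂ : Exec ω p s t₂ s₂) : t₁ = t₂ ∧ s₁ = s₂ := by
  induction h₁ generalizing t₂ s₂ with
  | skip | assign | store | flip => cases h₂; exact ⟨rfl, rfl⟩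
  | seq _ _ ih ih' =>
    cases h₂ with
    | seq a b =>
      obtain ⟨rfl, rfl⟩ := ih a
      obtain ⟨rfl, rfl⟩ := ih' b
      exact ⟨rfl, rfl⟩
  | ite_true he _ ih =>
    cases h₂ with
    | ite_true _ a => obtain ⟨rfl, rfl⟩ := ih a; exact ⟨rfl, rfl⟩
    | ite_false he' _ => exact absurd he' he
  | ite_false he _ ih =>
    cases h₂ with
    | ite_true he' _ => exact absurd he he'
    | ite_false _ a => obtain ⟨rfl, rfl⟩ := ih a; exact ⟨rfl, rfl⟩
  | loop_true he _ _ ih ih' =>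
    cases h₂ with
    | loop_true _ a b =>
      obtain ⟨rfl, rfl⟩ := ih a
      obtain ⟨rfl, rfl⟩ := ih' b
      exact ⟨rfl, rfl⟩
    | loop_false he' => exact absurd he' he
  | loop_false he =>
    cases h₂ with
    | loop_true he' _ _ => exact absurd he he'
    | loop_false _ => exact ⟨rfl, rfl⟩

/-- The law of an infinite sequence of independent fair coin tosses. -/
noncomputable def coins : Measure (ℕ → Bool) :=
  Measure.infinitePi fun _ => (PMF.uniformOfFintype Bool).toMeasure

/-- Started in `s`, the program `p` always halts (whatever the random bits) within time `T`, and
with probability at least `1 - ε` its yes/no answer is the truth value of `answer`.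
The answer is read off register `0`: nonzero means yes. -/
def Decides (p : Prog) (s : State) (answer : Prop) (T ε : ℝ) : Prop :=
  (∀ ω, ∃ t s', Exec ω p s t s' ∧ (t : ℝ) ≤ T) ∧
    1 - ε ≤ coins.real {ω | ∃ t s', Exec ω p s t s' ∧ (s'.reg 0 ≠ 0 ↔ answer)}

open Classical in
/-- The initial state for a graph `G` on the vertices `0, …, n - 1` and an integer `k`:
register `0` holds `n`, register `1` holds `k`, the memory holds the adjacency matrix of `G`
row by row from address `0` on, and everything else is `0`. -/
noncomputable def graphInput {n : ℕ} (G : SimpleGraph (Fin n)) (k : ℕ) : State where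
  reg x := if x = 0 then n else if x = 1 then k else 0
  mem a := if ∃ i j : Fin n, G.Adj i j ∧ a = (i : ℤ) * n + j then 1 else 0
  pos := 0

end RAM

/-- A yes-instance of Dual Coloring: the `n`-vertex graph `G` has a proper coloring with at most
`n - k` colors (never the case if `k > n`). -/
def DualColorable {n : ℕ} (G : SimpleGraph (Fin n)) (k : ℕ) : Prop :=
  k ≤ n ∧ G.Colorable (n - k)

/-! ### Lengths of integers under arithmetic. -/

namespace RAM

/-! A colouring of `G` with `m = n - k` colours is a cover of the complement of `G` by `m` cliques.
Pack vertex-disjoint triangles of the complement greedily. If there are `τ` of them, these triangles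
and the other vertices as singletons form a cover by `n - 2τ` cliques, so `2τ ≥ k` means yes
(`coverable_of_triangles`). Otherwise let `X` consist of `w = max(3τ, k)` vertices including all
packed ones, and let `Y` be the rest. Then `2w < 3k`, so work proportional to `2 ^ w` is affordable;
`Y` has `n - w ≤ m` vertices; and since the packing is maximal, `Y` contains no triangle of the
complement, so every clique has at most two vertices in `Y`.

On `Y` a cover is therefore a partial matching, that is, an involution `σ` of the `m` rows, where
row `u` stands for the vertex `w + u` (if there is one). A fixed point is a clique with at most one
vertex in `Y`. A pair `u < v = σ u` accounts for two cliques: the slot `(u, v)` is for a clique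
containing both vertices, the opposite slot `(v, u)` for a clique inside `X`. This makes `m` slots
for every `σ` (`coverable_of_slots`, `exists_slots`).

For `s ⊆ X` let `f_s(u, v)` be a slot weight times the generating function of the cliques inside `s`
that fit the slot, and take the determinant of the symmetric matrix `f_s(u, v) f_s(v, u)`. In
characteristic 2 the terms of `σ` and `σ⁻¹` cancel, and an involution contributes the square of `∏
f_s(u, σ u)` (`det_mul_swap`). In the sum over all `s`, a tuple of cliques inside that square is
counted once for every `s` containing its union, which is an even number unless the tuple covers
`X`. So the sum vanishes on no-instances (`coverSum_eq_zero`); on yes-instances it is a nonzero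
polynomial in the weights, because 0/1 weights read off a cover give the value 1
(`coverPoly_ne_zero`). Random weights from `𝔽₂[X]` of degree less than the number of bits drawn for
each then detect it by Schwartz–Zippel (`coins_coverSum_eq_zero_le`).

All of this is computed with integers. The weights are lifted to `ℤ[X]` and evaluated at a large
even base; the parities of the coefficients of the result are those of its balanced digits
(`exists_digits_odd_coverSum_iff`). The clique sums of all `2 ^ w` subsets are tabulated by
recursion on the largest element (`cliqueSum_insert`), and the determinants come from the
Faddeev–LeVerrier recursion, whose divisions are exact (`state_eq`).

The program is written in a language with arrays and counted loops. Its compilation costs a constant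
times the bit bound for each elementary step (`Cmd.exists_exec`), and its correctness and step count
are proved with the triples `Tri`. -/

theorem len_mono {a b : ℤ} (h : |a| ≤ |b|) : len a ≤ len b := by
  have : a.natAbs ≤ b.natAbs := by zify; exact h
  exact Nat.succ_le_succ (Nat.size_le_size this)

theorem len_le_of_abs_lt {a : ℤ} {L : ℕ} (h : |a| < 2 ^ L) : len a ≤ L + 1 := by
  refine Nat.succ_le_succ (Nat.size_le.2 ?_)
  zify; exact h

/-- A product has at most as many digits as its factors together; the two extra units in `len a +
len b` leave room for the carry of a sum and for the value 1 of a comparison of zeros. -/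
theorem len_apply_le (o : BinOp) (a b : ℤ) : len (o.apply a b) ≤ len a + len b := by
  have key : ∀ z : ℤ, z.natAbs < 2 ^ (a.natAbs.size + b.natAbs.size + 1) → len z ≤ len a + len b := by
    intro z hz
    have := Nat.size_le.2 hz
    unfold len; omega
  have ha := Nat.lt_size_self a.natAbs
  have hb := Nat.lt_size_self b.natAbs
  have ha1 : 1 ≤ 2 ^ a.natAbs.size := Nat.one_le_two_pow
  have hb1 : 1 ≤ 2 ^ b.natAbs.size := Nat.one_le_two_pow
  have hmul : 2 ^ (a.natAbs.size + b.natAbs.size + 1)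
      = 2 * (2 ^ a.natAbs.size * 2 ^ b.natAbs.size) := by ring
  have h1 : a.natAbs + b.natAbs < 2 ^ (a.natAbs.size + b.natAbs.size + 1) := by
    rw [hmul]; nlinarith
  cases o with
  | add => exact key _ (lt_of_le_of_lt (Int.natAbs_add_le a b) h1)
  | sub => exact key _ (lt_of_le_of_lt (Int.natAbs_sub_le a b) h1)
  | mul =>
    refine key _ ?_
    have := Nat.mul_lt_mul'' ha hb
    simp only [BinOp.apply, Int.natAbs_mul]
    omega
  | div =>
    refine key _ (lt_of_le_of_lt ?_ h1)
    have := Int.natAbs_ediv_le_natAbs a b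
    simp only [BinOp.apply]; omega
  | mod =>
    refine key _ (lt_of_le_of_lt ?_ h1)
    simp only [BinOp.apply]
    rcases eq_or_ne b 0 with rfl | hb0
    · simp
    · have h2 := Int.emod_nonneg a hb0
      have h3 := Int.emod_lt_abs a hb0
      rw [Int.abs_eq_natAbs] at h3
      omega
  | lt =>
    refine key _ (lt_of_le_of_lt (b := 1) ?_ ?_)
    · simp only [BinOp.apply]; split_ifs <;> simp
    · rw [hmul]; nlinarith
  | eq =>
    refine key _ (lt_of_le_of_lt (b := 1) ?_ ?_)
    · simp only [BinOp.apply]; split_ifs <;> simp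
    · rw [hmul]; nlinarith

end RAM

/-! A structured language with arrays and counted loops, and its compilation to the machine. -/

namespace StructuredRAM

structure St where
  reg : ℕ → ℤ
  arr : ℕ → ℕ → ℤ
  pos : ℕ

inductive Ex where
  | const (z : ℤ)
  | reg (x : ℕ)
  | get (k : ℕ) (e : Ex)
  | bin (o : RAM.BinOp) (e₁ e₂ : Ex)

def Ex.eval (s : St) : Ex → ℤ
  | .const z => z
  | .reg x => s.reg x
  | .get k e => s.arr k (e.eval s).toNat
  | .bin o e₁ e₂ => o.apply (e₁.eval s) (e₂.eval s)

def St.setReg (s : St) (x : ℕ) (z : ℤ) : St := { s with reg := Function.update s.reg x z }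

def St.setArr (s : St) (k i : ℕ) (z : ℤ) : St :=
  { s with arr := Function.update s.arr k (Function.update (s.arr k) i z) }

def St.flip (s : St) (ω : ℕ → Bool) (x : ℕ) : St :=
  { s with reg := Function.update s.reg x (if ω s.pos then 1 else 0), pos := s.pos + 1 }

inductive Cmd where
  | skip
  | set (x : ℕ) (e : Ex)
  | put (k : ℕ) (i e : Ex)
  | flip (x : ℕ)
  | seq (p q : Cmd)
  | ite (e : Ex) (p q : Cmd)
  /-- `for x in 0, …, e - 1 do p` -/
  | loop (x : ℕ) (e : Ex) (p : Cmd)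

def iter (f : ℕ → St → St) (s : St) : ℕ → St
  | 0 => s
  | i + 1 => f i (iter f s i)

def Cmd.run (ω : ℕ → Bool) : Cmd → St → St
  | .skip, s => s
  | .set x e, s => s.setReg x (e.eval s)
  | .put k i e, s => s.setArr k (i.eval s).toNat (e.eval s)
  | .flip x, s => s.flip ω x
  | .seq p q, s => q.run ω (p.run ω s)
  | .ite e p q, s => if e.eval s ≠ 0 then p.run ω s else q.run ω s
  | .loop x e p, s => iter (fun i s => p.run ω (s.setReg x i)) s (e.eval s).toNat

/-- The number of elementary steps of a run. -/
def Cmd.steps (ω : ℕ → Bool) : Cmd → St → ℕ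
  | .skip, _ => 1
  | .set _ _, _ => 1
  | .put _ _ _, _ => 1
  | .flip _, _ => 1
  | .seq p q, s => p.steps ω s + q.steps ω (p.run ω s)
  | .ite e p q, s => 1 + if e.eval s ≠ 0 then p.steps ω s else q.steps ω s
  | .loop x e p, s => 1 + ∑ i ∈ Finset.range (e.eval s).toNat,
      (1 + p.steps ω ((iter (fun i s => p.run ω (s.setReg x i)) s i).setReg x i))

/-- All values assigned during a run are less than `2 ^ L` in absolute value. -/
def Cmd.Safe (L : ℕ) (ω : ℕ → Bool) : Cmd → St → Prop
  | .skip, _ => True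
  | .set _ e, s => |e.eval s| < 2 ^ L
  | .put _ _ e, s => |e.eval s| < 2 ^ L
  | .flip _, _ => 0 < L
  | .seq p q, s => p.Safe L ω s ∧ q.Safe L ω (p.run ω s)
  | .ite e p q, s => if e.eval s ≠ 0 then p.Safe L ω s else q.Safe L ω s
  | .loop x e p, s => (e.eval s).toNat ≤ 2 ^ L ∧ ∀ i < (e.eval s).toNat,
      p.Safe L ω ((iter (fun i s => p.run ω (s.setReg x i)) s i).setReg x i)

def St.Bdd (L : ℕ) (s : St) : Prop := (∀ x, |s.reg x| < 2 ^ L) ∧ ∀ k i, |s.arr k i| < 2 ^ L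

/-! The memory layout. -/

/-- Registers 0 and 1 stay in place since input and output use them. The others move to even
numbers, which leaves the odd ones from 3 on for loop control. -/
def rho (x : ℕ) : ℕ := if x ≤ 1 then x else 2 * x

/-- Array 0 is where the input matrix lies. Every positive integer is `2 ^ k * (2 * i + 1)` in one
way only, so infinitely many unbounded arrays share the negative addresses. -/
def addr (k i : ℕ) : ℤ :=
  match k with
  | 0 => i
  | k + 1 => - (2 ^ k * (2 * i + 1))

theorem rho_injective : Function.Injective rho := by
  intro x y h
  unfold rho at h
  split_ifs at h <;> omega

theorem addr_injective {k i k' i' : ℕ} (h : addr k i = addr k' i') : k = k' ∧ i = i' := by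
  have pos : ∀ k i : ℕ, addr (k + 1) i < 0 := by
    intro k i
    simp only [addr]
    have : (0 : ℤ) < 2 ^ k * (2 * i + 1) := by positivity
    linarith
  cases k with
  | zero =>
    cases k' with
    | zero => simpa [addr] using h
    | succ k' => have := pos k' i'; rw [← h] at this; simp [addr] at this; omega
  | succ k =>
    cases k' with
    | zero => have := pos k i; rw [h] at this; simp [addr] at this; omega
    | succ k' =>
      simp only [addr, neg_inj] at h
      have h' : 2 ^ k * (2 * i + 1) = 2 ^ k' * (2 * i' + 1) := by exact_mod_cast h
      have aux : ∀ {a b x y : ℕ}, a ≤ b → 2 ^ a * (2 * x + 1) = 2 ^ b * (2 * y + 1) →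
          a = b ∧ x = y := by
        intro a b x y hab e
        obtain ⟨c, rfl⟩ := Nat.exists_eq_add_of_le hab
        rw [pow_add, mul_assoc] at e
        have e := Nat.eq_of_mul_eq_mul_left (by positivity) e
        cases c with
        | zero => simp at e; omega
        | succ c => rw [pow_succ] at e; have : 2 * x + 1 = 2 * (2 ^ c * (2 * y + 1)) := by
                      rw [e]; ring
                    omega
      rcases le_total k k' with hk | hk
      · have := aux hk h'; omega
      · have := aux hk h'.symm; omega

open RAM in
-- Truncates a negative index to 0, in agreement with `toNat` in `Ex.eval`.
def index (e : Expr) : Expr := .bin .mul e (.bin .sub (.const 1) (.bin .lt e (.const 0)))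

open RAM in
def address (k : ℕ) (e : Expr) : Expr :=
  match k with
  | 0 => index e
  | k + 1 => .bin .sub (.const 0)
      (.bin .mul (.const (2 ^ k)) (.bin .add (.bin .mul (.const 2) (index e)) (.const 1)))

def Ex.toRAM : Ex → RAM.Expr
  | .const z => .const z
  | .reg x => .reg (rho x)
  | .get k e => .load (address k e.toRAM)
  | .bin o a b => .bin o a.toRAM b.toRAM

open RAM in
-- The number `d` is the loop depth. Counter and bound of a loop live in registers of their own for
-- each depth, so the body cannot disturb them.
def Cmd.toRAM (d : ℕ) : Cmd → Prog
  | .skip => .skip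
  | .set x e => .assign (rho x) e.toRAM
  | .put k i e => .store (address k i.toRAM) e.toRAM
  | .flip x => .flip (rho x)
  | .seq p q => .seq (p.toRAM d) (q.toRAM d)
  | .ite e p q => .ite e.toRAM (p.toRAM d) (q.toRAM d)
  | .loop x e p => .seq (.assign (4 * d + 5) e.toRAM) (.seq (.assign (4 * d + 3) (.const 0))
      (.loop (.bin .lt (.reg (4 * d + 3)) (.reg (4 * d + 5)))
        (.seq (.assign (rho x) (.reg (4 * d + 3))) (.seq (p.toRAM (d + 1))
          (.assign (4 * d + 3) (.bin .add (.reg (4 * d + 3)) (.const 1)))))))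

/-- The machine state `t` represents `s`. -/
structure Rep (s : St) (t : RAM.State) : Prop where
  reg : ∀ x, t.reg (rho x) = s.reg x
  mem : ∀ k i, t.mem (addr k i) = s.arr k i
  pos : t.pos = s.pos

theorem eval_index (t : RAM.State) (e : RAM.Expr) : (index e).eval t = (e.eval t).toNat := by
  have e1 : (index e).eval t = e.eval t * (1 - if e.eval t < 0 then 1 else 0) := rfl
  rw [e1]
  by_cases h : e.eval t < 0
  · rw [if_pos h, Int.toNat_of_nonpos h.le]; simp
  · rw [if_neg h, sub_zero, mul_one, Int.toNat_of_nonneg (not_lt.1 h)]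

theorem eval_address (t : RAM.State) (k : ℕ) (e : RAM.Expr) :
    (address k e).eval t = addr k (e.eval t).toNat := by
  cases k with
  | zero => exact eval_index t e
  | succ k => simp [address, addr, RAM.Expr.eval, RAM.BinOp.apply, eval_index]

theorem Rep.eval {s : St} {t : RAM.State} (h : Rep s t) (e : Ex) : e.toRAM.eval t = e.eval s := by
  induction e with
  | const z => rfl
  | reg x => exact h.reg x
  | get k e ih => simp only [Ex.toRAM, RAM.Expr.eval, eval_address, ih, h.mem, Ex.eval]
  | bin o a b iha ihb => simp only [Ex.toRAM, RAM.Expr.eval, iha, ihb, Ex.eval]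

theorem exists_address_cost (k : ℕ) : ∃ κ, ∀ (t : RAM.State) (e : RAM.Expr) (M : ℕ),
    e.cost t ≤ M → RAM.len (e.eval t) ≤ M → (address k e).cost t ≤ κ * (M + 1) ∧
      RAM.len ((address k e).eval t) ≤ κ * (M + 1) := by
  have hidx : ∀ (t : RAM.State) (e : RAM.Expr) (M : ℕ), e.cost t ≤ M →
      RAM.len (e.eval t) ≤ M → (index e).cost t ≤ 6 * M + 20 ∧
      RAM.len ((index e).eval t) ≤ 2 * M + 20 := by
    intro t e M h1 h2
    have l0 : RAM.len 0 = 1 := by decide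
    have l1 : RAM.len 1 = 2 := by decide
    have a := RAM.len_apply_le .lt (e.eval t) 0
    have b := RAM.len_apply_le .sub 1 (RAM.BinOp.lt.apply (e.eval t) 0)
    have c := RAM.len_apply_le .mul (e.eval t)
      (RAM.BinOp.sub.apply 1 (RAM.BinOp.lt.apply (e.eval t) 0))
    simp only [index, RAM.Expr.cost, RAM.Expr.eval, l0, l1] at *
    omega
  cases k with
  | zero =>
    refine ⟨20, fun t e M h1 h2 => ?_⟩
    have := hidx t e M h1 h2
    simp only [address]; omega
  | succ k =>
    refine ⟨300 + 20 * RAM.len (2 ^ k), fun t e M h1 h2 => ?_⟩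
    obtain ⟨c1, c2⟩ := hidx t e M h1 h2
    have l0 : RAM.len 0 = 1 := by decide
    have l1 : RAM.len 1 = 2 := by decide
    have l2 : RAM.len 2 = 3 := by decide
    have a1 := RAM.len_apply_le .mul 2 ((index e).eval t)
    have a2 := RAM.len_apply_le .add (RAM.BinOp.mul.apply 2 ((index e).eval t)) 1
    have a3 := RAM.len_apply_le .mul (2 ^ k)
      (RAM.BinOp.add.apply (RAM.BinOp.mul.apply 2 ((index e).eval t)) 1)
    have a4 := RAM.len_apply_le .sub 0 (RAM.BinOp.mul.apply (2 ^ k)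
      (RAM.BinOp.add.apply (RAM.BinOp.mul.apply 2 ((index e).eval t)) 1))
    have e1 : (300 + 20 * RAM.len (2 ^ k)) * (M + 1)
      = 300 * M + 300 + 20 * (RAM.len (2 ^ k) * M) + 20 * RAM.len (2 ^ k) := by ring
    simp only [address, RAM.Expr.cost, RAM.Expr.eval, l0, l1, l2] at *
    rw [e1]
    omega

/-- An expression is fixed syntax, so its intermediate values are longer than the stored numbers by
a constant factor only. This is why `Cmd.Safe` restricts only the values that are assigned. -/
theorem Ex.exists_cost (e : Ex) : ∃ κ, ∀ (L : ℕ) (s : St) (t : RAM.State), Rep s t → s.Bdd L →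
    e.toRAM.cost t ≤ κ * (L + 1) ∧ RAM.len (e.eval s) ≤ κ * (L + 1) := by
  induction e with
  | const z =>
    refine ⟨RAM.len z, fun L s t _ _ => ?_⟩
    have : RAM.len z ≤ RAM.len z * (L + 1) := Nat.le_mul_of_pos_right _ (by omega)
    exact ⟨this, this⟩
  | reg x =>
    refine ⟨1, fun L s t h hb => ?_⟩
    have := RAM.len_le_of_abs_lt (hb.1 x)
    simp only [Ex.toRAM, RAM.Expr.cost, h.reg, Ex.eval, one_mul]
    exact ⟨this, this⟩
  | get k e ih =>
    obtain ⟨κ, ih⟩ := ih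
    obtain ⟨κ', ha⟩ := exists_address_cost k
    refine ⟨2 * (κ' * (κ + 1)) + 1, fun L s t h hb => ?_⟩
    obtain ⟨h1, h2⟩ := ih L s t h hb
    rw [← h.eval] at h2
    obtain ⟨h3, h4⟩ := ha t _ _ h1 h2
    have h5 := RAM.len_le_of_abs_lt (hb.2 k (e.eval s).toNat)
    have h6 : κ' * (κ * (L + 1) + 1) ≤ κ' * (κ + 1) * (L + 1) := by
      rw [mul_assoc]; gcongr; nlinarith
    have e1 : (2 * (κ' * (κ + 1)) + 1) * (L + 1) = 2 * (κ' * (κ + 1) * (L + 1)) + (L + 1) := by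
      ring
    simp only [Ex.toRAM, RAM.Expr.cost, Ex.eval]
    rw [e1]
    rw [eval_address, h.eval] at h4 ⊢
    rw [h.mem]
    omega
  | bin o a b iha ihb =>
    obtain ⟨κ, iha⟩ := iha
    obtain ⟨κ', ihb⟩ := ihb
    refine ⟨2 * κ + 2 * κ', fun L s t h hb => ?_⟩
    obtain ⟨h1, h2⟩ := iha L s t h hb
    obtain ⟨h3, h4⟩ := ihb L s t h hb
    have h5 := RAM.len_apply_le o (a.eval s) (b.eval s)
    have e1 : (2 * κ + 2 * κ') * (L + 1) = 2 * (κ * (L + 1)) + 2 * (κ' * (L + 1)) := by ring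
    simp only [Ex.toRAM, RAM.Expr.cost, h.eval, Ex.eval]
    rw [e1]
    omega

theorem exists_address_cost' (k : ℕ) (i : Ex) : ∃ κ, ∀ (L : ℕ) (s : St) (t : RAM.State),
    Rep s t → s.Bdd L → (address k i.toRAM).cost t ≤ κ * (L + 1) ∧
      RAM.len ((address k i.toRAM).eval t) ≤ κ * (L + 1) := by
  obtain ⟨κ, hi⟩ := i.exists_cost
  obtain ⟨κ', ha⟩ := exists_address_cost k
  refine ⟨κ' * (κ + 1), fun L s t h hb => ?_⟩
  obtain ⟨h1, h2⟩ := hi L s t h hb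
  rw [← h.eval] at h2
  obtain ⟨h3, h4⟩ := ha t _ _ h1 h2
  have h6 : κ' * (κ * (L + 1) + 1) ≤ κ' * (κ + 1) * (L + 1) := by
    rw [mul_assoc]; gcongr; nlinarith
  omega

theorem Rep.setReg {s : St} {t : RAM.State} (h : Rep s t) (x : ℕ) (z : ℤ) :
    Rep (s.setReg x z) { t with reg := Function.update t.reg (rho x) z } := by
  refine ⟨fun y => ?_, h.mem, h.pos⟩
  by_cases hy : y = x
  · subst hy; simp [St.setReg]
  · simp [St.setReg, hy, rho_injective.ne hy, h.reg]

theorem Rep.setHidden {s : St} {t : RAM.State} (h : Rep s t) {y : ℕ} (hy : ∀ x, rho x ≠ y)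
    (z : ℤ) : Rep s { t with reg := Function.update t.reg y z } :=
  ⟨fun x => by simp [hy x, h.reg], h.mem, h.pos⟩

theorem Rep.setArr {s : St} {t : RAM.State} (h : Rep s t) (k i : ℕ) (z : ℤ) :
    Rep (s.setArr k i z) { t with mem := Function.update t.mem (addr k i) z } := by
  refine ⟨h.reg, fun k' i' => ?_, h.pos⟩
  by_cases hk : k' = k
  · subst hk
    by_cases hi : i' = i
    · subst hi; simp [St.setArr]
    · have : addr k' i' ≠ addr k' i := fun e => hi (addr_injective e).2
      simp [St.setArr, hi, this, h.mem]
  · have : addr k' i' ≠ addr k i := fun e => hk (addr_injective e).1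
    simp [St.setArr, hk, this, h.mem]

theorem St.Bdd.setReg {L : ℕ} {s : St} (h : s.Bdd L) (x : ℕ) {z : ℤ} (hz : |z| < 2 ^ L) :
    (s.setReg x z).Bdd L := by
  refine ⟨fun y => ?_, h.2⟩
  by_cases hy : y = x
  · subst hy; simpa [St.setReg] using hz
  · simpa [St.setReg, hy] using h.1 y

theorem St.Bdd.setArr {L : ℕ} {s : St} (h : s.Bdd L) (k i : ℕ) {z : ℤ} (hz : |z| < 2 ^ L) :
    (s.setArr k i z).Bdd L := by
  refine ⟨h.1, fun k' i' => ?_⟩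
  by_cases hk : k' = k
  · subst hk
    by_cases hi : i' = i
    · subst hi; simpa [St.setArr] using hz
    · simpa [St.setArr, hi] using h.2 k' i'
  · simpa [St.setArr, hk] using h.2 k' i'

theorem rho_ne_hidden (x d : ℕ) : rho x ≠ 4 * d + 3 ∧ rho x ≠ 4 * d + 5 := by
  unfold rho; split_ifs <;> omega

/-- An elementary step handles boundedly many numbers of `O(L)` digits, with a constant depending on
the command alone. The last clause protects the control registers of the enclosing loops; the loop
case applies it to its body at depth `d + 1`. -/
theorem Cmd.exists_exec (c : Cmd) : ∃ κ, ∀ (ω : ℕ → Bool) (L d : ℕ) (s : St) (t : RAM.State),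
    Rep s t → s.Bdd L → c.Safe L ω s → ∃ T t', RAM.Exec ω (c.toRAM d) t T t' ∧
      T ≤ κ * (L + 1) * c.steps ω s ∧ Rep (c.run ω s) t' ∧ (c.run ω s).Bdd L ∧
      ∀ d' < d, t'.reg (4 * d' + 3) = t.reg (4 * d' + 3) ∧
        t'.reg (4 * d' + 5) = t.reg (4 * d' + 5) := by
  induction c with
  | skip =>
    refine ⟨1, fun ω L d s t h hb _ => ⟨1, t, .skip t, ?_, h, hb, fun _ _ => ⟨rfl, rfl⟩⟩⟩
    simp only [Cmd.steps]; omega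
  | set x e =>
    obtain ⟨κ, hκ⟩ := e.exists_cost
    refine ⟨2 * κ, fun ω L d s t h hb hs => ⟨_, _, .assign t (rho x) e.toRAM, ?_, ?_, ?_, ?_⟩⟩
    · obtain ⟨h1, h2⟩ := hκ L s t h hb
      rw [h.eval]
      simp only [Cmd.steps]; linarith
    · rw [h.eval]; exact h.setReg x _
    · exact hb.setReg x hs
    · intro d' _
      simp [(rho_ne_hidden x d').1.symm, (rho_ne_hidden x d').2.symm]
  | put k i e =>
    obtain ⟨κ, hκ⟩ := e.exists_cost
    obtain ⟨κ', hκ'⟩ := exists_address_cost' k i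
    refine ⟨2 * κ + 2 * κ', fun ω L d s t h hb hs =>
      ⟨_, _, .store t (address k i.toRAM) e.toRAM, ?_, ?_, ?_, fun _ _ => ⟨rfl, rfl⟩⟩⟩
    · obtain ⟨h1, h2⟩ := hκ L s t h hb
      obtain ⟨h3, h4⟩ := hκ' L s t h hb
      rw [h.eval]
      simp only [Cmd.steps]; linarith
    · rw [h.eval, eval_address, h.eval]; exact h.setArr k _ _
    · exact hb.setArr k _ hs
  | flip x =>
    refine ⟨1, fun ω L d s t h hb hs => ⟨_, _, .flip t (rho x), ?_, ?_, ?_, ?_⟩⟩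
    · simp only [Cmd.steps]; omega
    · have := h.setReg x (if ω t.pos then 1 else 0)
      refine ⟨fun y => ?_, this.mem, ?_⟩
      · rw [this.reg y, h.pos]; rfl
      · simp [Cmd.run, St.flip, h.pos]
    · refine (hb.setReg x (z := if ω s.pos then 1 else 0) ?_)
      have : (1 : ℤ) < 2 ^ L := one_lt_pow₀ (by norm_num) (Nat.pos_iff_ne_zero.1 hs)
      split_ifs <;> simp [this]
    · intro d' _
      simp [(rho_ne_hidden x d').1.symm, (rho_ne_hidden x d').2.symm]
  | seq p q ihp ihq =>
    obtain ⟨κ, hp⟩ := ihp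
    obtain ⟨κ', hq⟩ := ihq
    refine ⟨κ + κ', fun ω L d s t h hb hs => ?_⟩
    obtain ⟨T₁, t₁, e₁, c₁, r₁, b₁, f₁⟩ := hp ω L d s t h hb hs.1
    obtain ⟨T₂, t₂, e₂, c₂, r₂, b₂, f₂⟩ := hq ω L d _ t₁ r₁ b₁ hs.2
    refine ⟨_, t₂, .seq e₁ e₂, ?_, r₂, b₂, fun d' hd => ?_⟩
    · simp only [Cmd.steps]
      calc T₁ + T₂ ≤ κ * (L + 1) * p.steps ω s + κ' * (L + 1) * q.steps ω (p.run ω s) := by omega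
        _ ≤ (κ + κ') * (L + 1) * p.steps ω s + (κ + κ') * (L + 1) * q.steps ω (p.run ω s) := by
            gcongr <;> omega
        _ = _ := by ring
    · rw [(f₂ d' hd).1, (f₂ d' hd).2]; exact f₁ d' hd
  | ite e p q ihp ihq =>
    obtain ⟨κ, hp⟩ := ihp
    obtain ⟨κ', hq⟩ := ihq
    obtain ⟨κe, he⟩ := e.exists_cost
    refine ⟨κ + κ' + κe + 1, fun ω L d s t h hb hs => ?_⟩
    obtain ⟨h1, -⟩ := he L s t h hb
    have e1 : (κ + κ' + κe + 1) * (L + 1) = κ * (L + 1) + κ' * (L + 1) + κe * (L + 1) + L + 1 := by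
      ring
    by_cases hc : e.eval s ≠ 0
    · simp only [Cmd.Safe, if_pos hc] at hs
      obtain ⟨T₁, t₁, e₁, c₁, r₁, b₁, f₁⟩ := hp ω L d s t h hb hs
      refine ⟨_, t₁, .ite_true (by rwa [h.eval]) e₁, ?_, ?_, ?_, f₁⟩
      · simp only [Cmd.steps, if_pos hc, mul_add, e1, mul_one]
        have : κ * (L + 1) * p.steps ω s ≤
          (κ * (L + 1) + κ' * (L + 1) + κe * (L + 1) + L + 1) * p.steps ω s := by
            gcongr; omega
        simp only [mul_add, mul_one] at *
        omega
      · simpa only [Cmd.run, if_pos hc] using r₁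
      · simpa only [Cmd.run, if_pos hc] using b₁
    · simp only [Cmd.Safe, if_neg hc] at hs
      obtain ⟨T₁, t₁, e₁, c₁, r₁, b₁, f₁⟩ := hq ω L d s t h hb hs
      refine ⟨_, t₁, .ite_false (by rw [h.eval]; exact not_not.1 hc) e₁, ?_, ?_, ?_, f₁⟩
      · simp only [Cmd.steps, if_neg hc, mul_add, e1, mul_one]
        have : κ' * (L + 1) * q.steps ω s ≤
          (κ * (L + 1) + κ' * (L + 1) + κe * (L + 1) + L + 1) * q.steps ω s := by
            gcongr; omega
        simp only [mul_add, mul_one] at *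
        omega
      · simpa only [Cmd.run, if_neg hc] using r₁
      · simpa only [Cmd.run, if_neg hc] using b₁
  | loop x e p ih =>
    obtain ⟨κ, hp⟩ := ih
    obtain ⟨κe, he⟩ := e.exists_cost
    refine ⟨κ + 20 * κe + 30, fun ω L d s t h hb hs => ?_⟩
    obtain ⟨hN, hs⟩ := hs
    obtain ⟨h1, h2⟩ := he L s t h hb
    set N := (e.eval s).toNat with hNdef
    set st : ℕ → St := iter (fun i s => p.run ω (s.setReg x i)) s with hst
    have l0 : RAM.len 0 = 1 := by decide
    have l1 : RAM.len 1 = 2 := by decide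
    have hlen : ∀ j ≤ N, RAM.len (j : ℤ) ≤ κe * (L + 1) + 1 := by
      intro j hj
      rcases Nat.eq_zero_or_pos N with h0 | h0
      · have : j = 0 := by omega
        subst this; simp [l0]
      · refine (RAM.len_mono (b := e.eval s) ?_).trans (by omega)
        rw [abs_of_nonneg (by omega), abs_of_nonneg (by omega)]; omega
    set lp : RAM.Prog := (.loop (.bin .lt (.reg (4 * d + 3)) (.reg (4 * d + 5)))
        (.seq (.assign (rho x) (.reg (4 * d + 3))) (.seq (p.toRAM (d + 1))
          (.assign (4 * d + 3) (.bin .add (.reg (4 * d + 3)) (.const 1)))))) with hlp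
    -- Induction on the number `r` of rounds that remain, starting from an arbitrary round `j`.
    have key : ∀ r j : ℕ, j + r = N → ∀ t : RAM.State, Rep (st j) t → (st j).Bdd L →
        t.reg (4 * d + 3) = j → t.reg (4 * d + 5) = e.eval s →
        ∃ T t', RAM.Exec ω lp t T t' ∧ T ≤ (κ + 15 * κe + 20) * (L + 1) *
          (1 + ∑ i ∈ Finset.range r, (1 + p.steps ω ((st (j + i)).setReg x ((j + i : ℕ) : ℤ)))) ∧
          Rep (st N) t' ∧ (st N).Bdd L ∧
          ∀ d' < d, t'.reg (4 * d' + 3) = t.reg (4 * d' + 3) ∧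
            t'.reg (4 * d' + 5) = t.reg (4 * d' + 5) := by
      intro r
      induction r with
      | zero =>
        intro j hj t hR hB hc hl
        obtain rfl : N = j := by omega
        refine ⟨_, t, .loop_false ?_, ?_, hR, hB, fun _ _ => ⟨rfl, rfl⟩⟩
        · simp only [RAM.Expr.eval, RAM.BinOp.apply, hc, hl]
          rw [if_neg (by omega)]
        · have := hlen N le_rfl
          simp only [RAM.Expr.cost, RAM.Expr.eval, hc, hl, Finset.range_zero, Finset.sum_empty]
          nlinarith
      | succ r ihr =>
        intro j hj t hR hB hc hl
        have hjN : j < N := by omega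
        have hR1 := hR.setReg x (j : ℤ)
        have hjL : |(j : ℤ)| < 2 ^ L := by
          rw [abs_of_nonneg (by omega)]
          exact_mod_cast lt_of_lt_of_le hjN hN
        have hB1 := hB.setReg x hjL
        obtain ⟨T₁, t₁, e₁, c₁, r₁, b₁, f₁⟩ := hp ω L (d + 1) _ _ hR1 hB1 (hs j hjN)
        have fd := f₁ d (by omega)
        have n1 := rho_ne_hidden x d
        simp only [Function.update_of_ne n1.1.symm, Function.update_of_ne n1.2.symm, hc, hl] at fd
        have hR2 : Rep (st (j + 1)) { t₁ with
            reg := Function.update t₁.reg (4 * d + 3) ((j + 1 : ℕ) : ℤ) } :=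
          Rep.setHidden r₁ (fun x => (rho_ne_hidden x d).1) _
        obtain ⟨T₂, t₂, e₂, c₂, r₂, b₂, f₂⟩ := ihr (j + 1) (by omega) _ hR2 b₁ (by simp)
          (by simp [fd.2])
        have ea := RAM.Exec.assign (ω := ω) t (rho x) (.reg (4 * d + 3))
        have ec := RAM.Exec.assign (ω := ω) t₁ (4 * d + 3)
          (.bin .add (.reg (4 * d + 3)) (.const 1))
        have ev : (RAM.Expr.bin .add (.reg (4 * d + 3)) (.const 1)).eval t₁
            = ((j + 1 : ℕ) : ℤ) := by
          simp [RAM.Expr.eval, RAM.BinOp.apply, fd.1]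
        rw [ev] at ec
        have ev' : (RAM.Expr.reg (4 * d + 3)).eval t = j := by simp [RAM.Expr.eval, hc]
        rw [ev'] at ea
        refine ⟨_, t₂, .loop_true ?_ (.seq ea (.seq e₁ ec)) e₂, ?_, r₂, b₂, fun d' hd => ?_⟩
        · simp only [RAM.Expr.eval, RAM.BinOp.apply, hc, hl]
          rw [if_pos (by omega)]; norm_num
        · have g1 := hlen j hjN.le
          have g2 := hlen (j + 1) hjN
          have hsum : ∑ i ∈ Finset.range (r + 1),
              (1 + p.steps ω ((st (j + i)).setReg x ((j + i : ℕ) : ℤ)))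
              = (∑ i ∈ Finset.range r,
              (1 + p.steps ω ((st (j + 1 + i)).setReg x ((j + 1 + i : ℕ) : ℤ))))
              + (1 + p.steps ω ((st j).setReg x (j : ℤ))) := by
            rw [Finset.sum_range_succ']
            simp only [add_zero]
            congr 1
            refine Finset.sum_congr rfl fun i _ => ?_
            rw [show j + (i + 1) = j + 1 + i by ring]
          rw [hsum]
          simp only [RAM.Expr.cost, RAM.Expr.eval, hc, hl, fd.1, l1]
          generalize (∑ i ∈ Finset.range r,
              (1 + p.steps ω ((st (j + 1 + i)).setReg x ((j + 1 + i : ℕ) : ℤ)))) = A at *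
          generalize p.steps ω ((st j).setReg x (j : ℤ)) = P at *
          have e3 : (κ + 15 * κe + 20) * (L + 1) * (1 + (A + (1 + P)))
            = (κ + 15 * κe + 20) * (L + 1) * (1 + A) + κ * (L + 1) * P
              + (15 * κe + 20) * (L + 1) * P + (κ + 15 * κe + 20) * (L + 1) := by ring
          have e4 : (κ + 15 * κe + 20) * (L + 1)
            = κ * (L + 1) + 15 * (κe * (L + 1)) + 20 * L + 20 := by ring
          rw [e3]
          have : 0 ≤ (15 * κe + 20) * (L + 1) * P := Nat.zero_le _
          omega
        · have n3 := rho_ne_hidden x d'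
          have q1 := f₂ d' hd
          have q2 := f₁ d' (by omega)
          simp only [Function.update_of_ne n3.1.symm, Function.update_of_ne n3.2.symm] at q2
          simp only at q1
          rw [Function.update_of_ne (by omega), Function.update_of_ne (by omega)] at q1
          rw [q1.1, q1.2]; exact q2
    have ea := RAM.Exec.assign (ω := ω) t (4 * d + 5) e.toRAM
    rw [h.eval] at ea
    have hR1 := h.setHidden (fun x => (rho_ne_hidden x d).2) (e.eval s)
    have eb := RAM.Exec.assign (ω := ω)
      { t with reg := Function.update t.reg (4 * d + 5) (e.eval s) } (4 * d + 3) (.const 0)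
    have hR2 := hR1.setHidden (fun x => (rho_ne_hidden x d).1) 0
    obtain ⟨T, t', ex, c₁, r₁, b₁, f₁⟩ := key N 0 (by omega) _ hR2 hb (by simp) (by simp)
    refine ⟨_, t', .seq ea (.seq eb ex), ?_, r₁, b₁, fun d' hd => ?_⟩
    · simp only [RAM.Expr.cost, RAM.Expr.eval, l0, Cmd.steps]
      simp only [zero_add] at c₁
      rw [← hNdef, ← hst]
      generalize (∑ i ∈ Finset.range N, (1 + p.steps ω ((st i).setReg x (i : ℤ)))) = A at *
      have e3 : (κ + 20 * κe + 30) * (L + 1) * (1 + A) = (κ + 15 * κe + 20) * (L + 1) * (1 + A) +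
        (5 * (κe * (L + 1)) + 10 * L + 10) + (5 * κe + 10) * (L + 1) * A := by ring
      rw [e3]
      have : 0 ≤ (5 * κe + 10) * (L + 1) * A := Nat.zero_le _
      omega
    · have q1 := f₁ d' hd
      simp only at q1
      rw [Function.update_of_ne (by omega), Function.update_of_ne (by omega),
        Function.update_of_ne (by omega), Function.update_of_ne (by omega)] at q1
      exact q1

end StructuredRAM

/-! ### Hoare rules with step counts for the structured language. -/

namespace StructuredRAM

/-- The values of the comparison operations. -/
def ltZ (a b : ℤ) : ℤ := if a < b then 1 else 0
def eqZ (a b : ℤ) : ℤ := if a = b then 1 else 0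

theorem ltZ_of_le {a b : ℤ} (h : b ≤ a) : ltZ a b = 0 := if_neg (not_lt.2 h)
theorem eqZ_of_eq {a b : ℤ} (h : a = b) : eqZ a b = 1 := if_pos h
theorem eqZ_of_ne {a b : ℤ} (h : a ≠ b) : eqZ a b = 0 := if_neg h
theorem ltZ_ne_zero {a b : ℤ} : ltZ a b ≠ 0 ↔ a < b := by unfold ltZ; split_ifs <;> simp_all
theorem eqZ_ne_zero {a b : ℤ} : eqZ a b ≠ 0 ↔ a = b := by unfold eqZ; split_ifs <;> simp_all

instance : Add Ex := ⟨.bin .add⟩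
instance : Sub Ex := ⟨.bin .sub⟩
instance : Mul Ex := ⟨.bin .mul⟩
instance : Div Ex := ⟨.bin .div⟩
instance : Mod Ex := ⟨.bin .mod⟩
instance (n : ℕ) : OfNat Ex n := ⟨.const n⟩
def Ex.lt (a b : Ex) : Ex := .bin .lt a b
def Ex.eq (a b : Ex) : Ex := .bin .eq a b

@[simp] theorem eval_add (s : St) (a b : Ex) : (a + b).eval s = a.eval s + b.eval s := rfl
@[simp] theorem eval_sub (s : St) (a b : Ex) : (a - b).eval s = a.eval s - b.eval s := rfl
@[simp] theorem eval_mul (s : St) (a b : Ex) : (a * b).eval s = a.eval s * b.eval s := rfl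
@[simp] theorem eval_div (s : St) (a b : Ex) : (a / b).eval s = a.eval s / b.eval s := rfl
@[simp] theorem eval_mod (s : St) (a b : Ex) : (a % b).eval s = a.eval s % b.eval s := rfl
@[simp] theorem eval_lt (s : St) (a b : Ex) : (a.lt b).eval s = ltZ (a.eval s) (b.eval s) := rfl
@[simp] theorem eval_eq (s : St) (a b : Ex) : (a.eq b).eval s = eqZ (a.eval s) (b.eval s) := rfl
@[simp] theorem eval_reg (s : St) (x : ℕ) : (Ex.reg x).eval s = s.reg x := rfl
@[simp] theorem eval_const (s : St) (z : ℤ) : (Ex.const z).eval s = z := rfl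
@[simp] theorem eval_get (s : St) (k : ℕ) (e : Ex) :
    (Ex.get k e).eval s = s.arr k (e.eval s).toNat := rfl
@[simp] theorem eval_zero (s : St) : (0 : Ex).eval s = 0 := rfl
@[simp] theorem eval_one (s : St) : (1 : Ex).eval s = 1 := rfl
@[simp] theorem eval_ofNat (s : St) (n : ℕ) [n.AtLeastTwo] :
    (ofNat(n) : Ex).eval s = OfNat.ofNat n := rfl

@[simp] theorem setReg_reg (s : St) (x : ℕ) (z : ℤ) (y : ℕ) :
    (s.setReg x z).reg y = if y = x then z else s.reg y := by
  simp [St.setReg, Function.update_apply]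
@[simp] theorem setReg_arr (s : St) (x : ℕ) (z : ℤ) : (s.setReg x z).arr = s.arr := rfl
@[simp] theorem setReg_pos (s : St) (x : ℕ) (z : ℤ) : (s.setReg x z).pos = s.pos := rfl
@[simp] theorem setArr_reg (s : St) (k i : ℕ) (z : ℤ) : (s.setArr k i z).reg = s.reg := rfl
@[simp] theorem setArr_pos (s : St) (k i : ℕ) (z : ℤ) : (s.setArr k i z).pos = s.pos := rfl
theorem setArr_arr (s : St) (k i : ℕ) (z : ℤ) (k' i' : ℕ) :
    (s.setArr k i z).arr k' i' = if k' = k ∧ i' = i then z else s.arr k' i' := by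
  by_cases hk : k' = k
  · subst hk; simp [St.setArr, Function.update_apply]
  · simp [St.setArr, hk]
@[simp] theorem setArr_arr_self (s : St) (k i : ℕ) (z : ℤ) (i' : ℕ) :
    (s.setArr k i z).arr k i' = if i' = i then z else s.arr k i' := by
  simp [setArr_arr]
theorem setArr_arr_ne (s : St) {k k' : ℕ} (h : k' ≠ k) (i : ℕ) (z : ℤ) :
    (s.setArr k i z).arr k' = s.arr k' := by
  simp [St.setArr, h]
@[simp] theorem flip_reg (s : St) (ω : ℕ → Bool) (x y : ℕ) :
    (s.flip ω x).reg y = if y = x then (if ω s.pos then 1 else 0) else s.reg y := by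
  simp [St.flip, Function.update_apply]
@[simp] theorem flip_arr (s : St) (ω : ℕ → Bool) (x : ℕ) : (s.flip ω x).arr = s.arr := rfl
@[simp] theorem flip_pos (s : St) (ω : ℕ → Bool) (x : ℕ) : (s.flip ω x).pos = s.pos + 1 := rfl

def Cmd.regs : Cmd → List ℕ
  | .skip => []
  | .set x _ => [x]
  | .put _ _ _ => []
  | .flip x => [x]
  | .seq p q => p.regs ++ q.regs
  | .ite _ p q => p.regs ++ q.regs
  | .loop x _ p => x :: p.regs

def Cmd.arrs : Cmd → List ℕ
  | .skip => []
  | .set _ _ => []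
  | .put k _ _ => [k]
  | .flip _ => []
  | .seq p q => p.arrs ++ q.arrs
  | .ite _ p q => p.arrs ++ q.arrs
  | .loop _ _ p => p.arrs

def Cmd.coinFree : Cmd → Bool
  | .flip _ => false
  | .seq p q => p.coinFree && q.coinFree
  | .ite _ p q => p.coinFree && q.coinFree
  | .loop _ _ p => p.coinFree
  | _ => true

/-- `s'` differs from `s` only in what the program `c` may change. -/
structure Same (c : Cmd) (s s' : St) : Prop where
  reg : ∀ x, x ∉ c.regs → s'.reg x = s.reg x
  arr : ∀ k, k ∉ c.arrs → s'.arr k = s.arr k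
  pos : c.coinFree = true → s'.pos = s.pos

theorem Same.rfl {c : Cmd} {s : St} : Same c s s := ⟨fun _ _ => _root_.rfl, fun _ _ => _root_.rfl, fun _ => _root_.rfl⟩

theorem Same.trans {c : Cmd} {s s' s'' : St} (h : Same c s s') (h' : Same c s' s'') :
    Same c s s'' :=
  ⟨fun x hx => (h'.reg x hx).trans (h.reg x hx), fun x hx => (h'.arr x hx).trans (h.arr x hx),
    fun hc => (h'.pos hc).trans (h.pos hc)⟩

theorem Same.mono {c c' : Cmd} {s s' : St} (h : Same c s s') (h1 : c.regs ⊆ c'.regs)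
    (h2 : c.arrs ⊆ c'.arrs) (h3 : c'.coinFree = true → c.coinFree = true) : Same c' s s' :=
  ⟨fun x hx => h.reg x (fun e => hx (h1 e)), fun x hx => h.arr x (fun e => hx (h2 e)),
    fun hc => h.pos (h3 hc)⟩

theorem Same.setReg_loop (x : ℕ) (e : Ex) (p : Cmd) (s : St) (z : ℤ) :
    Same (.loop x e p) s (s.setReg x z) := by
  refine ⟨fun y hy => ?_, fun _ _ => _root_.rfl, fun _ => _root_.rfl⟩
  simp only [Cmd.regs, List.mem_cons, not_or] at hy
  simp [hy.1]

theorem same_run (ω : ℕ → Bool) (c : Cmd) (s : St) : Same c s (c.run ω s) := by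
  induction c generalizing s with
  | skip => exact Same.rfl
  | set x e =>
    refine ⟨fun y hy => ?_, fun _ _ => rfl, fun _ => rfl⟩
    simp only [Cmd.regs, List.mem_singleton] at hy
    simp [Cmd.run, hy]
  | put k i e =>
    refine ⟨fun _ _ => rfl, fun y hy => ?_, fun _ => rfl⟩
    simp only [Cmd.arrs, List.mem_singleton] at hy
    simp [Cmd.run, setArr_arr_ne _ hy]
  | flip x =>
    refine ⟨fun y hy => ?_, fun _ _ => rfl, fun h => by simp [Cmd.coinFree] at h⟩
    simp only [Cmd.regs, List.mem_singleton] at hy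
    simp [Cmd.run, hy]
  | seq p q ihp ihq =>
    refine ((ihp s).mono ?_ ?_ ?_).trans ((ihq _).mono ?_ ?_ ?_) <;>
      simp [Cmd.regs, Cmd.arrs, Cmd.coinFree] <;> tauto
  | ite e p q ihp ihq =>
    simp only [Cmd.run]
    split_ifs
    · refine (ihp s).mono ?_ ?_ ?_ <;> simp [Cmd.regs, Cmd.arrs, Cmd.coinFree] <;> tauto
    · refine (ihq s).mono ?_ ?_ ?_ <;> simp [Cmd.regs, Cmd.arrs, Cmd.coinFree]
  | loop x e p ih =>
    simp only [Cmd.run]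
    generalize (e.eval s).toNat = N
    induction N with
    | zero => exact Same.rfl
    | succ N ihN =>
      refine ihN.trans ((Same.setReg_loop x e p _ N).trans ((ih _).mono ?_ ?_ ?_)) <;>
        simp [Cmd.regs, Cmd.arrs, Cmd.coinFree]

/-- A run of `c` from `s` is safe, takes at most `T` steps and ends in a state satisfying `Q`. -/
def Tri (L : ℕ) (ω : ℕ → Bool) (c : Cmd) (s : St) (T : ℕ) (Q : St → Prop) : Prop :=
  c.Safe L ω s ∧ c.steps ω s ≤ T ∧ Q (c.run ω s)

section rules

variable {L : ℕ} {ω : ℕ → Bool}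

/-- The relation `Same` hands over the frame: a postcondition mentions only what is new, and
whatever the syntax of `c` cannot write is recovered from `Same`. -/
theorem Tri.mono {c : Cmd} {s : St} {T T' : ℕ} {Q Q' : St → Prop} (h : Tri L ω c s T Q)
    (hT : T ≤ T') (hQ : ∀ s', Same c s s' → Q s' → Q' s') : Tri L ω c s T' Q' :=
  ⟨h.1, h.2.1.trans hT, hQ _ (same_run ω c s) h.2.2⟩

theorem Tri.conseq {c : Cmd} {s : St} {T : ℕ} {Q Q' : St → Prop} (h : Tri L ω c s T Q)
    (hQ : ∀ s', Same c s s' → Q s' → Q' s') : Tri L ω c s T Q' := h.mono le_rfl hQ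

theorem Tri.skip {s : St} {Q : St → Prop} (h : Q s) : Tri L ω .skip s 1 Q := ⟨trivial, le_rfl, h⟩

theorem Tri.set {x : ℕ} {e : Ex} {s : St} {Q : St → Prop} (z : ℤ) (hz : e.eval s = z)
    (hL : |z| < 2 ^ L) (hQ : Q (s.setReg x z)) : Tri L ω (.set x e) s 1 Q := by
  subst hz; exact ⟨hL, le_rfl, hQ⟩

theorem Tri.put {k : ℕ} {i e : Ex} {s : St} {Q : St → Prop} (j : ℕ) (z : ℤ) (hj : i.eval s = j)
    (hz : e.eval s = z) (hL : |z| < 2 ^ L) (hQ : Q (s.setArr k j z)) :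
    Tri L ω (.put k i e) s 1 Q := by
  subst hz
  refine ⟨hL, le_rfl, ?_⟩
  simpa [Cmd.run, hj] using hQ

theorem Tri.flip {x : ℕ} {s : St} {Q : St → Prop} (hL : 0 < L) (hQ : Q (s.flip ω x)) :
    Tri L ω (.flip x) s 1 Q := ⟨hL, le_rfl, hQ⟩

theorem Tri.seq {p q : Cmd} {s : St} {T T' : ℕ} {Q Q' : St → Prop} (hp : Tri L ω p s T Q')
    (hq : ∀ s', Same p s s' → Q' s' → Tri L ω q s' T' Q) : Tri L ω (.seq p q) s (T + T') Q := by
  have := hq _ (same_run ω p s) hp.2.2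
  exact ⟨⟨hp.1, this.1⟩, Nat.add_le_add hp.2.1 this.2.1, this.2.2⟩

theorem Tri.ite {e : Ex} {p q : Cmd} {s : St} {T : ℕ} {Q : St → Prop}
    (hp : e.eval s ≠ 0 → Tri L ω p s T Q) (hq : e.eval s = 0 → Tri L ω q s T Q) :
    Tri L ω (.ite e p q) s (1 + T) Q := by
  by_cases h : e.eval s ≠ 0
  · have := hp h
    exact ⟨by simpa only [Cmd.Safe, if_pos h] using this.1,
      by simpa only [Cmd.steps, if_pos h] using Nat.add_le_add_left this.2.1 1,
      by simpa only [Cmd.run, if_pos h] using this.2.2⟩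
  · have := hq (not_not.1 h)
    exact ⟨by simpa only [Cmd.Safe, if_neg h] using this.1,
      by simpa only [Cmd.steps, if_neg h] using Nat.add_le_add_left this.2.1 1,
      by simpa only [Cmd.run, if_neg h] using this.2.2⟩

/-- The invariant describes the state between rounds. It has to be insensitive to the loop variable,
which is set before each round. -/
theorem Tri.loop_sum {x : ℕ} {e : Ex} {p : Cmd} {s : St} (I : ℕ → St → Prop) (N : ℕ) (T : ℕ → ℕ)
    (hN : e.eval s = N) (hL : N ≤ 2 ^ L) (h0 : I 0 s)
    (hx : ∀ i s z, I i s → I i (s.setReg x z))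
    (hp : ∀ i < N, ∀ s', Same (.loop x e p) s s' → s'.reg x = (i : ℤ) → I i s' →
      Tri L ω p s' (T i) (I (i + 1))) :
    Tri L ω (.loop x e p) s (1 + ∑ i ∈ Finset.range N, (1 + T i)) (I N) := by
  have hN' : (e.eval s).toNat = N := by rw [hN]; rfl
  set st : ℕ → St := iter (fun i s => p.run ω (s.setReg x i)) s with hst
  have key : ∀ i ≤ N, Same (.loop x e p) s (st i) ∧ I i (st i) := by
    intro i
    induction i with
    | zero => exact fun _ => ⟨Same.rfl, h0⟩
    | succ i ih =>
      intro hi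
      obtain ⟨h1, h2⟩ := ih (by omega)
      have h3 := h1.trans (Same.setReg_loop x e p _ (i : ℤ))
      have h4 := hp i (by omega) _ h3 (by simp) (hx i _ _ h2)
      refine ⟨h3.trans ((same_run ω p _).mono ?_ ?_ ?_), h4.2.2⟩ <;>
        simp [Cmd.regs, Cmd.arrs, Cmd.coinFree]
  have key' : ∀ i < N, Tri L ω p ((st i).setReg x i) (T i) (I (i + 1)) := by
    intro i hi
    obtain ⟨h1, h2⟩ := key i hi.le
    exact hp i hi _ (h1.trans (Same.setReg_loop x e p _ (i : ℤ))) (by simp) (hx i _ _ h2)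
  refine ⟨⟨by rwa [hN'], fun i hi => (key' i (by rwa [hN'] at hi)).1⟩, ?_, ?_⟩
  · simp only [Cmd.steps, hN']
    gcongr with i hi
    exact (key' i (Finset.mem_range.1 hi)).2.1
  · simp only [Cmd.run, hN']
    exact (key N le_rfl).2

theorem Tri.loop {x : ℕ} {e : Ex} {p : Cmd} {s : St} (I : ℕ → St → Prop) (N T : ℕ)
    (hN : e.eval s = N) (hL : N ≤ 2 ^ L) (h0 : I 0 s)
    (hx : ∀ i s z, I i s → I i (s.setReg x z))
    (hp : ∀ i < N, ∀ s', Same (.loop x e p) s s' → s'.reg x = (i : ℤ) → I i s' →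
      Tri L ω p s' T (I (i + 1))) :
    Tri L ω (.loop x e p) s (1 + N * (1 + T)) (I N) := by
  have := Tri.loop_sum I N (fun _ => T) hN hL h0 hx hp
  simpa using this

/-- A loop that fills an array. -/
theorem Tri.fill {x k : ℕ} {e f : Ex} {s : St} (N : ℕ) (F : ℕ → ℤ)
    (hN : e.eval s = N) (hL : N ≤ 2 ^ L)
    (hf : ∀ i < N, ∀ s' : St, (∀ y ≠ x, s'.reg y = s.reg y) → (∀ k' ≠ k, s'.arr k' = s.arr k') →
      s'.reg x = (i : ℤ) → (∀ j, i ≤ j → s'.arr k j = s.arr k j) → (∀ j < i, s'.arr k j = F j) →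
      f.eval s' = F i)
    (hF : ∀ i < N, |F i| < 2 ^ L) :
    Tri L ω (.loop x e (.put k (.reg x) f)) s (1 + N * 2) fun s' =>
      (∀ i < N, s'.arr k i = F i) ∧ ∀ i, N ≤ i → s'.arr k i = s.arr k i := by
  refine Tri.loop (fun i s' => (∀ j < i, s'.arr k j = F j) ∧ ∀ j, i ≤ j → s'.arr k j = s.arr k j)
    N 1 hN hL ⟨by simp, by simp⟩ (fun _ _ _ h => h) ?_
  rintro i hi s' hS hx ⟨h1, h2⟩
  refine Tri.put i (F i) (by simp [hx]) (hf i hi s' ?_ ?_ hx h2 h1) (hF i hi) ⟨?_, ?_⟩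
  · exact fun y hy => hS.reg y (by simp [Cmd.regs, hy])
  · exact fun y hy => hS.arr y (by simp [Cmd.arrs, hy])
  · intro j hj
    rcases eq_or_ne j i with rfl | hne
    · simp
    · simp [hne, h1 j (by omega)]
  · intro j hj
    simp [show j ≠ i by omega, h2 j (by omega)]

/-- A loop that adds up values of an expression. -/
theorem Tri.sumLoop {x y : ℕ} {e f : Ex} {s : St} (N : ℕ) (F : ℕ → ℤ) (hxy : y ≠ x)
    (hN : e.eval s = N) (hL : N ≤ 2 ^ L)
    (hf : ∀ i < N, ∀ s' : St, (∀ z, z ≠ x → z ≠ y → s'.reg z = s.reg z) → s'.arr = s.arr →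
      s'.reg x = (i : ℤ) → f.eval s' = F i)
    (hF : ∀ i ≤ N, |s.reg y + ∑ j ∈ Finset.range i, F j| < 2 ^ L) :
    Tri L ω (.loop x e (.set y (.reg y + f))) s (1 + N * 2) fun s' =>
      s'.reg y = s.reg y + ∑ j ∈ Finset.range N, F j := by
  refine Tri.loop (fun i s' => s'.reg y = s.reg y + ∑ j ∈ Finset.range i, F j)
    N 1 hN hL (by simp) (fun _ _ _ h => by simpa [hxy] using h) ?_
  intro i hi s' hS hx h1
  have e1 : f.eval s' = F i := by
    refine hf i hi s' ?_ ?_ hx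
    · exact fun z h1 h2 => hS.reg z (by simp [Cmd.regs, h1, h2])
    · funext k; exact hS.arr k (by simp [Cmd.arrs])
  have e2 : (Ex.reg y + f).eval s' = s.reg y + ∑ j ∈ Finset.range (i + 1), F j := by
    simp [e1, h1, Finset.sum_range_succ, add_assoc]
  refine Tri.set _ e2 (hF (i + 1) hi) (by simp)

end rules

end StructuredRAM

/-! The Faddeev–LeVerrier algorithm. -/

namespace FaddeevLeVerrier

open Polynomial Matrix Finset

section

variable {R : Type*} [CommRing R] {ι : Type*} [Fintype ι] [DecidableEq ι]

theorem det_eq_sum_rows (A : Matrix ι ι R) :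
    A.det = ∑ σ : Equiv.Perm ι, ((Equiv.Perm.sign σ : ℤ) : R) * ∏ i, A i (σ i) := by
  rw [← det_transpose, det_apply']
  rfl

/-- Differentiate the Leibniz expansion factor by factor: the entry `(i, σ i)` of `X - A` has
derivative 1 on the diagonal and 0 off it, and the remaining factors are the expansion of the `i`-th
diagonal entry of the adjugate. -/
theorem derivative_charpoly (A : Matrix ι ι R) :
    derivative A.charpoly = (adjugate (charmatrix A)).trace := by
  have h1 : derivative A.charpoly = ∑ σ : Equiv.Perm ι, ∑ i, ((Equiv.Perm.sign σ : ℤ) : R[X]) *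
      ((∏ j ∈ univ.erase i, charmatrix A j (σ j)) * (if σ i = i then 1 else 0)) := by
    rw [Matrix.charpoly, det_eq_sum_rows, derivative_sum]
    refine sum_congr rfl fun σ _ => ?_
    rw [derivative_intCast_mul, derivative_prod_finset, mul_sum]
    refine sum_congr rfl fun i _ => ?_
    congr 2
    by_cases h : σ i = i
    · rw [h]; simp
    · simp [h, charmatrix_apply_ne _ _ _ (Ne.symm h)]
  have h2 : ∀ i, adjugate (charmatrix A) i i = ∑ σ : Equiv.Perm ι,
      ((Equiv.Perm.sign σ : ℤ) : R[X]) *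
      ((∏ j ∈ univ.erase i, charmatrix A j (σ j)) * (if σ i = i then 1 else 0)) := by
    intro i
    rw [adjugate_apply, det_eq_sum_rows]
    refine sum_congr rfl fun σ _ => ?_
    congr 1
    rw [← prod_erase_mul _ _ (mem_univ i)]
    congr 1
    · exact prod_congr rfl fun j hj => by rw [updateRow_ne (ne_of_mem_erase hj)]
    · simp [Pi.single_apply]
  rw [h1, sum_comm, Matrix.trace]
  exact sum_congr rfl fun i _ => (h2 i).symm

/-- The matrix of the `j`-th coefficients of the adjugate of `X - A`. -/
noncomputable def adjCoeff (A : Matrix ι ι R) (j : ℕ) : Matrix ι ι R :=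
  .of fun u v => ((adjugate (charmatrix A)) u v).coeff j

theorem charmatrix_mul_apply (A : Matrix ι ι R) (B : Matrix ι ι R[X]) (u v : ι) :
    (charmatrix A * B) u v = X * B u v - ∑ l, C (A u l) * B l v := by
  rw [charmatrix, sub_mul, Matrix.sub_apply]
  congr 1
  rw [scalar_apply, diagonal_mul]

/-- The coefficient of `X ^ (j + 1)` in `(X - A) * adj(X - A) = χ • 1`. -/
theorem adjCoeff_succ (A : Matrix ι ι R) (j : ℕ) :
    adjCoeff A j = A * adjCoeff A (j + 1) + A.charpoly.coeff (j + 1) • 1 := by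
  ext u v
  have h := congrFun (congrFun (mul_adjugate (charmatrix A)) u) v
  rw [charmatrix_mul_apply] at h
  have h := congrArg (fun p => p.coeff (j + 1)) h
  simp only [coeff_sub, coeff_X_mul, finsetSum_coeff, coeff_C_mul] at h
  have e : ((charmatrix A).det • (1 : Matrix ι ι R[X])) u v
      = C ((1 : Matrix ι ι R) u v) * A.charpoly := by
    rw [Matrix.charpoly]
    by_cases huv : u = v <;> simp [Matrix.one_apply, huv]
  rw [e, coeff_C_mul] at h
  simp only [adjCoeff, Matrix.add_apply, Matrix.mul_apply, of_apply, Matrix.smul_apply, smul_eq_mul]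
  rw [mul_comm (A.charpoly.coeff _), ← h]; ring

theorem mul_adjCoeff_zero (A : Matrix ι ι R) :
    0 = A * adjCoeff A 0 + A.charpoly.coeff 0 • 1 := by
  ext u v
  have h := congrFun (congrFun (mul_adjugate (charmatrix A)) u) v
  rw [charmatrix_mul_apply] at h
  have h := congrArg (fun p => p.coeff 0) h
  simp only [coeff_sub, coeff_X_mul_zero, finsetSum_coeff, coeff_C_mul] at h
  have e : ((charmatrix A).det • (1 : Matrix ι ι R[X])) u v
      = C ((1 : Matrix ι ι R) u v) * A.charpoly := by
    rw [Matrix.charpoly]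
    by_cases huv : u = v <;> simp [Matrix.one_apply, huv]
  rw [e, coeff_C_mul] at h
  simp only [adjCoeff, Matrix.add_apply, Matrix.mul_apply, of_apply, Matrix.smul_apply,
    smul_eq_mul, Matrix.zero_apply]
  rw [mul_comm (A.charpoly.coeff _), ← h]; ring

theorem trace_adjCoeff (A : Matrix ι ι R) (j : ℕ) :
    (adjCoeff A j).trace = A.charpoly.coeff (j + 1) * (j + 1) := by
  rw [← coeff_derivative, derivative_charpoly, Matrix.trace, Matrix.trace, finsetSum_coeff]
  rfl

/-- Coefficients of very high index vanish because the entries are polynomials; the recursion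
carries this down as long as the coefficients of `χ` in it vanish as well. -/
theorem adjCoeff_eq_zero [Nontrivial R] (A : Matrix ι ι R) {j : ℕ} (hj : Fintype.card ι ≤ j) :
    adjCoeff A j = 0 := by
  obtain ⟨N, hN⟩ : ∃ N, ∀ j, N ≤ j → adjCoeff A j = 0 := by
    refine ⟨univ.sup (fun u => univ.sup fun v =>
      ((adjugate (charmatrix A)) u v).natDegree) + 1, fun j hj => ?_⟩
    ext u v
    refine coeff_eq_zero_of_natDegree_lt (lt_of_le_of_lt ?_ hj)
    exact (le_sup (f := fun v => ((adjugate (charmatrix A)) u v).natDegree) (mem_univ v)).trans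
      (le_sup (f := fun u => univ.sup fun v => ((adjugate (charmatrix A)) u v).natDegree)
        (mem_univ u))
  have : ∀ r j, Fintype.card ι ≤ j → N ≤ j + r → adjCoeff A j = 0 := by
    intro r
    induction r with
    | zero => exact fun j _ h => hN j h
    | succ r ih =>
      intro j h1 h2
      rw [adjCoeff_succ, ih (j + 1) (by omega) (by omega), coeff_eq_zero_of_natDegree_lt]
      · simp
      · rw [charpoly_natDegree_eq_dim]; omega
  exact this N j hj (by omega)

end

/-! ### The integer recursion and the growth of its numbers. -/

variable {m : ℕ}

/-- The `k`-th matrix and the `k`-th coefficient computed by the algorithm. -/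
noncomputable def state (A : Matrix (Fin m) (Fin m) ℤ) : ℕ → Matrix (Fin m) (Fin m) ℤ × ℤ
  | 0 => (1, 1)
  | k + 1 =>
    let c := -(A * (state A k).1).trace / (k + 1)
    (A * (state A k).1 + c • 1, c)

/-- The trace of `adjCoeff_succ`, combined with `trace_adjCoeff`, gives `tr(A M) = -(k + 1)
χ_{m-k-1}` for the `k`-th matrix `M`. Hence the integer division in `state` is exact. -/
theorem state_eq (A : Matrix (Fin m) (Fin m) ℤ) (k : ℕ) (hk : k ≤ m) :
    (state A k).2 = A.charpoly.coeff (m - k) ∧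
      (k < m → (state A k).1 = adjCoeff A (m - 1 - k)) := by
  have hlead : A.charpoly.coeff m = 1 := by
    have := charpoly_monic A
    rwa [Monic, leadingCoeff, charpoly_natDegree_eq_dim, Fintype.card_fin] at this
  induction k with
  | zero =>
    refine ⟨by simp [state, hlead], fun h => ?_⟩
    rw [adjCoeff_succ, adjCoeff_eq_zero A (by simp; omega),
      show m - 1 - 0 + 1 = m by omega, hlead]
    simp [state]
  | succ k ih =>
    obtain ⟨-, h2⟩ := ih (by omega)
    have h2 := h2 (by omega)
    have hc : (state A (k + 1)).2 = A.charpoly.coeff (m - (k + 1)) := by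
      have ht : (A * (state A k).1).trace = (k + 1) * -A.charpoly.coeff (m - (k + 1)) := by
        rw [h2]
        rcases Nat.lt_or_ge (k + 1) m with h | h
        · have e1 := congrArg Matrix.trace (adjCoeff_succ A (m - 1 - (k + 1)))
          rw [trace_adjCoeff, Matrix.trace_add, Matrix.trace_smul, Matrix.trace_one,
            show m - 1 - (k + 1) + 1 = m - 1 - k by omega] at e1
          rw [show m - (k + 1) = m - 1 - k by omega]
          have e2 : ((m - 1 - (k + 1) : ℕ) : ℤ) = m - 1 - (k + 1) := by omega
          rw [e2] at e1
          simp only [Fintype.card_fin, smul_eq_mul] at e1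
          linear_combination -e1
        -- In the last round the constant coefficient of the adjugate identity takes the place of
        -- the recursion.
        · have hm : m = k + 1 := by omega
          have e1 := congrArg Matrix.trace (mul_adjCoeff_zero A)
          rw [Matrix.trace_zero, Matrix.trace_add, Matrix.trace_smul, Matrix.trace_one] at e1
          rw [show m - 1 - k = 0 by omega, show m - (k + 1) = 0 by omega]
          simp only [Fintype.card_fin, smul_eq_mul] at e1
          have e2 : (m : ℤ) = k + 1 := by omega
          rw [e2] at e1
          linear_combination -e1
      simp only [state, ht]
      rw [mul_neg, neg_neg, Int.mul_ediv_cancel_left _ (by omega)]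
    refine ⟨hc, fun h => ?_⟩
    have e : (state A (k + 1)).1 = A * (state A k).1 + (state A (k + 1)).2 • 1 := rfl
    rw [e, hc, h2, adjCoeff_succ A (m - 1 - (k + 1)), show m - 1 - (k + 1) + 1 = m - 1 - k by omega,
      show m - (k + 1) = m - 1 - k by omega]

theorem state_snd (A : Matrix (Fin m) (Fin m) ℤ) : (state A m).2 = (-1) ^ m * A.det := by
  rw [(state_eq A m le_rfl).1, det_eq_sign_charpoly_coeff, Nat.sub_self, Fintype.card_fin,
    ← mul_assoc, ← mul_pow]
  simp

theorem abs_mul_le {A B : Matrix (Fin m) (Fin m) ℤ} {a b : ℤ} (hA : ∀ u v, |A u v| ≤ a)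
    (hB : ∀ u v, |B u v| ≤ b) (u v : Fin m) : |(A * B) u v| ≤ m * (a * b) := by
  rw [Matrix.mul_apply]
  refine (abs_sum_le_sum_abs _ _).trans ((sum_le_sum (g := fun _ => a * b) fun l _ => ?_).trans ?_)
  · rw [abs_mul]
    exact mul_le_mul (hA _ _) (hB _ _) (abs_nonneg _) ((abs_nonneg _).trans (hA u l))
  · simp

/-- With entries at most `a` and `b`, a product has entries at most `m a b` and trace at most `m² a
b`; the factor `2 (m + 1)² a` for each round covers their sum. The bound for the last coefficient
serves later as a bound for the determinant. -/
theorem abs_state_le (A : Matrix (Fin m) (Fin m) ℤ) {a : ℤ} (ha : 1 ≤ a)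
    (hA : ∀ u v, |A u v| ≤ a) (k : ℕ) :
    (∀ u v, |(state A k).1 u v| ≤ (2 * (m + 1) ^ 2 * a) ^ k) ∧
      |(state A k).2| ≤ (2 * (m + 1) ^ 2 * a) ^ k := by
  induction k with
  | zero =>
    refine ⟨fun u v => ?_, by simp [state]⟩
    simp only [state, Matrix.one_apply, pow_zero]
    split_ifs <;> simp
  | succ k ih =>
    set b : ℤ := (2 * (m + 1) ^ 2 * a) ^ k with hb
    have hm1 : (1 : ℤ) ≤ (m + 1) ^ 2 := one_le_pow₀ (by omega)
    have hb1 : 1 ≤ b := one_le_pow₀ (by nlinarith)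
    have h1 := abs_mul_le hA ih.1
    have h2 : |(A * (state A k).1).trace| ≤ m * (m * (a * b)) := by
      refine (abs_sum_le_sum_abs _ _).trans
        ((sum_le_sum (g := fun _ => m * (a * b)) fun l _ => h1 l l).trans ?_)
      simp
    have hab : 1 ≤ a * b := by nlinarith
    have h3 : |(state A (k + 1)).2| ≤ m * (m * (a * b)) := by
      simp only [state]
      refine le_trans ?_ h2
      rw [← abs_neg (Matrix.trace _)]
      have := Int.natAbs_ediv_le_natAbs (-(A * (state A k).1).trace) (k + 1)
      zify at this
      exact this
    have h4 : (2 * ((m : ℤ) + 1) ^ 2 * a) ^ (k + 1) = 2 * (m + 1) ^ 2 * (a * b) := by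
      rw [pow_succ, hb]; ring
    have hm0 : (0 : ℤ) ≤ m := by positivity
    rw [h4]
    have h5 : (m : ℤ) * (m * (a * b)) ≤ (m + 1) ^ 2 * (a * b) := by nlinarith [mul_nonneg hm0 hm0]
    refine ⟨fun u v => ?_, by nlinarith⟩
    have e : (state A (k + 1)).1 u v
        = (A * (state A k).1) u v + (state A (k + 1)).2 * (1 : Matrix (Fin m) (Fin m) ℤ) u v := rfl
    have h6 : |(state A (k + 1)).2 * (1 : Matrix (Fin m) (Fin m) ℤ) u v|
        ≤ m * (m * (a * b)) := by
      rw [Matrix.one_apply]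
      split_ifs
      · simpa using h3
      · simp; positivity
    rw [e]
    refine (abs_add_le _ _).trans ((add_le_add (h1 u v) h6).trans ?_)
    nlinarith [mul_nonneg hm0 (by linarith : 0 ≤ a * b)]

end FaddeevLeVerrier

/-! The determinant sum that detects clique covers. -/

namespace CliqueCover

open Finset

/-- A finite set is a clique of the relation `h` (read off its pairs in decreasing order). -/
def IsCl (h : ℕ → ℕ → Prop) (C : Finset ℕ) : Prop := ∀ x ∈ C, ∀ y ∈ C, y < x → h x y

section

variable {R : Type*} [CommRing R] (h : ℕ → ℕ → Prop)

open Classical in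
/-- The generating function of the cliques inside `s`. -/
noncomputable def cliqueSum (b : ℕ → R) (s : Finset ℕ) : R :=
  ∑ C ∈ s.powerset with IsCl h C, ∏ x ∈ C, b x

/-- The weight of the cliques inside `s` in the slot `(u, v)`. -/
noncomputable def wt (a : ℕ → ℕ → R) (b : ℕ → ℕ → ℕ → R) (s : Finset ℕ) (u v : ℕ) : R :=
  a u v * cliqueSum h (b u v) s

/-- The symmetric matrix with the products of the weights of opposite slots. -/
noncomputable def wtMatrix (m : ℕ) (a : ℕ → ℕ → R) (b : ℕ → ℕ → ℕ → R) (s : Finset ℕ) :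
    Matrix (Fin m) (Fin m) R :=
  .of fun u v => wt h a b s u v * wt h a b s v u

noncomputable def detSum (w m : ℕ) (a : ℕ → ℕ → R) (b : ℕ → ℕ → ℕ → R) : R :=
  ∑ s ∈ (range w).powerset, (wtMatrix h m a b s).det

theorem cliqueSum_empty (b : ℕ → R) : cliqueSum h b ∅ = 1 := by
  classical
  have : (∅ : Finset ℕ).powerset.filter (IsCl h) = {∅} := by
    ext C
    simp only [powerset_empty, mem_filter, mem_singleton, and_iff_left_iff_imp]
    rintro rfl x hx
    simp at hx
  unfold cliqueSum
  rw [this]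
  simp

open Classical in
-- A clique containing the largest vertex `x` is `x` together with a clique among the earlier
-- neighbours of `x`. The table of all clique sums is filled by this recursion.
theorem cliqueSum_insert (b : ℕ → R) {s : Finset ℕ} {x : ℕ} (hx : ∀ y ∈ s, y < x) :
    cliqueSum h b (insert x s) = cliqueSum h b s + b x * cliqueSum h b (s.filter (h x)) := by
  have hxs : x ∉ s := fun hs => lt_irrefl _ (hx x hs)
  unfold cliqueSum
  rw [sum_filter, sum_powerset_insert hxs, ← sum_filter, mul_sum, ← sum_filter]
  congr 1
  refine sum_nbij' (i := id) (j := id) ?_ ?_ (fun _ _ => rfl) (fun _ _ => rfl) ?_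
  · intro C hC
    simp only [mem_filter, mem_powerset, id] at hC ⊢
    obtain ⟨hCs, hcl⟩ := hC
    exact ⟨fun y hy => mem_filter.2 ⟨hCs hy, hcl x (mem_insert_self _ _) y
      (mem_insert_of_mem hy) (hx y (hCs hy))⟩,
      fun y hy z hz => hcl y (mem_insert_of_mem hy) z (mem_insert_of_mem hz)⟩
  · intro C hC
    simp only [mem_filter, mem_powerset, id] at hC ⊢
    obtain ⟨hCs, hcl⟩ := hC
    refine ⟨fun y hy => (mem_filter.1 (hCs hy)).1, ?_⟩
    intro y hy z hz hzy
    rcases mem_insert.1 hy with hy | hy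
    · rcases mem_insert.1 hz with hz | hz
      · omega
      · rw [hy]; exact (mem_filter.1 (hCs hz)).2
    · rcases mem_insert.1 hz with hz | hz
      · rw [hz] at hzy
        exact absurd hzy (lt_asymm (hx y (mem_filter.1 (hCs hy)).1))
      · exact hcl y hy z hz hzy
  · intro C hC
    simp only [mem_filter, mem_powerset] at hC
    exact prod_insert (fun hxC => hxs (hC.1 hxC))

variable {S : Type*} [CommRing S]

theorem map_cliqueSum (f : R →+* S) (b : ℕ → R) (s : Finset ℕ) :
    f (cliqueSum h b s) = cliqueSum h (fun x => f (b x)) s := by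
  simp [cliqueSum, map_sum, map_prod]

theorem map_wt (f : R →+* S) (a : ℕ → ℕ → R) (b : ℕ → ℕ → ℕ → R) (s : Finset ℕ) (u v : ℕ) :
    f (wt h a b s u v) = wt h (fun u v => f (a u v)) (fun u v x => f (b u v x)) s u v := by
  simp [wt, map_cliqueSum]

/-- Naturality is what makes the sums over `ℤ`, `ℤ[X]`, `𝔽₂[X]` and the generic polynomial
comparable. -/
theorem map_detSum (f : R →+* S) (w m : ℕ) (a : ℕ → ℕ → R) (b : ℕ → ℕ → ℕ → R) :
    f (detSum h w m a b)
      = detSum h w m (fun u v => f (a u v)) (fun u v x => f (b u v x)) := by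
  simp only [detSum, map_sum, RingHom.map_det]
  refine sum_congr rfl fun s _ => ?_
  congr 1
  ext u v
  simp [wtMatrix, map_wt]

section CharTwo

variable [CharP R 2]

/-- Signs disappear in characteristic 2. The term of `σ` is `∏ f u (σ u) * ∏ f u (σ⁻¹ u)`, which is
the same for `σ⁻¹`; hence all terms cancel in pairs except those of involutions, which are squares.
-/
theorem det_mul_swap {ι : Type*} [Fintype ι] [DecidableEq ι] (f : ι → ι → R) :
    (Matrix.of fun u v => f u v * f v u).det
      = ∑ σ : Equiv.Perm ι with σ⁻¹ = σ, (∏ u, f u (σ u)) ^ 2 := by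
  have h1 : (Matrix.of fun u v => f u v * f v u).det
      = ∑ σ : Equiv.Perm ι, (∏ u, f u (σ u)) * ∏ u, f u (σ⁻¹ u) := by
    rw [FaddeevLeVerrier.det_eq_sum_rows]
    refine sum_congr rfl fun σ _ => ?_
    have hs : ((Equiv.Perm.sign σ : ℤ) : R) = 1 := by
      rcases Int.units_eq_one_or (Equiv.Perm.sign σ) with h | h <;> simp [h, CharTwo.neg_eq]
    rw [hs, one_mul]
    simp only [Matrix.of_apply, prod_mul_distrib]
    congr 1
    rw [← Equiv.prod_comp σ (fun u => f u (σ⁻¹ u))]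
    simp
  rw [h1, ← sum_filter_add_sum_filter_not univ (fun σ : Equiv.Perm ι => σ⁻¹ = σ)]
  have h2 : ∑ σ : Equiv.Perm ι with ¬ σ⁻¹ = σ, (∏ u, f u (σ u)) * ∏ u, f u (σ⁻¹ u) = 0 := by
    refine sum_involution (fun σ _ => σ⁻¹) ?_ ?_ ?_ ?_
    · intro σ _
      rw [inv_inv, mul_comm (∏ u, f u (σ⁻¹ u))]
      exact CharTwo.add_self_eq_zero _
    · intro σ hσ _
      exact (mem_filter.1 hσ).2
    · intro σ hσ
      have := (mem_filter.1 hσ).2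
      simpa [eq_comm] using this
    · intro σ _
      exact inv_inv σ
  rw [h2, add_zero]
  refine sum_congr rfl fun σ hσ => ?_
  rw [(mem_filter.1 hσ).2, sq]

/-- Squaring is additive in characteristic 2, so the sum over `s` moves inside the square. -/
theorem detSum_eq (w m : ℕ) (a : ℕ → ℕ → R) (b : ℕ → ℕ → ℕ → R) :
    detSum h w m a b = ∑ σ : Equiv.Perm (Fin m) with σ⁻¹ = σ,
      (∑ s ∈ (range w).powerset, ∏ u : Fin m, wt h a b s u (σ u)) ^ 2 := by
  unfold detSum
  simp only [CharTwo.sum_sq]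
  rw [sum_comm]
  exact sum_congr rfl fun s _ => det_mul_swap (fun u v : Fin m => wt h a b s u v)

/-- In the expansion a tuple of cliques with union `U` occurs for each `s ⊇ U`, that is `2 ^ (w -
#U)` times. This is even unless the tuple covers `range w`, and `H` provides a zero factor for
covering tuples. -/
theorem sum_prod_cliqueSum_eq_zero {w m : ℕ} (α : Fin m → R) (b : Fin m → ℕ → R)
    (H : ∀ C : Fin m → Finset ℕ, (∀ u, IsCl h (C u)) → (∀ u, C u ⊆ range w) →
      (∀ x < w, ∃ u, x ∈ C u) → ∃ u, α u = 0 ∨ ∃ x ∈ C u, b u x = 0) :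
    ∑ s ∈ (range w).powerset, ∏ u : Fin m, (α u * cliqueSum h (b u) s) = 0 := by
  classical
  have h1 : ∀ s ∈ (range w).powerset, ∀ u, cliqueSum h (b u) s
      = ∑ C ∈ (range w).powerset with IsCl h C, if C ⊆ s then ∏ x ∈ C, b u x else 0 := by
    intro s hs u
    unfold cliqueSum
    rw [← sum_filter]
    refine sum_congr ?_ fun _ _ => rfl
    ext C
    simp only [mem_filter, mem_powerset] at hs ⊢
    exact ⟨fun ⟨h1, h2⟩ => ⟨⟨h1.trans hs, h2⟩, h1⟩, fun ⟨⟨_, h2⟩, h3⟩ => ⟨h3, h2⟩⟩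
  have h2 : ∑ s ∈ (range w).powerset, ∏ u : Fin m, (α u * cliqueSum h (b u) s)
      = ∑ s ∈ (range w).powerset, ∑ C ∈ Fintype.piFinset
          (fun _ : Fin m => (range w).powerset.filter (IsCl h)),
        if ∀ u ∈ univ, C u ⊆ s then (∏ u, α u) * ∏ u, ∏ x ∈ C u, b u x else 0 := by
    refine sum_congr rfl fun s hs => ?_
    rw [prod_mul_distrib, prod_congr rfl fun u _ => h1 s hs u, prod_univ_sum, mul_sum]
    refine sum_congr rfl fun C _ => ?_
    rw [prod_ite_zero, mul_ite, mul_zero]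
    congr
  rw [h2, sum_comm]
  refine sum_eq_zero fun C hC => ?_
  simp only [Fintype.mem_piFinset, mem_filter, mem_powerset] at hC
  rw [← sum_filter, sum_const]
  by_cases hcov : ∀ x < w, ∃ u, x ∈ C u
  · obtain ⟨u, hu⟩ := H C (fun u => (hC u).2) (fun u => (hC u).1) hcov
    rcases hu with hu | ⟨x, hx, hb⟩
    · rw [prod_eq_zero (mem_univ u) hu, zero_mul, smul_zero]
    · rw [prod_eq_zero (f := fun u => ∏ x ∈ C u, b u x) (mem_univ u) (prod_eq_zero hx hb),
        mul_zero, smul_zero]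
  · push Not at hcov
    obtain ⟨x, hx, hxC⟩ := hcov
    have hcard : #{s ∈ (range w).powerset | ∀ u ∈ univ, C u ⊆ s}
        = 2 ^ (w - #(univ.biUnion C)) := by
      have hU : univ.biUnion C ⊆ range w := biUnion_subset.2 fun u _ => (hC u).1
      have : {s ∈ (range w).powerset | ∀ u ∈ univ, C u ⊆ s} = Icc (univ.biUnion C) (range w) := by
        ext s
        simp [and_comm]
      rw [this, card_Icc_finset hU, card_range]
    have hlt : #(univ.biUnion C) < w := by
      have : univ.biUnion C ⊂ range w := by
        refine (ssubset_iff_of_subset (biUnion_subset.2 fun u _ => (hC u).1)).2 ⟨x, by simpa, ?_⟩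
        simpa using hxC
      simpa using card_lt_card this
    obtain ⟨r, hr⟩ := Nat.exists_eq_add_of_lt hlt
    rw [hcard, show w - #(univ.biUnion C) = r + 1 by omega, pow_succ, mul_smul, two_smul,
      CharTwo.add_self_eq_zero, smul_zero]

theorem detSum_eq_zero {w m : ℕ} (a : ℕ → ℕ → R) (b : ℕ → ℕ → ℕ → R)
    (H : ∀ (σ : Equiv.Perm (Fin m)) (C : Fin m → Finset ℕ), σ⁻¹ = σ → (∀ u, IsCl h (C u)) →
      (∀ u, C u ⊆ range w) → (∀ x < w, ∃ u, x ∈ C u) →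
      ∃ u : Fin m, a u (σ u) = 0 ∨ ∃ x ∈ C u, b u (σ u) x = 0) :
    detSum h w m a b = 0 := by
  rw [detSum_eq]
  refine sum_eq_zero fun σ hσ => ?_
  have := sum_prod_cliqueSum_eq_zero h (w := w) (fun u : Fin m => a u (σ u))
    (fun u : Fin m => b u (σ u)) (fun C => H σ C (mem_filter.1 hσ).2)
  unfold wt
  rw [this]
  simp

/-- The slot weights kill every permutation but `σ`. With these vertex weights the clique sum of row
`u` counts the subsets of `s ∩ φ⁻¹(u)`, all of them cliques; this is even once the class of `u`
meets `s`. So only `s = ∅` contributes, and it contributes 1. -/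
theorem detSum_eq_one {w m : ℕ} (σ : Equiv.Perm (Fin m)) (hσ : σ⁻¹ = σ) (φ : ℕ → Fin m)
    (hφ : ∀ x < w, ∀ y < w, y < x → φ x = φ y → h x y) (a : ℕ → ℕ → R) (b : ℕ → ℕ → ℕ → R)
    (ha : ∀ u v : Fin m, a u v = if σ u = v then 1 else 0)
    (hb : ∀ u : Fin m, ∀ x < w, b u (σ u) x = if φ x = u then 1 else 0) :
    detSum h w m a b = 1 := by
  classical
  have h0 : ∀ s ∈ (range w).powerset, s ≠ ∅ → ∏ u : Fin m, wt h a b s u (σ u) = 0 := by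
    intro s hs hne
    obtain ⟨x, hx⟩ := nonempty_iff_ne_empty.2 hne
    rw [mem_powerset] at hs
    refine prod_eq_zero (mem_univ (φ x)) ?_
    unfold wt
    suffices H : cliqueSum h (b (φ x) (σ (φ x))) s = 0 by rw [H, mul_zero]
    have hcl : cliqueSum h (b (φ x) (σ (φ x))) s
        = ∑ C ∈ (s.filter fun y => φ y = φ x).powerset, 1 := by
      unfold cliqueSum
      rw [sum_filter, ← sum_filter_add_sum_filter_not _ (fun C => ∀ y ∈ C, φ y = φ x)]
      have e2 : ∑ C ∈ s.powerset with ¬ ∀ y ∈ C, φ y = φ x,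
          (if IsCl h C then ∏ y ∈ C, b (φ x) (σ (φ x)) y else 0) = 0 := by
        refine sum_eq_zero fun C hC => ?_
        simp only [mem_filter, mem_powerset, not_forall] at hC
        obtain ⟨hC, y, hy, hyx⟩ := hC
        rw [prod_eq_zero hy, ite_self]
        rw [hb _ _ (mem_range.1 (hs (hC hy))), if_neg hyx]
      rw [e2, add_zero]
      refine sum_congr ?_ fun C hC => ?_
      · ext C
        simp only [mem_filter, mem_powerset, subset_iff]
        exact ⟨fun ⟨h1, h2⟩ y hy => ⟨h1 hy, h2 y hy⟩, fun h1 => ⟨fun y hy => (h1 hy).1,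
          fun y hy => (h1 hy).2⟩⟩
      · simp only [mem_powerset, subset_iff, mem_filter] at hC
        rw [if_pos]
        · exact prod_eq_one fun y hy => by
            rw [hb _ _ (mem_range.1 (hs (hC hy).1)), if_pos (hC hy).2]
        · intro y hy z hz hzy
          exact hφ y (mem_range.1 (hs (hC hy).1)) z (mem_range.1 (hs (hC hz).1)) hzy
            ((hC hy).2.trans (hC hz).2.symm)
    rw [hcl, sum_const, card_powerset]
    have hpos : 0 < #(s.filter fun y => φ y = φ x) := card_pos.2 ⟨x, by simp [hx]⟩
    obtain ⟨r, hr⟩ := Nat.exists_eq_add_of_lt hpos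
    rw [hr, pow_succ, mul_smul, two_smul, CharTwo.add_self_eq_zero, smul_zero]
  rw [detSum_eq, sum_eq_single_of_mem σ (by simp [hσ])]
  · rw [sum_eq_single_of_mem ∅ (by simp) h0, prod_eq_one, one_pow]
    intro u _
    rw [wt, cliqueSum_empty, mul_one, ha, if_pos rfl]
  · intro τ _ hτ
    obtain ⟨u, hu⟩ : ∃ u, σ u ≠ τ u := by
      by_contra! hc
      exact hτ (Equiv.ext fun u => (hc u).symm)
    rw [sum_eq_zero, zero_pow two_ne_zero]
    intro s _
    refine prod_eq_zero (mem_univ u) ?_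
    rw [wt, ha, if_neg hu, zero_mul]

end CharTwo

end

end CliqueCover

/-! ### Clique covers as involutions with a clique in every slot. -/

namespace CliqueCover

open Finset

section

variable (h : ℕ → ℕ → Prop) (n w m : ℕ)

/-- The vertices `0, …, n - 1` can be partitioned into `m` cliques of `h`. -/
def Coverable : Prop :=
  ∃ f : ℕ → ℕ, (∀ i < n, f i < m) ∧ ∀ i < n, ∀ j < n, i ≠ j → f i = f j → h i j

/-- The slot `(u, v)`, `u < v`, is for cliques that contain `w + u` and `w + v`. -/
def OkSlot (u v : ℕ) : Prop := v ≤ u ∨ (w + u < n ∧ w + v < n ∧ h (w + u) (w + v))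

/-- The vertex `x` may belong to the clique in the slot `(u, v)`. -/
def Allowed (u v x : ℕ) : Prop :=
  v < u ∨ ((w + u < n → h x (w + u)) ∧ (w + v < n → h x (w + v)))

variable {h n w m}

/-- A vertex of `X` is coloured by any row whose clique contains it, and `w + v` by the smaller of
`v` and `σ v`. The slot conditions bind exactly the rows `u ≤ σ u`, and these are the only colours
used on `Y`. -/
theorem coverable_of_slots (hsymm : ∀ x y, h x y → h y x) (hn : n ≤ w + m)
    (σ : Equiv.Perm (Fin m)) (hσ : σ⁻¹ = σ) (C : Fin m → Finset ℕ) (hC : ∀ u, IsCl h (C u))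
    (hcov : ∀ x < w, ∃ u, x ∈ C u) (hok : ∀ u : Fin m, OkSlot h n w u (σ u))
    (hal : ∀ u : Fin m, ∀ x ∈ C u, Allowed h n w u (σ u) x) : Coverable h n m := by
  classical
  have hσσ : ∀ u, σ (σ u) = u := fun u => by
    have e := inv_mul_cancel σ
    rw [hσ] at e
    exact DFunLike.congr_fun e u
  rcases Nat.eq_zero_or_pos m with rfl | hm
  · refine ⟨id, fun i hi => ?_, fun i hi => ?_⟩ <;>
    · obtain ⟨u, -⟩ := hcov i (by omega)
      exact u.elim0
  let base : Fin m → Fin m := fun u => if u ≤ σ u then u else σ u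
  have hbase : ∀ u, base u ≤ σ (base u) ∧ (u = base u ∨ u = σ (base u)) := by
    intro u
    simp only [base]
    split_ifs with hu
    · exact ⟨hu, Or.inl rfl⟩
    · rw [hσσ]; exact ⟨(not_le.1 hu).le, Or.inr rfl⟩
  have hex : ∀ i : ℕ, ∃ u : Fin m, i < n →
      (i < w → i ∈ C u) ∧ (w ≤ i → ∃ v : Fin m, i = w + v ∧ u = base v) := by
    intro i
    rcases lt_or_ge i w with hi | hi
    · obtain ⟨u, hu⟩ := hcov i hi
      exact ⟨u, fun _ => ⟨fun _ => hu, fun h => by omega⟩⟩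
    · rcases lt_or_ge i n with hin | hin
      · refine ⟨base ⟨i - w, by omega⟩, fun _ => ⟨fun h => by omega, fun _ =>
          ⟨⟨i - w, by omega⟩, by simp; omega, rfl⟩⟩⟩
      · exact ⟨⟨0, hm⟩, fun h => by omega⟩
  choose g hg using hex
  have hXY : ∀ i < n, ∀ j < n, i < w → w ≤ j → g i = g j → h i j := by
    intro i hi j hj hiw hjw e
    have h1 := (hg i hi).1 hiw
    obtain ⟨v, hv, hgv⟩ := (hg j hj).2 hjw
    have h2 := hal _ _ h1
    obtain ⟨b1, b2⟩ := hbase v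
    rw [e, hgv] at h2
    rcases h2 with h2 | ⟨h2, h3⟩
    · exact absurd b1 (not_le.2 h2)
    · rcases b2 with b2 | b2
      · rw [hv, b2]; rw [b2] at hv; exact h2 (by omega)
      · rw [hv, b2]; rw [b2] at hv; exact h3 (by omega)
  refine ⟨fun i => g i, fun i _ => (g i).2, fun i hi j hj hne e => ?_⟩
  have e : g i = g j := Fin.ext e
  rcases lt_or_ge i w with hiw | hiw <;> rcases lt_or_ge j w with hjw | hjw
  · have h1 := (hg i hi).1 hiw
    have h2 := (hg j hj).1 hjw
    rw [e] at h1
    rcases lt_or_gt_of_ne hne with hlt | hlt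
    · exact hsymm _ _ (hC _ _ h2 _ h1 hlt)
    · exact hC _ _ h1 _ h2 hlt
  · exact hXY i hi j hj hiw hjw e
  · exact hsymm _ _ (hXY j hj i hi hjw hiw e.symm)
  · obtain ⟨v, hv, hgv⟩ := (hg i hi).2 hiw
    obtain ⟨v', hv', hgv'⟩ := (hg j hj).2 hjw
    obtain ⟨b1, b2⟩ := hbase v
    obtain ⟨-, b3⟩ := hbase v'
    have eb : base v' = base v := by rw [← hgv, ← hgv', e]
    rw [eb] at b3
    have hne' : base v ≠ σ (base v) := by
      intro hb
      apply hne
      have e1 : v = base v := by rcases b2 with b2 | b2 <;> [exact b2; exact b2.trans hb.symm]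
      have e2 : v' = base v := by rcases b3 with b3 | b3 <;> [exact b3; exact b3.trans hb.symm]
      rw [hv, hv', e1.trans e2.symm]
    have h2 := hok (base v)
    have hlt : base v < σ (base v) := lt_of_le_of_ne b1 hne'
    rcases h2 with h2 | ⟨-, -, h2⟩
    · exact absurd hlt (not_lt.2 (by exact_mod_cast h2))
    · rcases b2 with b2 | b2 <;> rcases b3 with b3 | b3
      · exact absurd (by rw [hv, hv', b2.trans b3.symm]) hne
      · rw [hv, hv', b2, b3]; rwa [← b2] at h2 ⊢
      · rw [hv, hv', b2, b3]; exact hsymm _ _ h2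
      · exact absurd (by rw [hv, hv', b2.trans b3.symm]) hne

/-- No three vertices of `Y` share a colour, so equality of colours is a partial matching of `Y`,
and `σ` swaps matched rows. A class meeting `Y` goes to the row of its least vertex there. The other
classes fill the rows left over, which are larger partners or belong to no vertex, so their slots
impose nothing. -/
theorem exists_slots (hwn : w ≤ n) (hn : n ≤ w + m) (h0 : 0 < n) (hcov : Coverable h n m)
    (htri : ∀ i j l, w ≤ i → i < j → j < l → l < n → ¬ (h i j ∧ h i l ∧ h j l)) :
    ∃ (σ : Equiv.Perm (Fin m)) (φ : ℕ → Fin m), σ⁻¹ = σ ∧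
      (∀ x < w, ∀ y < w, y < x → φ x = φ y → h x y) ∧
      (∀ u : Fin m, OkSlot h n w u (σ u)) ∧
      ∀ u : Fin m, ∀ x < w, φ x = u → Allowed h n w u (σ u) x := by
  classical
  obtain ⟨f, hf, hcl⟩ := hcov
  have hm : 0 < m := by have := hf 0 h0; omega
  -- the least index of a vertex with a given colour
  have hrep : ∀ c : Fin m, ∃ v : ℕ, (∃ u, w + u < n ∧ f (w + u) = c) →
      w + v < n ∧ f (w + v) = c ∧ ∀ u, w + u < n → f (w + u) = c → v ≤ u := by
    intro c
    by_cases hc : ∃ u, w + u < n ∧ f (w + u) = c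
    · exact ⟨Nat.find hc, fun _ => ⟨(Nat.find_spec hc).1, (Nat.find_spec hc).2,
        fun u h1 h2 => Nat.find_min' hc ⟨h1, h2⟩⟩⟩
    · exact ⟨0, fun h => absurd h hc⟩
  choose rep hrep using hrep
  -- Extends the injection sending a colour on `Y` to its least row to a bijection between all
  -- colours and all rows.
  obtain ⟨g, hg⟩ := Finset.exists_equiv_extend_of_card_eq (α := Fin m) (t := range m) (by simp)
    (s := univ.filter fun c : Fin m => ∃ u, w + u < n ∧ f (w + u) = c) (f := rep)
    (by
      intro v hv
      simp only [mem_image, mem_filter, mem_univ, true_and, mem_range] at hv ⊢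
      obtain ⟨c, hc, rfl⟩ := hv
      have := (hrep c hc).1
      omega)
    (by
      intro c hc c' hc' e
      simp only [coe_filter, mem_univ, true_and, Set.mem_ofPred_eq] at hc hc'
      have h1 := (hrep c hc).2.1
      have h2 := (hrep c' hc').2.1
      rw [e, h2] at h1
      exact (Fin.ext h1).symm)
  let P : ℕ → ℕ → Prop := fun u v => u ≠ v ∧ w + u < n ∧ w + v < n ∧ f (w + u) = f (w + v)
  have hPs : ∀ u v, P u v → P v u := fun u v ⟨h1, h2, h3, h4⟩ => ⟨h1.symm, h3, h2, h4.symm⟩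
  have hPu : ∀ u v v', P u v → P u v' → v = v' := by
    have aux : ∀ a b c : ℕ, a < b → b < c → w + c < n → f (w + a) = f (w + b) →
        f (w + b) = f (w + c) → False := fun a b c h1 h2 h3 h4 h5 =>
      htri (w + a) (w + b) (w + c) (by omega) (by omega) (by omega) h3
        ⟨hcl _ (by omega) _ (by omega) (by omega) h4,
          hcl _ (by omega) _ (by omega) (by omega) (h4.trans h5),
          hcl _ (by omega) _ (by omega) (by omega) h5⟩
    rintro u v v' ⟨h1, h2, h3, h4⟩ ⟨h5, h6, h7, h8⟩
    by_contra hne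
    -- Two different partners of `u` would give three vertices of one colour, in one of six orders.
    rcases lt_trichotomy u v with a | a | a <;> rcases lt_trichotomy u v' with b | b | b <;>
      rcases lt_trichotomy v v' with c | c | c <;> first
      | omega
      | exact aux u v v' (by omega) (by omega) (by omega) (by omega) (by omega)
      | exact aux u v' v (by omega) (by omega) (by omega) (by omega) (by omega)
      | exact aux v u v' (by omega) (by omega) (by omega) (by omega) (by omega)
      | exact aux v' u v (by omega) (by omega) (by omega) (by omega) (by omega)
      | exact aux v v' u (by omega) (by omega) (by omega) (by omega) (by omega)
      | exact aux v' v u (by omega) (by omega) (by omega) (by omega) (by omega)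
  let s0 : ℕ → ℕ := fun u => if hu : ∃ v, P u v then hu.choose else u
  have hs1 : ∀ u v, P u v → s0 u = v := by
    intro u v huv
    have hu : ∃ v, P u v := ⟨v, huv⟩
    simp only [s0, dif_pos hu]
    exact hPu _ _ _ hu.choose_spec huv
  have hs2 : ∀ u, P u (s0 u) ∨ s0 u = u := by
    intro u
    by_cases hu : ∃ v, P u v
    · left; simp only [s0, dif_pos hu]; exact hu.choose_spec
    · right; simp only [s0, dif_neg hu]
  have hs3 : ∀ u, s0 (s0 u) = u := by
    intro u
    rcases hs2 u with h1 | h1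
    · exact hs1 _ _ (hPs _ _ h1)
    · rw [h1, h1]
  have hs4 : ∀ u : Fin m, s0 u < m := by
    intro u
    rcases hs2 u with h1 | h1
    · have := h1.2.2.1; omega
    · rw [h1]; exact u.2
  let σ : Equiv.Perm (Fin m) := Function.Involutive.toPerm (fun u => ⟨s0 u, hs4 u⟩)
    (fun u => Fin.ext (hs3 u))
  have hσ : ∀ u, (σ u : ℕ) = s0 u := fun u => rfl
  let f2 : ℕ → ℕ := fun x => if hx : x < n then (g ⟨f x, hf x hx⟩ : ℕ) else 0
  have hf2 : ∀ x < n, ∀ y < n, f2 x = f2 y → f x = f y := by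
    intro x hx y hy e
    simp only [f2, dif_pos hx, dif_pos hy] at e
    have := g.injective (Subtype.ext e)
    simpa using this
  have hf2m : ∀ x, f2 x < m := by
    intro x
    simp only [f2]
    split_ifs with hx
    · exact mem_range.1 (g ⟨f x, hf x hx⟩).2
    · exact hm
  have hf2w : ∀ u, w + u < n → u ≤ s0 u → f2 (w + u) = u := by
    intro u hu hle
    have hc : ∃ u', w + u' < n ∧ f (w + u') = (⟨f (w + u), hf _ hu⟩ : Fin m) := ⟨u, hu, rfl⟩
    have h1 : f2 (w + u) = rep ⟨f (w + u), hf _ hu⟩ := by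
      simp only [f2, dif_pos hu]
      exact hg _ (by simpa using hc)
    obtain ⟨h2, h3, h4⟩ := hrep _ hc
    have h5 := h4 u hu rfl
    rw [h1]
    by_contra hne
    have h6 : P u (rep ⟨f (w + u), hf _ hu⟩) := ⟨fun e => hne e.symm, hu, h2, h3.symm⟩
    have := hs1 _ _ h6
    omega
  refine ⟨σ, fun x => ⟨f2 x, hf2m x⟩, ?_, ?_, ?_, ?_⟩
  · exact Function.Involutive.toPerm_symm _
  · intro x hx y hy hyx e
    exact hcl _ (by omega) _ (by omega) (by omega)
      (hf2 _ (by omega) _ (by omega) (by simpa using e))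
  · intro u
    unfold OkSlot
    rw [hσ]
    rcases hs2 u with ⟨h1, h2, h3, h4⟩ | h1
    · exact Or.inr ⟨h2, h3, hcl _ h2 _ h3 (by omega) h4⟩
    · left; omega
  · rintro u x hx rfl
    unfold Allowed
    rw [hσ]
    simp only
    rcases lt_or_ge (s0 (f2 x)) (f2 x) with h1 | h1
    · exact Or.inl h1
    right
    -- A row not exceeding its partner hosts the class of its own vertex, so `x` has the colour of
    -- that vertex.
    have h2 : w + f2 x < n → f x = f (w + f2 x) := fun h2 =>
      hf2 _ (by omega) _ h2 (hf2w _ h2 h1).symm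
    refine ⟨fun h3 => hcl _ (by omega) _ h3 (by omega) (h2 h3), fun h3 => ?_⟩
    rcases hs2 (f2 x) with ⟨h4, h5, h6, h7⟩ | h4
    · exact hcl _ (by omega) _ h6 (by omega) ((h2 h5).trans h7)
    · rw [h4] at h3 ⊢
      exact hcl _ (by omega) _ h3 (by omega) (h2 h3)

end

end CliqueCover

/-! Size bounds for the determinant sum. -/

namespace CliqueCover

open Finset

/-- `N M a` says that the size of `a` is at most `M`, for a submultiplicative seminorm. -/
structure Gauge {R : Type*} [CommRing R] (N : ℤ → R → Prop) : Prop where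
  mono : ∀ {M M' a}, N M a → M ≤ M' → N M' a
  zero : N 0 0
  one : N 1 1
  neg : ∀ {M a}, N M a → N M (-a)
  add : ∀ {M M' a b}, N M a → N M' b → N (M + M') (a + b)
  mul : ∀ {M M' a b}, N M a → N M' b → N (M * M') (a * b)

/-- `N d a` says that the degree of `a` is at most `d`. -/
structure Filtration {R : Type*} [CommRing R] (N : ℕ → R → Prop) : Prop where
  mono : ∀ {M M' a}, N M a → M ≤ M' → N M' a
  zero : N 0 0
  one : N 0 1
  neg : ∀ {M a}, N M a → N M (-a)
  add : ∀ {M a b}, N M a → N M b → N M (a + b)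
  mul : ∀ {M M' a b}, N M a → N M' b → N (M + M') (a * b)

section

variable {R : Type*} [CommRing R] (h : ℕ → ℕ → Prop) {w m : ℕ} {a : ℕ → ℕ → R}
  {b : ℕ → ℕ → ℕ → R}

namespace Gauge

variable {N : ℤ → R → Prop} (hN : Gauge N)
include hN

theorem sum {ι : Type*} (s : Finset ι) {f : ι → R} {M : ℤ} (hf : ∀ i ∈ s, N M (f i)) :
    N (#s * M) (∑ i ∈ s, f i) := by
  classical
  induction s using Finset.induction_on with
  | empty => simpa using hN.zero
  | insert i s hi ih =>
    rw [sum_insert hi, card_insert_of_notMem hi]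
    have := hN.add (hf i (mem_insert_self _ _)) (ih fun j hj => hf j (mem_insert_of_mem hj))
    refine hN.mono this (le_of_eq ?_)
    push_cast; ring

theorem prod {ι : Type*} (s : Finset ι) {f : ι → R} {M : ℤ} (hf : ∀ i ∈ s, N M (f i)) :
    N (M ^ #s) (∏ i ∈ s, f i) := by
  classical
  induction s using Finset.induction_on with
  | empty => simpa using hN.one
  | insert i s hi ih =>
    rw [prod_insert hi, card_insert_of_notMem hi]
    have := hN.mul (hf i (mem_insert_self _ _)) (ih fun j hj => hf j (mem_insert_of_mem hj))
    exact hN.mono this (le_of_eq (by ring))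

/-- At most `2 ^ w` cliques, each of weight at most `ρ ^ w`. -/
theorem cliqueSum {ρ : ℤ} (hρ : 1 ≤ ρ) {f : ℕ → R} {s : Finset ℕ} (hs : s ⊆ range w)
    (hf : ∀ x < w, N ρ (f x)) : N ((2 * ρ) ^ w) (cliqueSum h f s) := by
  classical
  have hsw : #s ≤ w := by simpa using card_le_card hs
  refine hN.mono (hN.sum _ (M := ρ ^ w) fun C hC => ?_) ?_
  · rw [mem_filter, mem_powerset] at hC
    refine hN.mono (hN.prod C fun x hx => hf x (mem_range.1 (hs (hC.1 hx)))) ?_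
    exact pow_le_pow_right₀ hρ ((card_le_card hC.1).trans hsw)
  · rw [mul_pow]
    refine mul_le_mul_of_nonneg_right ?_ (by positivity)
    have h1 := card_filter_le s.powerset (IsCl h)
    rw [card_powerset] at h1
    exact_mod_cast h1.trans (Nat.pow_le_pow_right (by norm_num) hsw)

theorem wt {ρ : ℤ} (hρ : 1 ≤ ρ) {s : Finset ℕ} (hs : s ⊆ range w) {u v : ℕ}
    (ha : N ρ (a u v)) (hb : ∀ x < w, N ρ (b u v x)) :
    N ((2 * ρ) ^ (w + 1)) (wt h a b s u v) := by
  refine hN.mono (hN.mul ha (hN.cliqueSum h hρ hs hb)) ?_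
  rw [pow_succ']
  exact mul_le_mul_of_nonneg_right (by linarith) (by positivity)

theorem wtMatrix {ρ : ℤ} (hρ : 1 ≤ ρ) {s : Finset ℕ} (hs : s ⊆ range w)
    (ha : ∀ u < m, ∀ v < m, N ρ (a u v)) (hb : ∀ u < m, ∀ v < m, ∀ x < w, N ρ (b u v x))
    (u v : Fin m) : N ((2 * ρ) ^ (2 * (w + 1))) (wtMatrix h m a b s u v) := by
  refine hN.mono (hN.mul (hN.wt h hρ hs (ha u u.2 v v.2) (hb u u.2 v v.2))
    (hN.wt h hρ hs (ha v v.2 u u.2) (hb v v.2 u u.2))) (le_of_eq ?_)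
  rw [← pow_add, two_mul (w + 1)]

theorem det {A : Matrix (Fin m) (Fin m) R} {M : ℤ} (hA : ∀ u v, N M (A u v)) :
    N (m.factorial * M ^ m) A.det := by
  rw [FaddeevLeVerrier.det_eq_sum_rows]
  refine hN.mono (hN.sum univ (M := M ^ m) fun σ _ => ?_) (by simp [Fintype.card_perm])
  have := hN.prod univ fun u (_ : u ∈ univ) => hA u (σ u)
  rw [card_univ, Fintype.card_fin] at this
  rcases Int.units_eq_one_or (Equiv.Perm.sign σ) with h | h
  · simpa [h] using this
  · simpa [h] using hN.neg this

theorem detSum {ρ : ℤ} (hρ : 1 ≤ ρ)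
    (ha : ∀ u < m, ∀ v < m, N ρ (a u v)) (hb : ∀ u < m, ∀ v < m, ∀ x < w, N ρ (b u v x)) :
    N (2 ^ w * (m.factorial * ((2 * ρ) ^ (2 * (w + 1))) ^ m)) (detSum h w m a b) := by
  refine hN.mono (hN.sum (range w).powerset fun s hs =>
    hN.det fun u v => hN.wtMatrix h hρ (mem_powerset.1 hs) ha hb u v) (le_of_eq ?_)
  simp

end Gauge

namespace Filtration

variable {N : ℕ → R → Prop} (hN : Filtration N)
include hN

theorem sum {ι : Type*} (s : Finset ι) {f : ι → R} {M : ℕ} (hf : ∀ i ∈ s, N M (f i)) :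
    N M (∑ i ∈ s, f i) := by
  classical
  induction s using Finset.induction_on with
  | empty => simpa using hN.mono hN.zero (Nat.zero_le _)
  | insert i s hi ih =>
    rw [sum_insert hi]
    exact hN.add (hf i (mem_insert_self _ _)) (ih fun j hj => hf j (mem_insert_of_mem hj))

theorem prod {ι : Type*} (s : Finset ι) {f : ι → R} {M : ℕ} (hf : ∀ i ∈ s, N M (f i)) :
    N (#s * M) (∏ i ∈ s, f i) := by
  classical
  induction s using Finset.induction_on with
  | empty => simpa using hN.one
  | insert i s hi ih =>
    rw [prod_insert hi, card_insert_of_notMem hi]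
    have := hN.mul (hf i (mem_insert_self _ _)) (ih fun j hj => hf j (mem_insert_of_mem hj))
    exact hN.mono this (le_of_eq (by ring))

theorem detSum {d : ℕ}
    (ha : ∀ u < m, ∀ v < m, N d (a u v)) (hb : ∀ u < m, ∀ v < m, ∀ x < w, N d (b u v x)) :
    N (m * (2 * ((w + 1) * d))) (detSum h w m a b) := by
  classical
  have hwt : ∀ s ∈ (range w).powerset, ∀ u v : Fin m,
      N ((w + 1) * d) (CliqueCover.wt h a b s u v) := by
    intro s hs u v
    rw [mem_powerset] at hs
    have : N (w * d) (cliqueSum h (b u v) s) := by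
      refine hN.sum _ fun C hC => ?_
      rw [mem_filter, mem_powerset] at hC
      refine hN.mono (hN.prod C fun x hx => hb u u.2 v v.2 x (mem_range.1 (hs (hC.1 hx)))) ?_
      gcongr
      simpa using card_le_card (hC.1.trans hs)
    exact hN.mono (hN.mul (ha u u.2 v v.2) this) (le_of_eq (by ring))
  refine hN.sum _ fun s hs => ?_
  rw [FaddeevLeVerrier.det_eq_sum_rows]
  refine hN.sum _ fun σ _ => ?_
  have := hN.prod univ fun u (_ : u ∈ univ) =>
    hN.mul (hwt s hs u (σ u)) (hwt s hs (σ u) u)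
  rw [card_univ, Fintype.card_fin, ← two_mul] at this
  rcases Int.units_eq_one_or (Equiv.Perm.sign σ) with h | h
  · simpa [h, wtMatrix] using this
  · simpa [h, wtMatrix] using hN.neg this

end Filtration

end

/-- For the numbers that the machine stores. -/
theorem gauge_int : Gauge (R := ℤ) fun M a => |a| ≤ M where
  mono h h' := h.trans h'
  zero := by simp
  one := by simp
  neg h := by simpa using h
  add h h' := (abs_add_le _ _).trans (add_le_add h h')
  mul h h' := by
    rw [abs_mul]
    exact mul_le_mul h h' (abs_nonneg _) ((abs_nonneg _).trans h)

open Polynomial in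
/-- The sum of the absolute values of the coefficients of `P` is at most `M`. -/
def CoeffBound (M : ℤ) (P : ℤ[X]) : Prop :=
  ∃ Q : ℤ[X], (∀ i, |P.coeff i| ≤ Q.coeff i) ∧ Q.eval 1 ≤ M

open Polynomial in
theorem coeff_le_eval_one {Q : ℤ[X]} (hQ : ∀ i, 0 ≤ Q.coeff i) (i : ℕ) :
    Q.coeff i ≤ Q.eval 1 := by
  rw [eval_eq_sum_range' (n := max (Q.natDegree + 1) (i + 1)) (by omega)]
  simp only [one_pow, mul_one]
  exact single_le_sum (f := fun i => Q.coeff i) (fun j _ => hQ j) (mem_range.2 (by omega))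

open Polynomial in
theorem CoeffBound.abs_coeff_le {M : ℤ} {P : ℤ[X]} (h : CoeffBound M P) (i : ℕ) :
    |P.coeff i| ≤ M := by
  obtain ⟨Q, h1, h2⟩ := h
  exact (h1 i).trans ((coeff_le_eval_one (fun j => (abs_nonneg _).trans (h1 j)) i).trans h2)

open Polynomial in
-- Sums and products of coefficientwise majorants are majorants, and evaluation at 1 is a ring
-- homomorphism.
theorem gauge_coeffBound : Gauge CoeffBound where
  mono := fun ⟨Q, h1, h2⟩ h => ⟨Q, h1, h2.trans h⟩
  zero := ⟨0, by simp, by simp⟩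
  one := ⟨1, fun i => by rw [coeff_one]; split_ifs <;> simp, by simp⟩
  neg := fun ⟨Q, h1, h2⟩ => ⟨Q, by simpa using h1, h2⟩
  add := fun ⟨Q, h1, h2⟩ ⟨Q', h1', h2'⟩ => ⟨Q + Q', fun i => by
    rw [coeff_add, coeff_add]
    exact (abs_add_le _ _).trans (add_le_add (h1 i) (h1' i)), by
    rw [eval_add]; exact add_le_add h2 h2'⟩
  mul := fun {M M' a b} ⟨Q, h1, h2⟩ ⟨Q', h1', h2'⟩ => ⟨Q * Q', fun i => by
    rw [coeff_mul, coeff_mul]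
    refine (abs_sum_le_sum_abs _ _).trans (sum_le_sum fun p _ => ?_)
    rw [abs_mul]
    exact mul_le_mul (h1 _) (h1' _) (abs_nonneg _) ((abs_nonneg _).trans (h1 _)), by
    have e1 := (abs_nonneg _).trans ((h1 0).trans
      (coeff_le_eval_one (fun j => (abs_nonneg _).trans (h1 j)) 0))
    have e2 := (abs_nonneg _).trans ((h1' 0).trans
      (coeff_le_eval_one (fun j => (abs_nonneg _).trans (h1' j)) 0))
    rw [eval_mul]
    exact mul_le_mul h2 h2' e2 (e1.trans h2)⟩

open Polynomial in
-- For the number of digits that have to be inspected.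
theorem filtration_natDegree {R : Type*} [CommRing R] :
    Filtration (R := R[X]) fun d P => P.natDegree ≤ d where
  mono h h' := h.trans h'
  zero := by simp
  one := by simp
  neg h := by simpa using h
  add h h' := natDegree_add_le_of_degree_le h h'
  mul h h' := natDegree_mul_le_of_le h h'

/-- For the degree in the Schwartz–Zippel bound. -/
theorem filtration_totalDegree {R : Type*} [CommRing R] {κ : Type*} :
    Filtration (R := MvPolynomial κ R) fun d P => P.totalDegree ≤ d where
  mono h h' := h.trans h'
  zero := by simp
  one := by simp
  neg h := by simpa using h
  add h h' := (MvPolynomial.totalDegree_add _ _).trans (max_le h h')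
  mul h h' := (MvPolynomial.totalDegree_mul _ _).trans (add_le_add h h')

end CliqueCover

/-! Random weights. -/

namespace CliqueCover

open Finset

section

variable {R S : Type*} [CommRing R] [CommRing S]

/-- The value at `t` of the polynomial with coefficients `β (s - 1), …, β 0`. -/
def horner (t : R) (β : ℕ → Bool) : ℕ → R
  | 0 => 0
  | s + 1 => horner t β s * t + if β s then 1 else 0

/-- The random weights: `N` blocks of `s` random bits each. -/
def rand (t : R) (s N : ℕ) (ω : ℕ → Bool) (q : ℕ) : R :=
  if q < N then horner t (fun j => ω (q * s + j)) s else 0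

theorem map_horner (f : R →+* S) (t : R) (β : ℕ → Bool) (s : ℕ) :
    f (horner t β s) = horner (f t) β s := by
  induction s with
  | zero => simp [horner]
  | succ s ih => simp only [horner, map_add, map_mul, ih]; split_ifs <;> simp

theorem map_rand (f : R →+* S) (t : R) (s N : ℕ) (ω : ℕ → Bool) (q : ℕ) :
    f (rand t s N ω q) = rand (f t) s N ω q := by
  unfold rand; split_ifs <;> simp [map_horner]

theorem horner_congr (t : R) {β β' : ℕ → Bool} {s : ℕ} (h : ∀ j < s, β j = β' j) :
    horner t β s = horner t β' s := by
  induction s with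
  | zero => rfl
  | succ s ih => simp only [horner, ih fun j hj => h j (by omega), h s (by omega)]

open Polynomial in
-- The bits are the coefficients, so `s` bits yield `2 ^ s` different weights.
theorem horner_inj [Nontrivial R] {β β' : ℕ → Bool} {s : ℕ}
    (h : horner (X : R[X]) β s = horner X β' s) : ∀ j < s, β j = β' j := by
  induction s with
  | zero => simp
  | succ s ih =>
    have hc : ∀ b : Bool, (if b then 1 else 0 : R[X]) = C (if b then 1 else 0) := by
      intro b; split_ifs <;> simp
    simp only [horner, hc] at h
    have h0 := congrArg (fun p => p.coeff 0) h
    simp only [coeff_add, coeff_mul_X_zero, zero_add, coeff_C_zero] at h0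
    have h1 : β s = β' s := by
      cases h1 : β s <;> cases h2 : β' s <;> simp_all
    have h2 : horner (X : R[X]) β s = horner X β' s := by
      rw [h1] at h
      ext i
      have := congrArg (fun p => p.coeff (i + 1)) (add_right_cancel h)
      simpa [coeff_mul_X] using this
    intro j hj
    rcases Nat.lt_succ_iff_lt_or_eq.1 hj with hj | rfl
    · exact ih h2 j hj
    · exact h1

open Polynomial in
theorem natDegree_horner_le (β : ℕ → Bool) (s : ℕ) : (horner (X : R[X]) β s).natDegree ≤ s := by
  induction s with
  | zero => simp [horner]
  | succ s ih =>
    rw [horner]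
    refine natDegree_add_le_of_degree_le (natDegree_mul_le_of_le ih natDegree_X_le) ?_
    split_ifs <;> simp

open Polynomial in
theorem coeffBound_horner (β : ℕ → Bool) (s : ℕ) : CoeffBound s (horner (X : ℤ[X]) β s) := by
  induction s with
  | zero => simpa [horner] using gauge_coeffBound.zero
  | succ s ih =>
    rw [horner]
    have hX : CoeffBound 1 (X : ℤ[X]) :=
      ⟨X, fun i => by rw [coeff_X]; split_ifs <;> simp, by simp⟩
    have hb : CoeffBound 1 (if β s then 1 else 0 : ℤ[X]) := by
      split_ifs
      · exact gauge_coeffBound.one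
      · exact gauge_coeffBound.mono gauge_coeffBound.zero (by norm_num)
    exact gauge_coeffBound.mono (gauge_coeffBound.add (gauge_coeffBound.mul ih hX) hb)
      (by push_cast; linarith)

theorem abs_horner_le {B : ℤ} (hB : 2 ≤ B) (β : ℕ → Bool) (s : ℕ) :
    |horner B β s| ≤ B ^ s - 1 := by
  induction s with
  | zero => simp [horner]
  | succ s ih =>
    rw [horner]
    have hb : |(if β s then 1 else 0 : ℤ)| ≤ 1 := by split_ifs <;> simp
    refine (abs_add_le _ _).trans ?_
    rw [abs_mul, abs_of_nonneg (by linarith : 0 ≤ B), pow_succ]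
    nlinarith

end

/-! ### The determinant sum as a function of the weights. -/

section

variable {R S : Type*} [CommRing R] [CommRing S] (h : ℕ → ℕ → Prop) (n w m : ℕ)

open Classical in
-- Each slot owns `w + 1` consecutive weights: one for each vertex of `X`, and the last for the slot
-- itself.
noncomputable def slotWeight (r : ℕ → R) (u v : ℕ) : R :=
  if OkSlot h n w u v then r ((u * m + v) * (w + 1) + w) else 0

open Classical in
noncomputable def vertexWeight (r : ℕ → R) (u v x : ℕ) : R :=
  if Allowed h n w u v x then r ((u * m + v) * (w + 1) + x) else 0

/-- The determinant sum for the weights `r`. -/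
noncomputable def coverSum (r : ℕ → R) : R :=
  detSum h w m (slotWeight h n w m r) (vertexWeight h n w m r)

theorem map_coverSum (f : R →+* S) (r : ℕ → R) :
    f (coverSum h n w m r) = coverSum h n w m fun q => f (r q) := by
  rw [coverSum, map_detSum, coverSum]
  congr
  · funext u v; unfold slotWeight; split_ifs <;> simp
  · funext u v x; unfold vertexWeight; split_ifs <;> simp

variable {h n w m}

/-- An involution and covering cliques without a zero weight would satisfy the conditions of
`coverable_of_slots`. -/
theorem coverSum_eq_zero [CharP R 2] (hsymm : ∀ x y, h x y → h y x) (hn : n ≤ w + m)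
    (hcov : ¬ Coverable h n m) (r : ℕ → R) : coverSum h n w m r = 0 := by
  refine detSum_eq_zero h _ _ fun σ C hσ hC _ hw => ?_
  by_contra! H
  refine hcov (coverable_of_slots hsymm hn σ hσ C hC hw (fun u => ?_) fun u x hx => ?_)
  · by_contra hu
    exact (H u).1 (if_neg hu)
  · by_contra hu
    exact (H u).2 x hx (if_neg hu)

theorem slot_lt {u v j : ℕ} (hu : u < m) (hv : v < m) (hj : j < w + 1) :
    (u * m + v) * (w + 1) + j < m * m * (w + 1) := by
  have h1 : u * m + v + 1 ≤ m * m := by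
    have : (u + 1) * m ≤ m * m := Nat.mul_le_mul_right _ hu
    linarith
  have h2 : (u * m + v + 1) * (w + 1) ≤ m * m * (w + 1) := Nat.mul_le_mul_right _ h1
  linarith

theorem slot_div {q j : ℕ} (hj : j < w + 1) : (q * (w + 1) + j) / (w + 1) = q ∧
    (q * (w + 1) + j) % (w + 1) = j := by
  constructor
  · rw [mul_comm, Nat.mul_add_div (by omega), Nat.div_eq_of_lt hj, add_zero]
  · rw [mul_comm, Nat.mul_add_mod, Nat.mod_eq_of_lt hj]

/-- The generic determinant sum. -/
noncomputable def coverPoly (h : ℕ → ℕ → Prop) (n w m : ℕ) (K : Type*) [CommRing K] :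
    MvPolynomial (Fin (m * m * (w + 1))) K :=
  coverSum h n w m fun q => if hq : q < m * m * (w + 1) then MvPolynomial.X ⟨q, hq⟩ else 0

theorem eval_coverPoly {K : Type*} [CommRing K] (r : ℕ → K)
    (hr : ∀ q, m * m * (w + 1) ≤ q → r q = 0) :
    MvPolynomial.eval (fun q : Fin (m * m * (w + 1)) => r q) (coverPoly h n w m K) = coverSum h n w m r := by
  rw [coverPoly, map_coverSum]
  congr
  funext q
  split_ifs with hq
  · simp
  · simp [hr q (by omega)]

theorem coverPoly_ne_zero {K : Type*} [CommRing K] [CharP K 2] [Nontrivial K] (hwn : w ≤ n)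
    (hn : n ≤ w + m) (h0 : 0 < n) (hcov : Coverable h n m)
    (htri : ∀ i j l, w ≤ i → i < j → j < l → l < n → ¬ (h i j ∧ h i l ∧ h j l)) :
    coverPoly h n w m K ≠ 0 := by
  classical
  obtain ⟨σ, φ, hσ, hφ, hok, hal⟩ := exists_slots hwn hn h0 hcov htri
  -- Decodes `q = (u * m + v) * (w + 1) + x`: the weight is `[φ x = u]` for `x < w`, and `[σ u = v]`
  -- for `x = w`.
  let r : ℕ → K := fun q =>
    if hq : q < m * m * (w + 1) then
      if q % (w + 1) < w then
        if (φ (q % (w + 1)) : ℕ) = q / (w + 1) / m then 1 else 0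
      else
        if ∃ u : Fin m, (u : ℕ) = q / (w + 1) / m ∧ (σ u : ℕ) = q / (w + 1) % m then 1 else 0
    else 0
  have e := eval_coverPoly (h := h) (n := n) (w := w) (m := m) r (fun q hq => dif_neg (by omega))
  have hdec : ∀ u v : Fin m, ((u : ℕ) * m + v) / m = u ∧ ((u : ℕ) * m + v) % m = v := by
    intro u v
    have := u.2
    constructor
    · rw [mul_comm, Nat.mul_add_div (by omega), Nat.div_eq_of_lt v.2, add_zero]
    · rw [mul_comm, Nat.mul_add_mod, Nat.mod_eq_of_lt v.2]
  have e1 : coverSum h n w m r = 1 := by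
    refine detSum_eq_one h σ hσ φ hφ _ _ (fun u v => ?_) (fun u x hx => ?_)
    · have hw : w < w + 1 := by omega
      have d1 := slot_div (q := (u : ℕ) * m + v) hw
      have d2 := hdec u v
      have hr : r ((u * m + v) * (w + 1) + w) = if σ u = v then 1 else 0 := by
        simp only [r]
        rw [dif_pos (slot_lt u.2 v.2 hw), d1.1, d1.2, d2.1, d2.2, if_neg (lt_irrefl _)]
        congr 1
        apply propext
        constructor
        · rintro ⟨u', hu', hv'⟩
          rw [Fin.ext hu'] at hv'
          exact Fin.ext hv'
        · rintro rfl
          exact ⟨u, rfl, rfl⟩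
      unfold slotWeight
      rw [hr]
      split_ifs with h1 h2 h2
      · rfl
      -- A forbidden slot has weight 0 anyway, since `σ` uses only admissible ones.
      · rfl
      · exact absurd (h2 ▸ hok u) h1
      · rfl
    · have hx' : x < w + 1 := by omega
      have d1 := slot_div (q := (u : ℕ) * m + σ u) hx'
      have d2 := hdec u (σ u)
      have hr : r ((u * m + σ u) * (w + 1) + x) = if φ x = u then 1 else 0 := by
        simp only [r]
        rw [dif_pos (slot_lt u.2 (σ u).2 hx'), d1.1, d1.2, d2.1, if_pos hx]
        simp only [Fin.ext_iff]
      unfold vertexWeight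
      rw [hr]
      split_ifs with h1 h2 h2
      · rfl
      · rfl
      · exact absurd (hal u x hx h2) h1
      · rfl
  intro hz
  rw [hz, map_zero, e1] at e
  exact zero_ne_one e

theorem totalDegree_coverPoly_le {K : Type*} [CommRing K] [Nontrivial K] :
    (coverPoly h n w m K).totalDegree ≤ m * (2 * ((w + 1) * 1)) := by
  have hX : ∀ q, (if hq : q < m * m * (w + 1) then MvPolynomial.X ⟨q, hq⟩ else 0 :
      MvPolynomial (Fin (m * m * (w + 1))) K).totalDegree ≤ 1 := by
    intro q
    split_ifs
    · simp
    · simp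
  refine filtration_totalDegree.detSum h (fun u _ v _ => ?_) (fun u _ v _ x _ => ?_)
  · unfold slotWeight
    split_ifs
    · exact hX _
    · simp
  · unfold vertexWeight
    split_ifs
    · exact hX _
    · simp

end

/-! ### The probability that the random weights hit a zero. -/

theorem coins_agree (ω₀ : ℕ → Bool) (Z : ℕ) :
    RAM.coins.real {ω | ∀ i < Z, ω i = ω₀ i} = (1 / 2 : ℝ) ^ Z := by
  have hset : {ω : ℕ → Bool | ∀ i < Z, ω i = ω₀ i}
      = Set.pi (range Z : Finset ℕ) fun i => {ω₀ i} := by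
    ext ω; simp [Set.mem_pi]
  have hone : ∀ b : Bool, (PMF.uniformOfFintype Bool).toMeasure {b} = (1 / 2 : ENNReal) := by
    intro b
    rw [PMF.toMeasure_apply_singleton _ _ (MeasurableSet.singleton b)]
    simp
  rw [hset, Measure.real, RAM.coins, Measure.infinitePi_pi _ fun i _ => MeasurableSet.singleton _]
  simp [hone]

open Polynomial in
-- Schwartz–Zippel over the domain `𝔽₂[X]`, with the `2 ^ s` polynomials given by `s` bits as sample
-- set; no field with `2 ^ s` elements is needed. A total degree of at most `2 m (w + 1)` gives the
-- bound.
theorem coins_coverSum_eq_zero_le {h : ℕ → ℕ → Prop} {n w m : ℕ} (s : ℕ) (hwn : w ≤ n)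
    (hn : n ≤ w + m) (h0 : 0 < n) (hcov : Coverable h n m)
    (htri : ∀ i j l, w ≤ i → i < j → j < l → l < n → ¬ (h i j ∧ h i l ∧ h j l)) :
    RAM.coins.real {ω | coverSum h n w m
      (rand (X : (ZMod 2)[X]) s (m * m * (w + 1)) ω) = 0} ≤ (2 * m * (w + 1) : ℕ) / 2 ^ s := by
  classical
  set N := m * m * (w + 1) with hNdef
  set P := coverPoly h n w m (ZMod 2)[X] with hP
  let toPoly : (Fin s → Bool) → (ZMod 2)[X] := fun β =>
    horner X (fun j => if hj : j < s then β ⟨j, hj⟩ else false) s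
  have hinj : Function.Injective toPoly := by
    intro β β' e
    funext j
    have := horner_inj e j j.2
    simpa using this
  let S : Finset (ZMod 2)[X] := univ.image toPoly
  have hS : #S = 2 ^ s := by
    rw [card_image_of_injective _ hinj]; simp
  have hSZ := MvPolynomial.schwartz_zippel_totalDegree
    (coverPoly_ne_zero (K := (ZMod 2)[X]) hwn hn h0 hcov htri) S
  set bad : Finset (Fin N → (ZMod 2)[X]) :=
    {f ∈ Fintype.piFinset fun _ => S | MvPolynomial.eval f P = 0} with hbad
  have hr0 : ∀ (ω : ℕ → Bool) q, N ≤ q → rand (X : (ZMod 2)[X]) s N ω q = 0 :=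
    fun ω q hq => if_neg (by omega)
  have hsub : {ω | coverSum h n w m (rand (X : (ZMod 2)[X]) s N ω) = 0}
      ⊆ ⋃ f ∈ bad, {ω | (fun q : Fin N => rand (X : (ZMod 2)[X]) s N ω q) = f} := by
    intro ω hω
    simp only [Set.mem_iUnion]
    refine ⟨fun q => rand X s N ω q, ?_, rfl⟩
    rw [hbad, mem_filter, Fintype.mem_piFinset]
    refine ⟨fun q => mem_image.2 ⟨fun j => ω (q * s + j), mem_univ _, ?_⟩, ?_⟩
    · simp only [toPoly, rand, if_pos q.2]
      exact horner_congr _ fun j hj => by simp [hj]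
    · rw [hP, eval_coverPoly _ (hr0 ω)]; exact hω
  -- The weights determine the first `N * s` bits, so each value of the weights lies in one cylinder
  -- of that length or does not occur.
  have hpt : ∀ f ∈ bad, RAM.coins.real
      {ω | (fun q : Fin N => rand (X : (ZMod 2)[X]) s N ω q) = f} ≤ (1 / 2 : ℝ) ^ (N * s) := by
    intro f _
    by_cases hf : ∃ ω₀, (fun q : Fin N => rand (X : (ZMod 2)[X]) s N ω₀ q) = f
    · obtain ⟨ω₀, rfl⟩ := hf
      rw [← coins_agree ω₀]
      have : IsProbabilityMeasure RAM.coins := by unfold RAM.coins; infer_instance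
      refine measureReal_mono fun ω hω i hi => ?_
      have hs : 0 < s := by
        rcases Nat.eq_zero_or_pos s with rfl | hs
        · simp at hi
        · exact hs
      have hq : i / s < N := (Nat.div_lt_iff_lt_mul hs).2 hi
      have e := congrFun hω ⟨i / s, hq⟩
      simp only [rand, if_pos hq] at e
      have := horner_inj e (i % s) (Nat.mod_lt _ hs)
      rwa [mul_comm, Nat.div_add_mod] at this
    · have : {ω | (fun q : Fin N => rand (X : (ZMod 2)[X]) s N ω q) = f} = ∅ := by
        ext ω; simp only [Set.mem_ofPred_eq, Set.mem_empty_iff_false, iff_false]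
        exact fun e => hf ⟨ω, e⟩
      rw [this]; simp
  have hprob : IsProbabilityMeasure RAM.coins := by unfold RAM.coins; infer_instance
  calc RAM.coins.real {ω | coverSum h n w m (rand (X : (ZMod 2)[X]) s N ω) = 0}
      ≤ RAM.coins.real (⋃ f ∈ bad,
          {ω | (fun q : Fin N => rand (X : (ZMod 2)[X]) s N ω q) = f}) :=
        measureReal_mono hsub (measure_ne_top _ _)
    _ ≤ ∑ f ∈ bad, RAM.coins.real
          {ω | (fun q : Fin N => rand (X : (ZMod 2)[X]) s N ω q) = f} :=
        measureReal_biUnion_finset_le _ _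
    _ ≤ ∑ f ∈ bad, (1 / 2 : ℝ) ^ (N * s) := sum_le_sum hpt
    _ = #bad / (2 ^ s) ^ N := by
        rw [sum_const, nsmul_eq_mul, ← pow_mul, mul_comm s N, one_div, inv_pow, div_eq_mul_inv]
    _ ≤ P.totalDegree / 2 ^ s := by
        rw [hS] at hSZ
        have := (NNRat.cast_le (K := ℝ)).2 hSZ
        push_cast at this
        exact this
    _ ≤ (2 * m * (w + 1) : ℕ) / 2 ^ s := by
        gcongr
        refine totalDegree_coverPoly_le.trans (le_of_eq ?_)
        ring

end CliqueCover

/-! Recovering the parities of the coefficients of an integer polynomial from one value. -/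

namespace CliqueCover

open Finset Polynomial

/-- Repeated removal of the last balanced digit in base `2 * β`. -/
def digits (β D : ℤ) : ℕ → ℤ
  | 0 => D
  | i + 1 => (digits β D i + β) / (2 * β)

/-- After `i` rounds the polynomial without its lowest `i` coefficients remains, evaluated at `2 *
β`. Its constant coefficient lies in `(-β, β)`, so adding `β` and dividing removes exactly that one;
and since the base is even, it decides the parity. -/
theorem digits_eval {β : ℤ} {P : ℤ[X]} (hP : ∀ i, |P.coeff i| < β) (i : ℕ) :
    digits β (P.eval (2 * β)) i % 2 = P.coeff i % 2 := by
  have hβ : 0 < β := (abs_nonneg _).trans_lt (hP 0)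
  suffices H : ∃ Q : ℤ[X], (∀ j, Q.coeff j = P.coeff (i + j)) ∧
      digits β (P.eval (2 * β)) i = Q.eval (2 * β) by
    obtain ⟨Q, h1, h2⟩ := H
    have h3 := h1 0
    rw [add_zero] at h3
    rw [h2, ← h3, ← divX_mul_X_add Q]
    simp only [eval_add, eval_mul, eval_X, eval_C, coeff_add, coeff_mul_X_zero, coeff_C_zero,
      zero_add]
    rw [show Q.divX.eval (2 * β) * (2 * β) + Q.coeff 0
      = Q.coeff 0 + 2 * (Q.divX.eval (2 * β) * β) by ring, Int.add_mul_emod_self_left]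
  induction i with
  | zero => exact ⟨P, fun j => by rw [zero_add], rfl⟩
  | succ i ih =>
    obtain ⟨Q, h1, h2⟩ := ih
    refine ⟨Q.divX, fun j => ?_, ?_⟩
    · rw [coeff_divX, h1, add_right_comm, add_assoc]
    · rw [digits, h2]
      conv_lhs => rw [← divX_mul_X_add Q]
      simp only [eval_add, eval_mul, eval_X, eval_C]
      have h3 := abs_lt.1 (h1 0 ▸ hP (i + 0))
      rw [add_assoc, add_comm, Int.add_mul_ediv_right _ _ (by omega),
        Int.ediv_eq_zero_of_lt (by omega) (by omega), zero_add]

theorem exists_digits_odd_iff {β : ℤ} {P : ℤ[X]} (hP : ∀ i, |P.coeff i| < β) {K : ℕ}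
    (hK : P.natDegree < K) : (∃ i < K, digits β (P.eval (2 * β)) i % 2 ≠ 0) ↔
      P.map (Int.castRingHom (ZMod 2)) ≠ 0 := by
  have hz : ∀ c : ℤ, c % 2 = 0 ↔ (c : ZMod 2) = 0 := fun c => by
    rw [ZMod.intCast_zmod_eq_zero_iff_dvd]; exact ⟨Int.dvd_of_emod_eq_zero, Int.emod_eq_zero_of_dvd⟩
  simp only [digits_eval hP]
  constructor
  · rintro ⟨i, -, hi⟩ h0
    have := congrArg (fun p => p.coeff i) h0
    simp only [coeff_map, coeff_zero, eq_intCast] at this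
    exact hi ((hz _).2 this)
  · intro h0
    by_contra! H
    refine h0 (Polynomial.ext fun i => ?_)
    rw [coeff_map, coeff_zero, eq_intCast, ← hz]
    rcases lt_or_ge i K with hi | hi
    · exact H i hi
    · rw [coeff_eq_zero_of_natDegree_lt (by omega)]; rfl

/-- The bit length of the base. -/
def bigExp (w m s : ℕ) : ℕ := w + m * m + 2 * s * (w + 1) * m + 1

/-- One polynomial over `ℤ` yields both sides: its value at the base is the integer that is
computed, and its reduction mod 2 is the sum over `𝔽₂[X]`. -/
theorem exists_digits_odd_coverSum_iff (h : ℕ → ℕ → Prop) (n w m s N : ℕ) (hs : 1 ≤ s)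
    (ω : ℕ → Bool) :
    (∃ i < 2 * m * (w + 1) * s + 1, digits (2 ^ bigExp w m s)
      (coverSum h n w m (rand ((2 : ℤ) * 2 ^ bigExp w m s) s N ω)) i % 2 ≠ 0) ↔
      coverSum h n w m (rand (X : (ZMod 2)[X]) s N ω) ≠ 0 := by
  set P : ℤ[X] := coverSum h n w m (rand (X : ℤ[X]) s N ω) with hP
  have hr1 : ∀ q, CoeffBound s (rand (X : ℤ[X]) s N ω q) := fun q => by
    unfold rand
    split_ifs
    · exact coeffBound_horner _ _
    · exact gauge_coeffBound.mono gauge_coeffBound.zero (by positivity)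
  have hr2 : ∀ q, (rand (X : ℤ[X]) s N ω q).natDegree ≤ s := fun q => by
    unfold rand
    split_ifs
    · exact natDegree_horner_le _ _
    · simp
  have hzero : CoeffBound s (0 : ℤ[X]) :=
    gauge_coeffBound.mono gauge_coeffBound.zero (by positivity)
  have hb := gauge_coeffBound.detSum h (w := w) (m := m) (ρ := (s : ℤ)) (by omega)
    (a := slotWeight h n w m (rand (X : ℤ[X]) s N ω))
    (b := vertexWeight h n w m (rand (X : ℤ[X]) s N ω))
    (fun u _ v _ => by unfold slotWeight; split_ifs <;> [exact hr1 _; exact hzero])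
    (fun u _ v _ x _ => by unfold vertexWeight; split_ifs <;> [exact hr1 _; exact hzero])
  have hd : P.natDegree ≤ _ := filtration_natDegree.detSum h (w := w) (m := m) (d := s)
    (a := slotWeight h n w m (rand (X : ℤ[X]) s N ω))
    (b := vertexWeight h n w m (rand (X : ℤ[X]) s N ω))
    (fun u _ v _ => by unfold slotWeight; split_ifs <;> [exact hr2 _; simp])
    (fun u _ v _ x _ => by unfold vertexWeight; split_ifs <;> [exact hr2 _; simp])
  -- The coefficient bound, with `m! ≤ 2 ^ (m * m)` and `2 * s ≤ 2 ^ s`, explains the exponent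
  -- `bigExp`.
  have hbound : (2 : ℤ) ^ w * (m.factorial * ((2 * s) ^ (2 * (w + 1))) ^ m) < 2 ^ bigExp w m s := by
    have h1 : m.factorial ≤ 2 ^ (m * m) := by
      refine (Nat.factorial_le_pow m).trans ?_
      rw [pow_mul]
      exact Nat.pow_le_pow_left Nat.lt_two_pow_self.le m
    have h2 : 2 * s ≤ 2 ^ s := by
      obtain ⟨r, rfl⟩ := Nat.exists_eq_add_of_le' hs
      rw [pow_succ, mul_comm]
      exact Nat.mul_le_mul_right _ Nat.lt_two_pow_self
    have h3 : 2 ^ w * (m.factorial * ((2 * s) ^ (2 * (w + 1))) ^ m)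
        ≤ 2 ^ w * (2 ^ (m * m) * ((2 ^ s) ^ (2 * (w + 1))) ^ m) := by gcongr
    have h4 : 2 ^ w * (2 ^ (m * m) * ((2 ^ s) ^ (2 * (w + 1))) ^ m)
        = 2 ^ (w + m * m + 2 * s * (w + 1) * m) := by
      rw [← pow_mul, ← pow_mul, ← pow_add, ← pow_add]
      congr 1; ring
    have h5 : 2 ^ (w + m * m + 2 * s * (w + 1) * m) < 2 ^ bigExp w m s :=
      Nat.pow_lt_pow_right (by norm_num) (by unfold bigExp; omega)
    exact_mod_cast (h3.trans_eq h4).trans_lt h5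
  have key := exists_digits_odd_iff (P := P) (β := 2 ^ bigExp w m s)
    (fun i => (hb.abs_coeff_le i).trans_lt hbound) (K := 2 * m * (w + 1) * s + 1)
    (hd.trans_lt (by rw [show m * (2 * ((w + 1) * s)) = 2 * m * (w + 1) * s by ring]; omega))
  have e1 : P.eval (2 * 2 ^ bigExp w m s)
      = coverSum h n w m (rand ((2 : ℤ) * 2 ^ bigExp w m s) s N ω) := by
    have := map_coverSum h n w m (evalRingHom (2 * 2 ^ bigExp w m s)) (rand (X : ℤ[X]) s N ω)
    simpa only [map_rand, coe_evalRingHom, eval_X] using this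
  have e2 : P.map (Int.castRingHom (ZMod 2))
      = coverSum h n w m (rand (X : (ZMod 2)[X]) s N ω) := by
    have := map_coverSum h n w m (mapRingHom (Int.castRingHom (ZMod 2))) (rand (X : ℤ[X]) s N ω)
    simpa only [map_rand, coe_mapRingHom, map_X] using this
  rw [← e1, ← e2]
  exact key

end CliqueCover

/-! Greedy packing of triangles. -/

namespace DualColoring

open StructuredRAM

/-- The array `2` holds the first `l` entries of the list `V` of distinct numbers below `n`, the
array `1` marks its elements. -/
structure Listing (n : ℕ) (s : St) (l : ℕ) (V : ℕ → ℕ) : Prop where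
  len : s.reg 8 = l
  vs : ∀ i < l, s.arr 2 i = V i
  mark : ∀ v, (∃ i < l, V i = v) → s.arr 1 v = 1
  unmark : ∀ v, (∀ i < l, V i ≠ v) → s.arr 1 v = 0
  lt : ∀ i < l, V i < n
  inj : ∀ i < l, ∀ j < l, V i = V j → i = j

theorem Listing.congr {n : ℕ} {s s' : St} {l : ℕ} {V : ℕ → ℕ} (h : Listing n s l V)
    (h8 : s'.reg 8 = s.reg 8) (h1 : s'.arr 1 = s.arr 1) (h2 : s'.arr 2 = s.arr 2) :
    Listing n s' l V :=
  ⟨h8.trans h.len, by rw [h2]; exact h.vs, by rw [h1]; exact h.mark, by rw [h1]; exact h.unmark,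
    h.lt, h.inj⟩

theorem le_of_inj {n l : ℕ} {V : ℕ → ℕ} (lt : ∀ i < l, V i < n)
    (inj : ∀ i < l, ∀ j < l, V i = V j → i = j) : l ≤ n := by
  have := Finset.card_le_card_of_injOn (s := Finset.range l) (t := Finset.range n) V
    (fun i hi => by simpa using lt i (by simpa using hi))
    (fun i hi j hj e => inj i (by simpa using hi) j (by simpa using hj) e)
  simpa using this

def push (x : ℕ) : Cmd :=
  .seq (.put 1 (.reg x) 1) (.seq (.put 2 (.reg 8) (.reg x)) (.set 8 (.reg 8 + 1)))

/-- The list `V` with `v` put at position `l`. -/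
def extend (V : ℕ → ℕ) (l v : ℕ) : ℕ → ℕ := fun i => if i = l then v else V i

variable {L : ℕ} {ω : ℕ → Bool} {n : ℕ}

theorem tri_push {s : St} {l : ℕ} {V : ℕ → ℕ} {x v : ℕ} (hL : n + 3 < 2 ^ L)
    (h : Listing n s l V) (hx : s.reg x = v) (hv : v < n) (hnew : ∀ i < l, V i ≠ v) :
    Tri L ω (push x) s 3 fun s' => Listing n s' (l + 1) (extend V l v) := by
  have hl : l ≤ n := le_of_inj h.lt h.inj
  have hL' : (n : ℤ) + 3 < 2 ^ L := by exact_mod_cast hL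
  unfold push
  have e1 : Tri L ω (.put 1 (.reg x) 1) s 1 (· = s.setArr 1 v 1) :=
    Tri.put v 1 (by simpa using hx) (by simp) (by simp; omega) rfl
  refine (Tri.seq e1 fun s₁ _ hs₁ => ?_ : Tri L ω _ s (1 + 2) _)
  have e2 : Tri L ω (.put 2 (.reg 8) (.reg x)) s₁ 1 (· = s₁.setArr 2 l v) :=
    Tri.put l v (by subst hs₁; simpa using h.len) (by subst hs₁; simpa using hx)
      (by rw [abs_of_nonneg (by omega)]; omega) rfl
  refine (Tri.seq e2 fun s₂ _ hs₂ => ?_ : Tri L ω _ s₁ (1 + 1) _)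
  refine Tri.set (l + 1 : ℤ) (by subst hs₂ hs₁; simp [h.len])
    (by rw [abs_of_nonneg (by omega)]; omega) ?_
  subst hs₂ hs₁
  refine ⟨by simp, fun i hi => ?_, fun u hu => ?_, fun u hu => ?_, fun i hi => ?_,
    fun i hi j hj e => ?_⟩
  · simp only [setReg_arr, setArr_arr_self, extend]
    split_ifs with hil
    · rfl
    · rw [setArr_arr_ne _ (by decide)]; exact h.vs i (by omega)
  · obtain ⟨i, hi, e⟩ := hu
    simp only [setReg_arr]
    rw [setArr_arr_ne _ (by decide), setArr_arr_self]
    split_ifs with huv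
    · rfl
    · simp only [extend] at e
      split_ifs at e with hil
      · exact absurd e.symm huv
      · exact h.mark u ⟨i, by omega, e⟩
  · simp only [setReg_arr]
    rw [setArr_arr_ne _ (by decide), setArr_arr_self]
    have h1 := hu l (by omega)
    simp only [extend, if_true] at h1
    rw [if_neg (Ne.symm h1)]
    refine h.unmark u fun i hi e => hu i (by omega) ?_
    simpa [extend, show i ≠ l by omega] using e
  · simp only [extend]
    split_ifs
    · exact hv
    · exact h.lt i (by omega)
  · simp only [extend] at e
    split_ifs at e with h1 h2 h2
    · omega
    · exact absurd e.symm (hnew j (by omega))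
    · exact absurd e (hnew i (by omega))
    · exact h.inj i (by omega) j (by omega) e

/-- `1` if the vertices `a` and `b` are distinct and not adjacent, otherwise `0`. -/
def nonAdj (a b : Ex) : Ex := (1 - .get 0 (a * .reg 0 + b)) * (1 - a.eq b)

/-- The array `0` holds the complement of the relation `H` on the numbers below `n`. -/
structure Input (H : ℕ → ℕ → Prop) (n : ℕ) (s : St) : Prop where
  size : s.reg 0 = n
  adj : ∀ a < n, ∀ b < n, a ≠ b → H a b → s.arr 0 (a * n + b) = 0
  nonadj : ∀ a < n, ∀ b < n, a ≠ b → ¬ H a b → s.arr 0 (a * n + b) = 1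

theorem Input.congr {H : ℕ → ℕ → Prop} {s s' : St} (h : Input H n s)
    (h0 : s'.reg 0 = s.reg 0) (h1 : s'.arr 0 = s.arr 0) : Input H n s' :=
  ⟨h0.trans h.size, by rw [h1]; exact h.adj, by rw [h1]; exact h.nonadj⟩

theorem Input.eval_nonAdj {H : ℕ → ℕ → Prop} (hirr : ∀ a, ¬ H a a) {s : St} (h : Input H n s)
    {e f : Ex} {a b : ℕ} (he : e.eval s = a) (hf : f.eval s = b) (ha : a < n) (hb : b < n) :
    (H a b → (nonAdj e f).eval s = 1) ∧ (¬ H a b → (nonAdj e f).eval s = 0) := by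
  have e0 : ((a : ℤ) * n + b).toNat = a * n + b := by
    have : ((a : ℤ) * n + b) = ((a * n + b : ℕ) : ℤ) := by push_cast; ring
    rw [this]; rfl
  have e1 : (nonAdj e f).eval s = (1 - s.arr 0 (a * n + b)) * (1 - eqZ a b) := by
    simp [nonAdj, he, hf, h.size, e0]
  rw [e1]
  by_cases hab : a = b
  · subst hab
    simp [eqZ_of_eq, hirr]
  · rw [eqZ_of_ne (by exact_mod_cast hab)]
    refine ⟨fun hH => by rw [h.adj a ha b hb hab hH]; norm_num,
      fun hH => by rw [h.nonadj a ha b hb hab hH]; norm_num⟩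

def triangleTest : Ex :=
  nonAdj (.reg 10) (.reg 11) * nonAdj (.reg 10) (.reg 12) * nonAdj (.reg 11) (.reg 12)
    * (1 - .get 1 (.reg 10)) * (1 - .get 1 (.reg 11)) * (1 - .get 1 (.reg 12))

def triangleStep : Cmd := .ite triangleTest (.seq (push 10) (.seq (push 11) (push 12))) .skip

def packTriangles : Cmd :=
  .loop 10 (.reg 0) (.loop 11 (.reg 0) (.loop 12 (.reg 0) triangleStep))

/-- The state lists the vertices of `τ` disjoint triangles. -/
structure Packed (H : ℕ → ℕ → Prop) (n : ℕ) (s : St) (τ : ℕ) (V : ℕ → ℕ) : Prop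
    extends Listing n s (3 * τ) V where
  tri : ∀ t < τ, H (V (3 * t)) (V (3 * t + 1)) ∧ H (V (3 * t)) (V (3 * t + 2)) ∧
    H (V (3 * t + 1)) (V (3 * t + 2))

/-- The triangle `a, b, c` meets the marked vertices, if it is one. -/
def Hit (H : ℕ → ℕ → Prop) (s : St) (a b c : ℕ) : Prop :=
  H a b → H a c → H b c → s.arr 1 a = 1 ∨ s.arr 1 b = 1 ∨ s.arr 1 c = 1

/-- Marks are never removed, so a triple that has been hit stays hit. After all triples have been
tried, the packing is therefore maximal. -/
theorem tri_triangleStep {H : ℕ → ℕ → Prop} (hirr : ∀ a, ¬ H a a)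
    {s : St} {τ : ℕ} {V : ℕ → ℕ} {a b c : ℕ} (hL : n + 3 < 2 ^ L) (hin : Input H n s)
    (h : Packed H n s τ V) (ha : s.reg 10 = a) (hb : s.reg 11 = b) (hc : s.reg 12 = c)
    (han : a < n) (hbn : b < n) (hcn : c < n) :
    Tri L ω triangleStep s 10 fun s' => (∃ τ V, Packed H n s' τ V) ∧ Hit H s' a b c ∧
      ∀ v, s.arr 1 v = 1 → s'.arr 1 v = 1 := by
  have hab := hin.eval_nonAdj hirr (e := .reg 10) (f := .reg 11) ha hb han hbn
  have hac := hin.eval_nonAdj hirr (e := .reg 10) (f := .reg 12) ha hc han hcn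
  have hbc := hin.eval_nonAdj hirr (e := .reg 11) (f := .reg 12) hb hc hbn hcn
  have he : triangleTest.eval s = (nonAdj (.reg 10) (.reg 11)).eval s *
      (nonAdj (.reg 10) (.reg 12)).eval s * (nonAdj (.reg 11) (.reg 12)).eval s
      * (1 - s.arr 1 a) * (1 - s.arr 1 b) * (1 - s.arr 1 c) := by
    simp [triangleTest, ha, hb, hc]
  have hunm : ∀ v, s.arr 1 v ≠ 1 → ∀ i < 3 * τ, V i ≠ v := fun v hv i hi e =>
    hv (h.mark v ⟨i, hi, e⟩)
  refine (Tri.ite (T := 9) ?_ ?_ : Tri L ω _ s (1 + 9) _)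
  · rw [he]
    intro hne
    have g1 : H a b := by by_contra hH; rw [hab.2 hH] at hne; simp at hne
    have g2 : H a c := by by_contra hH; rw [hac.2 hH] at hne; simp at hne
    have g3 : H b c := by by_contra hH; rw [hbc.2 hH] at hne; simp at hne
    have ga : s.arr 1 a ≠ 1 := by intro hm; rw [hm] at hne; simp at hne
    have gb : s.arr 1 b ≠ 1 := by intro hm; rw [hm] at hne; simp at hne
    have gc : s.arr 1 c ≠ 1 := by intro hm; rw [hm] at hne; simp at hne
    have nab : a ≠ b := by rintro rfl; exact hirr _ g1
    have nac : a ≠ c := by rintro rfl; exact hirr _ g2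
    have nbc : b ≠ c := by rintro rfl; exact hirr _ g3
    refine (Tri.seq (tri_push hL h.toListing ha han (hunm a ga)) fun s₁ S₁ h₁ => ?_ :
      Tri L ω _ s (3 + 6) _)
    refine (Tri.seq (tri_push hL h₁ ((S₁.reg 11 (by decide)).trans hb) hbn ?_)
      fun s₂ S₂ h₂ => ?_ : Tri L ω _ s₁ (3 + 3) _)
    · intro i hi
      simp only [extend]
      split_ifs
      · exact nab
      · exact hunm b gb i (by omega)
    refine (tri_push hL h₂ ((S₂.reg 12 (by decide)).trans ((S₁.reg 12 (by decide)).trans hc)) hcn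
      ?_).conseq fun s₃ _ h₃ => ?_
    · intro i hi
      simp only [extend]
      split_ifs
      · exact nbc
      · exact nac
      · exact hunm c gc i (by omega)
    have hlast : ∀ v, (v = a ∨ v = b ∨ v = c) → s₃.arr 1 v = 1 := by
      rintro v (rfl | rfl | rfl)
      · exact h₃.mark _ ⟨3 * τ, by omega, by simp [extend]; omega⟩
      · exact h₃.mark _ ⟨3 * τ + 1, by omega, by simp [extend]⟩
      · exact h₃.mark _ ⟨3 * τ + 1 + 1, by omega, by simp [extend]⟩
    refine ⟨⟨τ + 1, _, h₃, fun t ht => ?_⟩, fun _ _ _ => Or.inl (hlast a (Or.inl rfl)), ?_⟩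
    · rcases Nat.lt_succ_iff_lt_or_eq.1 ht with ht | rfl
      · have := h.tri t ht
        simp only [extend]
        repeat rw [if_neg (by omega)]
        exact this
      · have h1 : ¬ 3 * t = 3 * t + 1 + 1 := by omega
        simpa [extend, h1] using ⟨g1, g2, g3⟩
    · intro v hv
      by_cases hex : ∃ i < 3 * τ, V i = v
      · obtain ⟨i, hi, e⟩ := hex
        refine h₃.mark v ⟨i, by omega, ?_⟩
        simp only [extend]
        repeat rw [if_neg (by omega)]
        exact e
      · push Not at hex
        rw [h.unmark v hex] at hv
        exact absurd hv (by norm_num)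
  · rw [he]
    intro hz
    refine (Tri.skip ?_ : Tri L ω _ s 1 _).mono (by norm_num) fun _ _ h => h
    refine ⟨⟨τ, V, h⟩, fun g1 g2 g3 => ?_, fun v hv => hv⟩
    rw [hab.1 g1, hac.1 g2, hbc.1 g3] at hz
    simp only [one_mul, mul_eq_zero] at hz
    omega

theorem tri_packTriangles {H : ℕ → ℕ → Prop} (hirr : ∀ a, ¬ H a a) {s : St}
    (hL : n + 3 < 2 ^ L) (hin : Input H n s) (h8 : s.reg 8 = 0) (h1 : ∀ v, s.arr 1 v = 0) :
    Tri L ω packTriangles s (1 + n * (1 + (1 + n * (1 + (1 + n * (1 + 10)))))) fun s' =>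
      ∃ τ V, Packed H n s' τ V ∧ ∀ a < n, ∀ b < n, ∀ c < n, Hit H s' a b c := by
  have hLn : n ≤ 2 ^ L := by omega
  have hit : ∀ {s s' : St} {a b c : ℕ}, (∀ v, s.arr 1 v = 1 → s'.arr 1 v = 1) → Hit H s a b c →
      Hit H s' a b c := by
    intro s s' a b c hm h g1 g2 g3
    rcases h g1 g2 g3 with h | h | h
    · exact Or.inl (hm _ h)
    · exact Or.inr (Or.inl (hm _ h))
    · exact Or.inr (Or.inr (hm _ h))
  have pk : ∀ {s : St} {x : ℕ} {z : ℤ}, x ≠ 8 → (∃ τ V, Packed H n s τ V) →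
      ∃ τ V, Packed H n (s.setReg x z) τ V := by
    rintro s x z hx ⟨τ, V, h⟩
    exact ⟨τ, V, h.toListing.congr (by simp [hx.symm]) rfl rfl, h.tri⟩
  refine (Tri.loop (e := .reg 0) (fun i s' => (∃ τ V, Packed H n s' τ V) ∧
      ∀ a < i, ∀ b < n, ∀ c < n, Hit H s' a b c) n _ hin.size hLn
    ⟨⟨0, fun _ => 0, ⟨h8, by simp, by simp, fun v _ => h1 v, by simp, by simp⟩, by simp⟩, by simp⟩
    (fun i s z h => ⟨pk (by decide) h.1, h.2⟩)
    fun a ha s₁ S₁ x₁ h₁ => ?_).conseq fun s' _ h' => ?_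
  swap
  · obtain ⟨⟨τ, V, h2⟩, h3⟩ := h'
    exact ⟨τ, V, h2, h3⟩
  refine (Tri.loop (e := .reg 0) (fun i s' => ((∃ τ V, Packed H n s' τ V) ∧
      ∀ a' < a, ∀ b < n, ∀ c < n, Hit H s' a' b c) ∧ ∀ b < i, ∀ c < n, Hit H s' a b c) n _
    ((S₁.reg 0 (by decide)).trans hin.size) hLn ⟨h₁, by simp⟩
    (fun i s z h => ⟨⟨pk (by decide) h.1.1, h.1.2⟩, h.2⟩)
    fun b hb s₂ S₂ x₂ h₂ => ?_).conseq fun s' _ h' => ?_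
  swap
  · obtain ⟨⟨h2, h3⟩, h4⟩ := h'
    refine ⟨h2, fun a' ha' => ?_⟩
    rcases Nat.lt_succ_iff_lt_or_eq.1 ha' with ha' | rfl
    · exact h3 a' ha'
    · exact h4
  refine (Tri.loop (e := .reg 0) (fun i s' => (((∃ τ V, Packed H n s' τ V) ∧
      ∀ a' < a, ∀ b < n, ∀ c < n, Hit H s' a' b c) ∧ ∀ b' < b, ∀ c < n, Hit H s' a b' c) ∧
      ∀ c < i, Hit H s' a b c) n _
    ((S₂.reg 0 (by decide)).trans ((S₁.reg 0 (by decide)).trans hin.size)) hLn ⟨h₂, by simp⟩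
    (fun i s z h => ⟨⟨⟨pk (by decide) h.1.1.1, h.1.1.2⟩, h.1.2⟩, h.2⟩)
    fun c hc s₃ S₃ x₃ h₃ => ?_).conseq fun s' _ h' => ?_
  swap
  · obtain ⟨⟨h2, h3⟩, h4⟩ := h'
    refine ⟨h2, fun a' ha' => ?_⟩
    rcases Nat.lt_succ_iff_lt_or_eq.1 ha' with ha' | rfl
    · exact h3 a' ha'
    · exact h4
  obtain ⟨⟨⟨⟨τ, V, h4⟩, h5⟩, h6⟩, h7⟩ := h₃
  have hin₃ : Input H n s₃ :=
    ((hin.congr (S₁.reg 0 (by decide)) (S₁.arr 0 (by decide))).congr (S₂.reg 0 (by decide))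
      (S₂.arr 0 (by decide))).congr (S₃.reg 0 (by decide)) (S₃.arr 0 (by decide))
  refine (tri_triangleStep hirr hL hin₃ h4 ?_ ?_ x₃ ha hb hc).conseq fun s' _ h' => ?_
  · rw [S₃.reg 10 (by decide), S₂.reg 10 (by decide), x₁]
  · rw [S₃.reg 11 (by decide), x₂]
  · obtain ⟨g1, g2, g3⟩ := h'
    refine ⟨⟨⟨g1, fun a ha b hb c hc => hit g3 (h5 a ha b hb c hc)⟩,
      fun b hb c hc => hit g3 (h6 b hb c hc)⟩, fun c' hc' => ?_⟩
    rcases Nat.lt_succ_iff_lt_or_eq.1 hc' with hc' | rfl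
    · exact hit g3 (h7 c' hc')
    · exact g2

def appendRest : Cmd := .loop 10 (.reg 0) (.ite (.get 1 (.reg 10)) .skip (push 10))

theorem tri_appendRest {s : St} {l : ℕ} {V : ℕ → ℕ} (hL : n + 3 < 2 ^ L) (h0 : s.reg 0 = n)
    (h : Listing n s l V) :
    Tri L ω appendRest s (1 + n * (1 + 4)) fun s' => ∃ V', Listing n s' n V' ∧
      ∀ i < l, V' i = V i := by
  have hLn : n ≤ 2 ^ L := by omega
  refine (Tri.loop (e := .reg 0) (fun i s' => ∃ l' V', Listing n s' l' V' ∧ l ≤ l' ∧ (∀ i < l, V' i = V i) ∧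
    ∀ v < i, ∃ j < l', V' j = v) n _ h0 hLn ⟨l, V, h, le_rfl, fun _ _ => rfl, by simp⟩ ?_
    fun v hv s₁ S₁ x₁ h₁ => ?_).conseq fun s' _ h' => ?_
  · rintro i s z ⟨l', V', h1, h2⟩
    exact ⟨l', V', h1.congr (by simp) rfl rfl, h2⟩
  · obtain ⟨l', V', h1, h2, h3, h4⟩ := h₁
    refine (Tri.ite (T := 3) (fun hne => ?_) fun hz => ?_ : Tri L ω _ s₁ (1 + 3) _)
    · refine (Tri.skip ?_ : Tri L ω _ s₁ 1 _).mono (by norm_num) fun _ _ h => h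
      refine ⟨l', V', h1, h2, h3, fun v' hv' => ?_⟩
      rcases Nat.lt_succ_iff_lt_or_eq.1 hv' with hv' | rfl
      · exact h4 v' hv'
      · by_contra! hc
        have := h1.unmark v' hc
        simp [x₁] at hne
        exact hne this
    · simp only [eval_get, eval_reg, x₁, Int.toNat_natCast] at hz
      have hnew : ∀ i < l', V' i ≠ v := fun i hi e => by
        rw [h1.mark v ⟨i, hi, e⟩] at hz; norm_num at hz
      refine (tri_push hL h1 x₁ hv hnew).conseq fun s' _ h' => ?_
      refine ⟨l' + 1, _, h', by omega, fun i hi => ?_, fun v' hv' => ?_⟩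
      · simp only [extend]
        rw [if_neg (by omega)]
        exact h3 i hi
      · rcases Nat.lt_succ_iff_lt_or_eq.1 hv' with hv' | rfl
        · obtain ⟨j, hj, e⟩ := h4 v' hv'
          refine ⟨j, by omega, ?_⟩
          simp only [extend]
          rw [if_neg (by omega)]
          exact e
        · exact ⟨l', by omega, by simp [extend]⟩
  · obtain ⟨l', V', h1, h2, h3, h4⟩ := h'
    have hle : l' ≤ n := le_of_inj h1.lt h1.inj
    -- Choosing a position for each vertex is injective.
    have hge : n ≤ l' := by
      choose! j hj hjv using h4
      exact le_of_inj (V := j) hj fun a ha b hb e => by rw [← hjv a ha, ← hjv b hb, e]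
    obtain rfl : l' = n := le_antisymm hle hge
    exact ⟨V', h1, h3⟩

end DualColoring

/-! Sizes, tables of powers, the reordered adjacency matrix and the random weights. -/

namespace StructuredRAM

theorem eval_get_nat {s : St} {k : ℕ} {e : Ex} {i : ℕ} (he : e.eval s = i) :
    (Ex.get k e).eval s = s.arr k i := by simp [he]

theorem ltZ_nat (a b : ℕ) : ltZ a b = if a < b then 1 else 0 := by simp [ltZ]

theorem eqZ_nat (a b : ℕ) : eqZ a b = if a = b then 1 else 0 := by simp [eqZ]

theorem Same.regs {c : Cmd} {s s' : St} (S : Same c s s') {l : List ℕ}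
    (h : ∀ x ∈ l, x ∉ c.regs) : ∀ x ∈ l, s'.reg x = s.reg x := fun x hx => S.reg x (h x hx)

end StructuredRAM

namespace DualColoring

open StructuredRAM CliqueCover

variable {L : ℕ} {ω : ℕ → Bool} {n : ℕ}

/-- Has to precede `appendRest`, which overwrites the number of packed vertices in register 8. In
the bit count `(c + 3) * (n + 2)`, the 3 pays for the degree `2 m (w + 1)` and `c` for the required
error. -/
def setSizes (c : ℕ) : Cmd :=
  .seq (.set 2 (.reg 0 - .reg 1))
    (.seq (.ite ((Ex.reg 8).lt (.reg 1)) (.set 3 (.reg 1)) (.set 3 (.reg 8)))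
      (.seq (.set 5 (.const (c + 3) * (.reg 0 + 2)))
        (.set 9 (.reg 2 * .reg 2 * (.reg 3 + 1)))))

/-- The sizes of the problem. -/
structure Sizes (n w m s : ℕ) (st : St) : Prop where
  n_eq : st.reg 0 = n
  m_eq : st.reg 2 = m
  w_eq : st.reg 3 = w
  s_eq : st.reg 5 = s
  N_eq : st.reg 9 = (m * m * (w + 1) : ℕ)

theorem Sizes.congr {n w m s : ℕ} {st st' : St} (h : Sizes n w m s st)
    (e : ∀ x ∈ [0, 2, 3, 5, 9], st'.reg x = st.reg x) : Sizes n w m s st' :=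
  ⟨(e 0 (by decide)).trans h.n_eq, (e 2 (by decide)).trans h.m_eq, (e 3 (by decide)).trans h.w_eq,
    (e 5 (by decide)).trans h.s_eq, (e 9 (by decide)).trans h.N_eq⟩

theorem tri_setSizes {c k l : ℕ} {st : St} (h0 : st.reg 0 = n) (h1 : st.reg 1 = k)
    (h8 : st.reg 8 = l) (hkn : k ≤ n) (hln : l ≤ n) (hs : (c + 3) * (n + 2) < 2 ^ L)
    (hN : (n - k) * (n - k) * (max l k + 1) < 2 ^ L) :
    Tri L ω (setSizes c) st 5
      (Sizes n (max l k) (n - k) ((c + 3) * (n + 2))) := by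
  have hL : n < 2 ^ L := by nlinarith
  unfold setSizes
  have e1 : Tri L ω (.set 2 (.reg 0 - .reg 1)) st 1 (· = st.setReg 2 (n - k : ℕ)) :=
    Tri.set _ (by simp [h0, h1, Nat.cast_sub hkn])
      (by rw [Nat.abs_cast]; exact_mod_cast (by omega : n - k < 2 ^ L)) rfl
  refine (Tri.seq e1 fun s₁ _ hs₁ => ?_ : Tri L ω _ st (1 + (2 + (1 + 1))) _)
  have e2 : Tri L ω (.ite ((Ex.reg 8).lt (.reg 1)) (.set 3 (.reg 1)) (.set 3 (.reg 8))) s₁ (1 + 1)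
      (· = s₁.setReg 3 (max l k : ℕ)) := by
    have hmax : max l k < 2 ^ L := by omega
    have hb : |((max l k : ℕ) : ℤ)| < 2 ^ L := by rw [Nat.abs_cast]; exact_mod_cast hmax
    have ev : ((Ex.reg 8).lt (.reg 1)).eval s₁ = ltZ l k := by subst hs₁; simp [h1, h8]
    refine Tri.ite (fun h => ?_) fun h => ?_
    · rw [ev, ltZ_ne_zero] at h
      refine Tri.set _ ?_ hb rfl
      subst hs₁
      simp [h1]; omega
    · rw [ev] at h
      have : ¬ ((l : ℤ) < k) := fun h' => ltZ_ne_zero.2 h' h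
      refine Tri.set _ ?_ hb rfl
      subst hs₁
      simp [h8]; omega
  refine (Tri.seq e2 fun s₂ _ hs₂ => ?_ : Tri L ω _ s₁ (2 + (1 + 1)) _)
  have e3 : Tri L ω (.set 5 (.const (c + 3) * (.reg 0 + 2))) s₂ 1
      (· = s₂.setReg 5 ((c + 3) * (n + 2) : ℕ)) :=
    Tri.set _ (by subst hs₂ hs₁; simp [h0]) (by rw [Nat.abs_cast]; exact_mod_cast hs) rfl
  refine (Tri.seq e3 fun s₃ _ hs₃ => ?_ : Tri L ω _ s₂ (1 + 1) _)
  subst hs₃ hs₂ hs₁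
  refine Tri.set (((n - k) * (n - k) * (max l k + 1) : ℕ) : ℤ) (by simp)
    (by rw [Nat.abs_cast]; exact_mod_cast hN) ⟨?_, ?_, ?_, ?_, ?_⟩ <;> simp [h0]

def powers : Cmd :=
  .seq (.set 4 1) (.loop 10 (.reg 3) (.seq (.put 9 (.reg 10) (.reg 4)) (.set 4 (.reg 4 * 2))))

theorem tri_powers {w : ℕ} {st : St} (h3 : st.reg 3 = w) (hw : 2 ^ w < 2 ^ L) :
    Tri L ω powers st (1 + (1 + w * (1 + 2))) fun s' => s'.reg 4 = 2 ^ w ∧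
      ∀ j < w, s'.arr 9 j = 2 ^ j := by
  have hp : ∀ i ≤ w, |(2 : ℤ) ^ i| < 2 ^ L := fun i hi => by
    rw [abs_of_nonneg (by positivity)]
    exact_mod_cast (Nat.pow_le_pow_right (by norm_num) hi).trans_lt hw
  have e1 : Tri L ω (.set 4 1) st 1 (· = st.setReg 4 1) :=
    Tri.set 1 (by simp) (by simpa using hp 0 (by omega)) rfl
  refine Tri.seq e1 fun s₁ _ hs₁ => ?_
  refine Tri.loop (e := .reg 3)
    (fun i s' => s'.reg 4 = 2 ^ i ∧ ∀ j < i, s'.arr 9 j = 2 ^ j) w 2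
    (by subst hs₁; simp [h3]) (Nat.lt_two_pow_self.le.trans hw.le) (by subst hs₁; simp)
    (fun i s z h => by simpa using h) fun i hi s₂ S₂ x₂ h₂ => ?_
  have e2 : Tri L ω (.put 9 (.reg 10) (.reg 4)) s₂ 1 (· = s₂.setArr 9 i (2 ^ i)) :=
    Tri.put i _ (by simpa using x₂) (by simpa using h₂.1) (hp i hi.le) rfl
  refine (Tri.seq e2 fun s₃ _ hs₃ => ?_ : Tri L ω _ s₂ (1 + 1) _)
  subst hs₃
  refine Tri.set (2 ^ (i + 1)) (by simp [h₂.1, pow_succ]) (hp _ hi) ⟨by simp, fun j hj => ?_⟩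
  rcases Nat.lt_succ_iff_lt_or_eq.1 hj with hj | rfl
  · simpa [hj.ne] using h₂.2 j hj
  · simp

def base : Cmd :=
  .seq (.set 7 1) (.seq (.loop 10
    (.reg 3 + .reg 2 * .reg 2 + 2 * .reg 5 * (.reg 3 + 1) * .reg 2 + 1) (.set 7 (.reg 7 * 2)))
    (.set 6 (2 * .reg 7)))

theorem tri_base {w m s : ℕ} {st : St} (h : Sizes n w m s st)
    (hL : bigExp w m s + 1 < L) :
    Tri L ω base st (1 + ((1 + bigExp w m s * (1 + 1)) + 1)) fun s' =>
      s'.reg 7 = 2 ^ bigExp w m s ∧ s'.reg 6 = 2 * 2 ^ bigExp w m s := by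
  have hp : ∀ i ≤ bigExp w m s + 1, |(2 : ℤ) ^ i| < 2 ^ L := fun i hi => by
    rw [abs_of_nonneg (by positivity)]
    exact pow_lt_pow_right₀ (by norm_num) (by omega)
  have e1 : Tri L ω (.set 7 1) st 1 (· = st.setReg 7 1) :=
    Tri.set 1 (by simp) (by simpa using hp 0 (by omega)) rfl
  refine Tri.seq e1 fun s₁ _ hs₁ => ?_
  refine Tri.seq (Q' := fun s' => s'.reg 7 = 2 ^ bigExp w m s) ?_ fun s₂ _ h₂ => ?_
  · refine Tri.loop (fun i s' => s'.reg 7 = 2 ^ i) (bigExp w m s) 1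
      (by subst hs₁; simp [h.w_eq, h.m_eq, h.s_eq, bigExp]) ?_ (by subst hs₁; simp)
      (fun i s z h => by simpa using h) fun i hi s₂ S₂ x₂ h₂ => ?_
    · exact Nat.lt_two_pow_self.le.trans (Nat.pow_le_pow_right (by norm_num) (by omega))
    · exact Tri.set (2 ^ (i + 1)) (by simp [h₂, pow_succ]) (hp _ (by omega)) (by simp)
  · refine Tri.set (2 * 2 ^ bigExp w m s) (by simp [h₂]) ?_ (by simp [h₂])
    rw [← pow_succ']
    exact hp _ le_rfl

def reorder : Cmd :=
  .loop 10 (.reg 0 * .reg 0)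
    (.put 3 (.reg 10) (nonAdj (.get 2 (.reg 10 / .reg 0)) (.get 2 (.reg 10 % .reg 0))))

open Classical in
theorem tri_reorder {H : ℕ → ℕ → Prop} (hirr : ∀ a, ¬ H a a) {V : ℕ → ℕ} {st : St}
    (hin : Input H n st) (hV : Listing n st n V) (hL : n * n < 2 ^ L) (hL0 : 0 < L) :
    Tri L ω reorder st (1 + n * n * 2) fun s' => ∀ a < n, ∀ b < n,
      s'.arr 3 (a * n + b) = if H (V a) (V b) then 1 else 0 := by
  have hL1 : (1 : ℤ) < 2 ^ L := one_lt_pow₀ (by norm_num) hL0.ne'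
  refine (Tri.fill (n * n) (fun q => if H (V (q / n)) (V (q % n)) then 1 else 0)
    (by simp [hin.size]) hL.le (fun q hq s' h1 h2 h3 _ _ => ?_) fun q _ => ?_).conseq
    fun s' _ h' a ha b hb => ?_
  · have hn : 0 < n := Nat.pos_of_ne_zero (by rintro rfl; simp at hq)
    have hd : q / n < n := (Nat.div_lt_iff_lt_mul hn).2 hq
    have hm : q % n < n := Nat.mod_lt _ hn
    have h0 : s'.reg 0 = n := (h1 0 (by decide)).trans hin.size
    have ed : (Ex.get 2 (.reg 10 / .reg 0)).eval s' = V (q / n) := by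
      rw [eval_get_nat (i := q / n) (by simp [h3, h0]), h2 2 (by decide), hV.vs _ hd]
    have em : (Ex.get 2 (.reg 10 % .reg 0)).eval s' = V (q % n) := by
      rw [eval_get_nat (i := q % n) (by simp [h3, h0]), h2 2 (by decide), hV.vs _ hm]
    have := (hin.congr (h1 0 (by decide)) (h2 0 (by decide))).eval_nonAdj hirr ed em
      (hV.lt _ hd) (hV.lt _ hm)
    split_ifs with hH
    · exact this.1 hH
    · exact this.2 hH
  · split_ifs <;> simp [hL1]
  · rw [h'.1 (a * n + b) (by nlinarith), Nat.add_comm, Nat.add_mul_div_right _ _ (by omega),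
      Nat.add_mul_mod_self_right, Nat.div_eq_of_lt hb, Nat.mod_eq_of_lt hb, zero_add]

open Classical in
/-- Everything that is computed before the random weights. -/
structure Setup (h : ℕ → ℕ → Prop) (n w m s : ℕ) (st : St) : Prop extends Sizes n w m s st where
  W_eq : st.reg 4 = (2 ^ w : ℕ)
  B_eq : st.reg 6 = 2 * 2 ^ bigExp w m s
  β_eq : st.reg 7 = 2 ^ bigExp w m s
  pw : ∀ j < w, st.arr 9 j = (2 ^ j : ℕ)
  adj : ∀ a < n, ∀ b < n, st.arr 3 (a * n + b) = if h a b then 1 else 0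

theorem Setup.same {h : ℕ → ℕ → Prop} {n w m s : ℕ} {st st' : St} (H : Setup h n w m s st)
    {c : Cmd} (S : Same c st st') (hr : ∀ x ∈ [0, 2, 3, 4, 5, 6, 7, 9], x ∉ c.regs)
    (ha : ∀ k ∈ [3, 9], k ∉ c.arrs) : Setup h n w m s st' where
  n_eq := (S.reg 0 (hr _ (by decide))).trans H.n_eq
  m_eq := (S.reg 2 (hr _ (by decide))).trans H.m_eq
  w_eq := (S.reg 3 (hr _ (by decide))).trans H.w_eq
  s_eq := (S.reg 5 (hr _ (by decide))).trans H.s_eq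
  N_eq := (S.reg 9 (hr _ (by decide))).trans H.N_eq
  W_eq := (S.reg 4 (hr _ (by decide))).trans H.W_eq
  B_eq := (S.reg 6 (hr _ (by decide))).trans H.B_eq
  β_eq := (S.reg 7 (hr _ (by decide))).trans H.β_eq
  pw := by rw [S.arr 9 (ha _ (by decide))]; exact H.pw
  adj := by rw [S.arr 3 (ha _ (by decide))]; exact H.adj

def setup (c : ℕ) : Cmd :=
  .seq (setSizes c) (.seq appendRest (.seq powers (.seq base reorder)))

theorem tri_setup {H : ℕ → ℕ → Prop} (hirr : ∀ a, ¬ H a a) {c k l w m s : ℕ} {V : ℕ → ℕ} {st : St}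
    (hin : Input H n st) (h1 : st.reg 1 = k) (hV : Listing n st l V) (hkn : k ≤ n)
    (hw : w = max l k) (hm : m = n - k) (hs : s = (c + 3) * (n + 2))
    (hLn : n + 3 < 2 ^ L) (hLs : s < 2 ^ L) (hLN : m * m * (w + 1) < 2 ^ L)
    (hLw : 2 ^ w < 2 ^ L) (hLb : bigExp w m s + 1 < L) (hLn2 : n * n < 2 ^ L) :
    Tri L ω (setup c) st (5 + ((1 + n * (1 + 4)) + ((1 + (1 + w * (1 + 2))) +
      ((1 + ((1 + bigExp w m s * (1 + 1)) + 1)) + (1 + n * n * 2))))) fun s' =>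
      ∃ V', Listing n s' n V' ∧ (∀ i < l, V' i = V i) ∧
        Setup (fun a b => H (V' a) (V' b)) n w m s s' := by
  have hln : l ≤ n := le_of_inj hV.lt hV.inj
  refine Tri.seq (by subst hw hm hs; exact tri_setSizes hin.size h1 hV.len hkn hln hLs hLN)
    fun s₁ S₁ h₁ => ?_
  rw [← hw, ← hm, ← hs] at h₁
  have hV₁ : Listing n s₁ l V := hV.congr (S₁.reg 8 (by simp [setSizes, Cmd.regs]))
    (S₁.arr 1 (by simp [setSizes, Cmd.arrs])) (S₁.arr 2 (by simp [setSizes, Cmd.arrs]))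
  refine Tri.seq (tri_appendRest hLn h₁.n_eq hV₁) fun s₂ S₂ h₂ => ?_
  obtain ⟨V', hV₂, hVV⟩ := h₂
  have h₂ : Sizes n w m s s₂ := h₁.congr (S₂.regs (by decide))
  refine Tri.seq (tri_powers h₂.w_eq hLw) fun s₃ S₃ h₃ => ?_
  have h₃' : Sizes n w m s s₃ := h₂.congr (S₃.regs (by decide))
  refine Tri.seq (tri_base h₃' hLb) fun s₄ S₄ h₄ => ?_
  have h₄' : Sizes n w m s s₄ := h₃'.congr (S₄.regs (by decide))
  have hV₄ : Listing n s₄ n V' := (hV₂.congr (S₃.reg 8 (by decide)) (S₃.arr 1 (by decide))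
    (S₃.arr 2 (by decide))).congr (S₄.reg 8 (by decide)) (S₄.arr 1 (by decide))
    (S₄.arr 2 (by decide))
  have hin₄ : Input H n s₄ := by
    refine hin.congr (h₄'.n_eq.trans hin.size.symm) ?_
    rw [S₄.arr 0 (by decide), S₃.arr 0 (by decide), S₂.arr 0 (by decide),
      S₁.arr 0 (by simp [setSizes, Cmd.arrs])]
  refine (tri_reorder hirr hin₄ hV₄ hLn2 (by omega)).conseq fun s₅ S₅ h₅ => ?_
  refine ⟨V', hV₄.congr (S₅.reg 8 (by decide)) (S₅.arr 1 (by decide)) (S₅.arr 2 (by decide)), hVV,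
    { h₄'.congr (S₅.regs (by decide)) with
      W_eq := ?_
      B_eq := (S₅.reg 6 (by decide)).trans h₄.2
      β_eq := (S₅.reg 7 (by decide)).trans h₄.1
      pw := ?_
      adj := h₅ }⟩
  · rw [S₅.reg 4 (by decide), S₄.reg 4 (by decide), h₃.1]; norm_cast
  · rw [S₅.arr 9 (by decide), S₄.arr 9 (by decide)]; exact_mod_cast h₃.2

/-- The adjacency of two vertices. -/
def adjEx (a b : Ex) : Ex := .get 3 (a * .reg 0 + b)

open Classical in
theorem Setup.eval_adjEx {h : ℕ → ℕ → Prop} {w m s : ℕ} {st : St} (H : Setup h n w m s st)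
    {e f : Ex} {a b : ℕ} (he : e.eval st = a) (hf : f.eval st = b) (ha : a < n) (hb : b < n) :
    (adjEx e f).eval st = if h a b then 1 else 0 := by
  rw [adjEx, eval_get_nat (i := a * n + b) (by simp [he, hf, H.n_eq]), H.adj a ha b hb]

/-- Propositional formulas become arithmetic on 0 and 1. The matrix may be read outside its range,
but then a zero factor discards the value. -/
def okSlot : Ex :=
  1 - (Ex.reg 12).lt (.reg 13) * (1 - (Ex.reg 3 + Ex.reg 12).lt (.reg 0) *
    (Ex.reg 3 + Ex.reg 13).lt (.reg 0) * adjEx (.reg 3 + .reg 12) (.reg 3 + .reg 13))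

def allowed : Ex :=
  1 - (1 - (Ex.reg 13).lt (.reg 12)) * (1 -
    (1 - (Ex.reg 3 + Ex.reg 12).lt (.reg 0) * (1 - adjEx (.reg 16) (.reg 3 + .reg 12))) *
    (1 - (Ex.reg 3 + Ex.reg 13).lt (.reg 0) * (1 - adjEx (.reg 16) (.reg 3 + .reg 13))))

open Classical in
theorem Setup.eval_okSlot {h : ℕ → ℕ → Prop} {w m s : ℕ} {st : St} (H : Setup h n w m s st)
    {u v : ℕ} (hu : st.reg 12 = u) (hv : st.reg 13 = v) :
    okSlot.eval st = if OkSlot h n w u v then 1 else 0 := by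
  have e1 : (Ex.reg 3 + Ex.reg 12).eval st = (w + u : ℕ) := by simp [H.w_eq, hu]
  have e2 : (Ex.reg 3 + Ex.reg 13).eval st = (w + v : ℕ) := by simp [H.w_eq, hv]
  have key : okSlot.eval st = 1 - ltZ u v * (1 - ltZ (w + u : ℕ) n * ltZ (w + v : ℕ) n *
      (adjEx (.reg 3 + .reg 12) (.reg 3 + .reg 13)).eval st) := by
    simp [okSlot, hu, hv, H.w_eq, H.n_eq]
  rw [key]
  simp only [ltZ_nat, OkSlot]
  by_cases h1 : u < v <;> by_cases h2 : w + u < n <;> by_cases h3 : w + v < n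
  · rw [H.eval_adjEx e1 e2 h2 h3]
    by_cases h4 : h (w + u) (w + v) <;> simp [h1, h2, h3, h4]
  all_goals simp [h1, h2, h3]

open Classical in
theorem Setup.eval_allowed {h : ℕ → ℕ → Prop} {w m s : ℕ} {st : St} (H : Setup h n w m s st)
    {u v x : ℕ} (hu : st.reg 12 = u) (hv : st.reg 13 = v) (hx : st.reg 16 = x) (hxn : x < n) :
    allowed.eval st = if Allowed h n w u v x then 1 else 0 := by
  have e1 : (Ex.reg 3 + Ex.reg 12).eval st = (w + u : ℕ) := by simp [H.w_eq, hu]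
  have e2 : (Ex.reg 3 + Ex.reg 13).eval st = (w + v : ℕ) := by simp [H.w_eq, hv]
  have f1 : 1 - ltZ (w + u : ℕ) n * (1 - (adjEx (.reg 16) (.reg 3 + .reg 12)).eval st)
      = if w + u < n → h x (w + u) then 1 else 0 := by
    rw [ltZ_nat]
    by_cases h2 : w + u < n
    · rw [H.eval_adjEx (e := .reg 16) hx e1 hxn h2]
      by_cases h4 : h x (w + u) <;> simp [h2, h4]
    · simp [h2]
  have f2 : 1 - ltZ (w + v : ℕ) n * (1 - (adjEx (.reg 16) (.reg 3 + .reg 13)).eval st)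
      = if w + v < n → h x (w + v) then 1 else 0 := by
    rw [ltZ_nat]
    by_cases h2 : w + v < n
    · rw [H.eval_adjEx (e := .reg 16) hx e2 hxn h2]
      by_cases h4 : h x (w + v) <;> simp [h2, h4]
    · simp [h2]
  have key : allowed.eval st = 1 - (1 - ltZ v u) * (1 -
      (1 - ltZ (w + u : ℕ) n * (1 - (adjEx (.reg 16) (.reg 3 + .reg 12)).eval st)) *
      (1 - ltZ (w + v : ℕ) n * (1 - (adjEx (.reg 16) (.reg 3 + .reg 13)).eval st))) := by
    simp [allowed, hu, hv, H.w_eq, H.n_eq]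
  rw [key, f1, f2, ltZ_nat]
  by_cases hA : Allowed h n w u v x
  · rw [if_pos hA]
    unfold Allowed at hA
    split_ifs <;> first | rfl | (exfalso; tauto)
  · rw [if_neg hA]
    unfold Allowed at hA
    split_ifs <;> first | rfl | (exfalso; tauto)

def drawWeight : Cmd :=
  .seq (.set 14 0) (.loop 11 (.reg 5) (.seq (.flip 15) (.set 14 (.reg 14 * .reg 6 + .reg 15))))

theorem tri_drawWeight {B : ℤ} (hB : 2 ≤ B) {s : ℕ} {st : St} (h5 : st.reg 5 = s)
    (h6 : st.reg 6 = B) (hLs : s < 2 ^ L) (hLB : B ^ s < 2 ^ L) :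
    Tri L ω drawWeight st (1 + (1 + s * (1 + 2))) fun s' =>
      s'.reg 14 = horner B (fun j => ω (st.pos + j)) s ∧ s'.pos = st.pos + s := by
  have hL0 : 0 < L := by
    rcases Nat.eq_zero_or_pos L with rfl | h
    · have : 1 ≤ B ^ s := one_le_pow₀ (by omega)
      simp at hLB; omega
    · exact h
  have e1 : Tri L ω (.set 14 0) st 1 (· = st.setReg 14 0) := Tri.set 0 (by simp) (by simp) rfl
  refine Tri.seq e1 fun s₁ _ hs₁ => ?_
  refine Tri.loop (e := .reg 5) (fun i s' => s'.reg 14 = horner B (fun j => ω (st.pos + j)) i ∧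
    s'.pos = st.pos + i) s 2 (by subst hs₁; simp [h5]) hLs.le (by subst hs₁; simp [horner])
    (fun i s z h => by simpa using h) fun i hi s₂ S₂ x₂ h₂ => ?_
  have h6' : s₂.reg 6 = B := by rw [S₂.reg 6 (by decide)]; subst hs₁; simp [h6]
  have e2 : Tri L ω (.flip 15) s₂ 1 (· = s₂.flip ω 15) := Tri.flip hL0 rfl
  refine (Tri.seq e2 fun s₃ _ hs₃ => ?_ : Tri L ω _ s₂ (1 + 1) _)
  subst hs₃
  refine Tri.set (horner B (fun j => ω (st.pos + j)) (i + 1)) (by simp [h₂, h6', horner]) ?_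
    ⟨by simp, by simp [h₂.2, add_assoc]⟩
  have h1 := abs_horner_le hB (fun j => ω (st.pos + j)) (i + 1)
  have h2 : B ^ (i + 1) ≤ B ^ s := pow_le_pow_right₀ (by omega) hi
  omega

def drawWeights : Cmd :=
  .loop 10 (.reg 9) (.seq drawWeight (.seq (.set 12 (.reg 10 / (.reg 3 + 1) / .reg 2))
    (.seq (.set 13 (.reg 10 / (.reg 3 + 1) % .reg 2)) (.seq (.set 16 (.reg 10 % (.reg 3 + 1)))
      (.ite ((Ex.reg 16).eq (.reg 3)) (.put 4 (.reg 10) (.reg 14 * okSlot))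
        (.put 4 (.reg 10) (.reg 14 * allowed)))))))

/-- The array `4` holds the weights `a` and `b`. -/
structure Weights (w m : ℕ) (a : ℕ → ℕ → ℤ) (b : ℕ → ℕ → ℕ → ℤ) (st : St) : Prop where
  slot : ∀ q < m * m, st.arr 4 (q * (w + 1) + w) = a (q / m) (q % m)
  vertex : ∀ q < m * m, ∀ x < w, st.arr 4 (q * (w + 1) + x) = b (q / m) (q % m) x

theorem Weights.congr {w m : ℕ} {a : ℕ → ℕ → ℤ} {b : ℕ → ℕ → ℕ → ℤ} {st st' : St}
    (h : Weights w m a b st) (e : st'.arr 4 = st.arr 4) : Weights w m a b st' :=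
  ⟨by rw [e]; exact h.slot, by rw [e]; exact h.vertex⟩

/-- The invariant fixes the number of coins used: round `q` starts at coin `q * s`, just as `rand`
prescribes. -/
theorem tri_drawWeights {h : ℕ → ℕ → Prop} {w m s : ℕ} {B : ℤ} (hB : B = 2 * 2 ^ bigExp w m s)
    {st : St} (H : Setup h n w m s st) (hpos : st.pos = 0) (hwn : w ≤ n)
    (hLs : s < 2 ^ L) (hLN : m * m * (w + 1) < 2 ^ L) (hLB : B ^ s < 2 ^ L) :
    Tri L ω drawWeights st
      (1 + m * m * (w + 1) * (1 + ((1 + (1 + s * (1 + 2))) + (1 + (1 + (1 + (1 + 1)))))))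
      (Weights w m (slotWeight h n w m (rand B s (m * m * (w + 1)) ω))
        (vertexWeight h n w m (rand B s (m * m * (w + 1)) ω))) := by
  have hB2 : 2 ≤ B := by
    have : (1 : ℤ) ≤ 2 ^ bigExp w m s := one_le_pow₀ (by norm_num)
    omega
  set N := m * m * (w + 1) with hN
  set r := rand B s N ω with hr
  set F : ℕ → ℤ := fun q => if q % (w + 1) = w then
    slotWeight h n w m r (q / (w + 1) / m) (q / (w + 1) % m) else
    vertexWeight h n w m r (q / (w + 1) / m) (q / (w + 1) % m) (q % (w + 1)) with hF
  refine (Tri.loop (e := .reg 9) (fun i s' => (∀ q < i, s'.arr 4 q = F q) ∧ s'.pos = i * s) N _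
    H.N_eq hLN.le (by simp [hpos]) (fun i s z h => by simpa using h) fun q hq s₁ S₁ x₁ h₁ => ?_).conseq
    fun s' _ h' => ?_
  · have H₁ := H.same S₁ (by decide) (by decide)
    have hm0 : 0 < m := Nat.pos_of_ne_zero (by rintro rfl; simp [hN] at hq)
    have hidx : (q / (w + 1) / m * m + q / (w + 1) % m) * (w + 1) + q % (w + 1) = q := by
      rw [Nat.div_add_mod', Nat.div_add_mod']
    refine Tri.seq (tri_drawWeight hB2 H₁.s_eq (H₁.B_eq.trans hB.symm) hLs hLB) fun s₂ S₂ h₂ => ?_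
    have H₂ := H₁.same S₂ (by decide) (by decide)
    have x₂ : s₂.reg 10 = q := (S₂.reg 10 (by decide)).trans x₁
    have hz₂ : s₂.reg 14 = r q := by
      rw [h₂.1, hr, rand, if_pos hq, h₁.2]
    have hqL : q / (w + 1) < 2 ^ L := (Nat.div_le_self _ _).trans_lt (hq.trans hLN)
    have lift : ∀ {a : ℕ}, a < 2 ^ L → |(a : ℤ)| < 2 ^ L := fun ha => by
      rw [Nat.abs_cast]; exact_mod_cast ha
    have e3 : Tri L ω (.set 12 (.reg 10 / (.reg 3 + 1) / .reg 2)) s₂ 1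
        (· = s₂.setReg 12 (q / (w + 1) / m : ℕ)) :=
      Tri.set _ (by simp [x₂, H₂.w_eq, H₂.m_eq]) (lift ((Nat.div_le_self _ _).trans_lt hqL)) rfl
    refine Tri.seq e3 fun s₃ S₃ hs₃ => ?_
    have H₃ := H₂.same S₃ (by decide) (by decide)
    have x₃ : s₃.reg 10 = q := (S₃.reg 10 (by decide)).trans x₂
    have e4 : Tri L ω (.set 13 (.reg 10 / (.reg 3 + 1) % .reg 2)) s₃ 1
        (· = s₃.setReg 13 (q / (w + 1) % m : ℕ)) :=
      Tri.set _ (by simp [x₃, H₃.w_eq, H₃.m_eq]) (lift ((Nat.mod_le _ _).trans_lt hqL)) rfl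
    refine Tri.seq e4 fun s₄ S₄ hs₄ => ?_
    have H₄ := H₃.same S₄ (by decide) (by decide)
    have x₄ : s₄.reg 10 = q := (S₄.reg 10 (by decide)).trans x₃
    have hmod : q % (w + 1) < w + 1 := Nat.mod_lt _ (by omega)
    have e5 : Tri L ω (.set 16 (.reg 10 % (.reg 3 + 1))) s₄ 1
        (· = s₄.setReg 16 (q % (w + 1) : ℕ)) :=
      Tri.set _ (by simp [x₄, H₄.w_eq]) (lift ((Nat.mod_le _ _).trans_lt (hq.trans hLN))) rfl
    refine Tri.seq e5 fun s₅ S₅ hs₅ => ?_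
    have H₅ := H₄.same S₅ (by decide) (by decide)
    have x₅ : s₅.reg 10 = q := (S₅.reg 10 (by decide)).trans x₄
    have y₅ : s₅.reg 16 = (q % (w + 1) : ℕ) := by subst hs₅; simp
    have v₅ : s₅.reg 13 = (q / (w + 1) % m : ℕ) := by subst hs₅ hs₄; simp
    have u₅ : s₅.reg 12 = (q / (w + 1) / m : ℕ) := by subst hs₅ hs₄ hs₃; simp
    have z₅ : s₅.reg 14 = r q := by subst hs₅ hs₄ hs₃; simp [hz₂]
    have a₅ : s₅.arr 4 = s₁.arr 4 := by
      rw [S₅.arr 4 (by decide), S₄.arr 4 (by decide), S₃.arr 4 (by decide), S₂.arr 4 (by decide)]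
    have p₅ : s₅.pos = (q + 1) * s := by
      rw [S₅.pos rfl, S₄.pos rfl, S₃.pos rfl, h₂.2, h₁.2]; ring
    have hrq : |r q| < 2 ^ L := by
      rw [hr, rand, if_pos hq]
      have := abs_horner_le hB2 (fun j => ω (q * s + j)) s
      omega
    have hFq : |F q| < 2 ^ L := by
      simp only [hF, slotWeight, vertexWeight]
      split_ifs with h1 h2 h2
      · rw [h1] at hidx; rwa [hidx]
      · simp
      · rwa [hidx]
      · simp
    have hfin : (∀ p < q + 1, (s₅.setArr 4 q (F q)).arr 4 p = F p) ∧
        (s₅.setArr 4 q (F q)).pos = (q + 1) * s := by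
      refine ⟨fun p hp => ?_, p₅⟩
      rcases Nat.lt_succ_iff_lt_or_eq.1 hp with hp | rfl
      · rw [setArr_arr_self, if_neg hp.ne, a₅]; exact h₁.1 p hp
      · simp
    refine Tri.ite (fun hc => ?_) fun hc => ?_
    · have hc' : q % (w + 1) = w := by
        rw [eval_eq, eqZ_ne_zero] at hc
        simp only [eval_reg, y₅, H₅.w_eq] at hc
        exact_mod_cast hc
      refine Tri.put q (F q) (by simpa using x₅) ?_ hFq hfin
      rw [eval_mul, eval_reg, z₅, H₅.eval_okSlot u₅ v₅]
      simp only [hF, if_pos hc', slotWeight]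
      rw [hc'] at hidx
      rw [hidx]
      split_ifs <;> simp
    · have hc' : q % (w + 1) ≠ w := by
        intro h'
        refine absurd hc (eqZ_ne_zero.2 ?_)
        simp only [eval_reg, y₅, H₅.w_eq, h']
      refine Tri.put q (F q) (by simpa using x₅) ?_ hFq hfin
      rw [eval_mul, eval_reg, z₅, H₅.eval_allowed u₅ v₅ y₅ (by omega)]
      simp only [hF, if_neg hc', vertexWeight]
      rw [hidx]
      split_ifs <;> simp
  · have hlt : ∀ q < m * m, ∀ x < w + 1, q * (w + 1) + x < N := by
      intro q hq x hx
      rw [hN]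
      calc q * (w + 1) + x < q * (w + 1) + (w + 1) := by omega
        _ = (q + 1) * (w + 1) := by ring
        _ ≤ _ := Nat.mul_le_mul_right _ hq
    refine ⟨fun q hq => ?_, fun q hq x hx => ?_⟩
    · rw [h'.1 _ (hlt q hq w (by omega))]
      obtain ⟨h1, h2⟩ := slot_div (w := w) (q := q) (j := w) (by omega)
      simp only [hF, h1, h2, if_true]
    · rw [h'.1 _ (hlt q hq x (by omega))]
      obtain ⟨h1, h2⟩ := slot_div (w := w) (q := q) (j := x) (by omega)
      simp only [hF, h1, h2, hx.ne, if_false]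

end DualColoring

/-! The tables of the weights of the cliques inside every subset. -/

namespace DualColoring

open StructuredRAM CliqueCover Finset

/-- The finite set with the characteristic bits of `S`. -/
def bits (S : ℕ) : Finset ℕ := S.bitIndices.toFinset

theorem mem_bits {S j : ℕ} : j ∈ bits S ↔ S / 2 ^ j % 2 = 1 := by
  simp [bits, Nat.testBit_eq_decide_div_mod_eq]

theorem bits_sum (s : Finset ℕ) : bits (∑ i ∈ s, 2 ^ i) = s := toFinset_bitIndices_sum_two_pow s

theorem sum_bits (S : ℕ) : ∑ i ∈ bits S, 2 ^ i = S := sum_toFinset_bitIndices_two_pow S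

theorem bits_subset {S w : ℕ} : bits S ⊆ range w ↔ S < 2 ^ w := by
  refine ⟨fun h => ?_, fun h j hj => ?_⟩
  · have := Nat.geomSum_lt (m := 2) le_rfl (fun k hk => mem_range.1 (h hk))
    rwa [sum_bits] at this
  · have h1 : 2 ^ j ≤ ∑ i ∈ bits S, 2 ^ i := single_le_sum (f := fun i => 2 ^ i) (by simp) hj
    rw [sum_bits] at h1
    exact mem_range.2 ((Nat.pow_lt_pow_iff_right (by norm_num)).1 (h1.trans_lt h))

theorem bits_zero : bits 0 = ∅ := by simpa using bits_sum ∅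

theorem bits_two_pow_add {x S : ℕ} (hS : S < 2 ^ x) : bits (2 ^ x + S) = insert x (bits S) := by
  have hx : x ∉ bits S := fun h => by simpa using bits_subset.2 hS h
  conv_lhs => rw [← sum_bits S, ← sum_insert (f := fun i => 2 ^ i) hx]
  exact bits_sum _

theorem sum_range_two_pow {R : Type*} [AddCommMonoid R] (w : ℕ) (f : Finset ℕ → R) :
    ∑ S ∈ range (2 ^ w), f (bits S) = ∑ s ∈ (range w).powerset, f s :=
  sum_nbij' (i := bits) (j := fun s => ∑ i ∈ s, 2 ^ i)
    (fun S hS => mem_powerset.2 (bits_subset.2 (mem_range.1 hS)))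
    (fun s hs => mem_range.2 (bits_subset.1 (by rw [bits_sum]; exact mem_powerset.1 hs)))
    (fun S _ => sum_bits S) (fun s _ => bits_sum s) fun _ _ => rfl

variable {L : ℕ} {ω : ℕ → Bool} {n : ℕ}

def tableBase : Cmd :=
  .loop 10 (.reg 2 * .reg 2)
    (.put 5 (.reg 10 * .reg 4) (.get 4 (.reg 10 * (.reg 3 + 1) + .reg 3)))

/-- Computes the number of the set of neighbours of `x` in the set with number `S`. -/
def mask : Cmd :=
  .seq (.set 12 0) (.loop 13 (.reg 10) (.set 12 (.reg 12 +
    .reg 11 / .get 9 (.reg 13) % 2 * adjEx (.reg 10) (.reg 13) * .get 9 (.reg 13))))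

def tableColumn : Cmd :=
  .loop 13 (.reg 2 * .reg 2) (.put 5 (.reg 13 * .reg 4 + (.get 9 (.reg 10) + .reg 11))
    (.get 5 (.reg 13 * .reg 4 + .reg 11) + .get 4 (.reg 13 * (.reg 3 + 1) + .reg 10) *
      .get 5 (.reg 13 * .reg 4 + .reg 12)))

/-- Subsets are numbered in binary. Those with largest element `x` have the numbers `2 ^ x + S`, `S
< 2 ^ x`, and `cliqueSum_insert` refers them to two smaller numbers, both below `2 ^ x`. -/
def tables : Cmd :=
  .seq tableBase (.loop 10 (.reg 3) (.loop 11 (.get 9 (.reg 10)) (.seq mask tableColumn)))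

/-- The array `5` holds the weights for the subsets with number less than `K`. -/
def Table (h : ℕ → ℕ → Prop) (w m : ℕ) (a : ℕ → ℕ → ℤ) (b : ℕ → ℕ → ℕ → ℤ) (K : ℕ) (st : St) :
    Prop :=
  ∀ q < m * m, ∀ S < K, st.arr 5 (q * 2 ^ w + S) = wt h a b (bits S) (q / m) (q % m)

variable {h : ℕ → ℕ → Prop} {w m s : ℕ} {a : ℕ → ℕ → ℤ} {b : ℕ → ℕ → ℕ → ℤ}

theorem index_inj {W q q' S S' : ℕ} (hS : S < W) (hS' : S' < W) (e : q * W + S = q' * W + S') :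
    q = q' ∧ S = S' := by
  have h1 : (q * W + S) / W = q := by
    rw [Nat.add_comm, Nat.add_mul_div_right _ _ (by omega), Nat.div_eq_of_lt hS, zero_add]
  have h2 : (q' * W + S') / W = q' := by
    rw [Nat.add_comm, Nat.add_mul_div_right _ _ (by omega), Nat.div_eq_of_lt hS', zero_add]
  have : q = q' := by rw [← h1, ← h2, e]
  subst this
  exact ⟨rfl, by omega⟩

theorem tri_tableBase {st : St} (H : Setup h n w m s st) (hw : Weights w m a b st)
    (hLm : m * m < 2 ^ L)
    (hbd : ∀ q < m * m, ∀ s ⊆ range w, |wt h a b s (q / m) (q % m)| < 2 ^ L) :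
    Tri L ω tableBase st (1 + m * m * (1 + 1)) (Table h w m a b 1) := by
  have wt0 : ∀ q, wt h a b (bits 0) (q / m) (q % m) = a (q / m) (q % m) := fun q => by
    rw [bits_zero, wt, cliqueSum_empty, mul_one]
  refine (Tri.loop (fun i s' => ∀ q < i, s'.arr 5 (q * 2 ^ w) = a (q / m) (q % m)) (m * m) 1
    (by simp [H.m_eq]) hLm.le (by simp) (fun i s z h => h) fun q hq s₁ S₁ x₁ h₁ => ?_).conseq
    fun s' _ h' q hq S hS => ?_
  · have H₁ := H.same S₁ (by decide) (by decide)
    refine Tri.put (q * 2 ^ w) (a (q / m) (q % m)) (by simp [x₁, H₁.W_eq]) ?_ ?_ fun p hp => ?_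
    · rw [eval_get_nat (i := q * (w + 1) + w) (by simp [x₁, H₁.w_eq]), S₁.arr 4 (by decide)]
      exact hw.slot q hq
    · rw [← wt0]
      exact hbd q hq _ (by simp [bits_zero])
    · rw [setArr_arr_self]
      split_ifs with e
      · obtain rfl := Nat.eq_of_mul_eq_mul_right (by positivity) e
        rfl
      · have : p ≠ q := by rintro rfl; exact e rfl
        exact h₁ p (by omega)
  · obtain rfl : S = 0 := by omega
    rw [wt0]
    exact h' q hq

open Classical in
theorem tri_mask {st : St} (H : Setup h n w m s st) {x S : ℕ} (h10 : st.reg 10 = x)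
    (h11 : st.reg 11 = S) (hx : x < w) (hwn : w ≤ n) (hLw : 2 ^ w < 2 ^ L) (hSx : S < 2 ^ x) :
    Tri L ω mask st (1 + (1 + w * 2)) fun s' =>
      s'.reg 12 = (∑ j ∈ (bits S).filter (h x), 2 ^ j : ℕ) := by
  set F : ℕ → ℕ := fun j => if j ∈ bits S ∧ h x j then 2 ^ j else 0 with hF
  have e1 : Tri L ω (.set 12 0) st 1 (· = st.setReg 12 0) := Tri.set 0 (by simp) (by simp) rfl
  refine Tri.seq e1 fun s₁ S₁ hs₁ => ?_
  have H₁ := H.same S₁ (by decide) (by decide)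
  have hxw : x ≤ 2 ^ L := hx.le.trans (Nat.lt_two_pow_self.le.trans hLw.le)
  have hlt : ∀ i ≤ x, ∑ j ∈ range i, F j < 2 ^ L := fun i hi => by
    refine lt_of_le_of_lt (sum_le_sum (g := fun j => 2 ^ j) fun j _ => ?_)
      ((Nat.geomSum_lt (m := 2) (n := w) le_rfl fun k hk => ?_).trans hLw)
    · simp only [hF]; split_ifs <;> simp
    · rw [mem_range] at hk; omega
  refine (Tri.sumLoop (e := .reg 10) x (fun j => F j) (by decide)
    ((S₁.reg 10 (by decide)).trans h10) hxw (fun j hj s₂ h1 h2 h3 => ?_) fun i hi => ?_).mono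
    (by gcongr) fun s₂ _ h₂ => ?_
  · have r10 : s₂.reg 10 = x := (h1 10 (by decide) (by decide)).trans
      ((S₁.reg 10 (by decide)).trans h10)
    have r11 : s₂.reg 11 = S := (h1 11 (by decide) (by decide)).trans
      ((S₁.reg 11 (by decide)).trans h11)
    have hpw : (Ex.get 9 (.reg 13)).eval s₂ = (2 ^ j : ℕ) := by
      rw [eval_get_nat (i := j) (by simpa using h3), h2, H₁.pw j (by omega)]
    have hadj : (adjEx (.reg 10) (.reg 13)).eval s₂ = if h x j then 1 else 0 := by
      rw [adjEx, eval_get_nat (i := x * n + j)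
        (by simp [r10, h3, h1 0 (by decide) (by decide), H₁.n_eq]), h2,
        H₁.adj x (by omega) j (by omega)]
    have hbit : (Ex.reg 11 / Ex.get 9 (.reg 13) % 2).eval s₂ = if j ∈ bits S then 1 else 0 := by
      have : (Ex.reg 11 / Ex.get 9 (.reg 13) % 2).eval s₂ = (S / 2 ^ j % 2 : ℕ) := by
        rw [eval_mod, eval_div, hpw, eval_reg, r11]; simp
      rw [this]
      split_ifs with hj
      · rw [mem_bits.1 hj]; rfl
      · rw [mem_bits] at hj
        rw [show S / 2 ^ j % 2 = 0 by omega]; rfl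
    rw [eval_mul, eval_mul, hbit, hadj, hpw, hF]
    by_cases c1 : j ∈ bits S <;> by_cases c2 : h x j <;> simp [c1, c2]
  · subst hs₁
    simp only [setReg_reg, if_true, zero_add]
    rw [← Nat.cast_sum, Nat.abs_cast]
    exact_mod_cast hlt i hi
  · subst hs₁
    rw [h₂, setReg_reg, if_pos rfl, zero_add, ← Nat.cast_sum, hF, ← sum_filter]
    congr 2
    ext j
    simp only [mem_filter, mem_range, and_iff_right_iff_imp]
    rintro ⟨hj, _⟩
    simpa using bits_subset.2 hSx hj

open Classical in
theorem tri_tableColumn {st : St} (H : Setup h n w m s st) (hw : Weights w m a b st) {x S : ℕ}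
    (h10 : st.reg 10 = x) (h11 : st.reg 11 = S)
    (h12 : st.reg 12 = (∑ j ∈ (bits S).filter (h x), 2 ^ j : ℕ)) (hx : x < w)
    (hSx : S < 2 ^ x) (hT : Table h w m a b (2 ^ x + S) st) (hLm : m * m < 2 ^ L)
    (hbd : ∀ q < m * m, ∀ s ⊆ range w, |wt h a b s (q / m) (q % m)| < 2 ^ L) :
    Tri L ω tableColumn st (1 + m * m * (1 + 1)) (Table h w m a b (2 ^ x + S + 1)) := by
  have hxw : 2 ^ x + 2 ^ x ≤ 2 ^ w := by
    rw [← two_mul, ← pow_succ']; exact Nat.pow_le_pow_right (by norm_num) hx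
  set M := ∑ j ∈ (bits S).filter (h x), 2 ^ j with hM
  have hMx : M < 2 ^ x := by
    rw [← bits_subset, hM, bits_sum]
    exact (filter_subset _ _).trans (bits_subset.2 hSx)
  have hrec : ∀ u v, wt h a b (bits (2 ^ x + S)) u v
      = wt h a b (bits S) u v + b u v x * wt h a b (bits M) u v := by
    intro u v
    rw [bits_two_pow_add hSx, hM, bits_sum]
    simp only [wt]
    rw [cliqueSum_insert h (b u v) fun y hy => mem_range.1 (bits_subset.2 hSx hy)]
    ring
  refine (Tri.loop (fun i s' => Table h w m a b (2 ^ x + S) s' ∧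
      ∀ q < i, s'.arr 5 (q * 2 ^ w + (2 ^ x + S)) = wt h a b (bits (2 ^ x + S)) (q / m) (q % m))
    (m * m) 1 (by simp [H.m_eq]) hLm.le ⟨hT, by simp⟩ (fun i s z h => h)
    fun q hq s₁ S₁ x₁ h₁ => ?_).conseq fun s' _ h' q hq S' hS' => ?_
  · have H₁ := H.same S₁ (by decide) (by decide)
    have hw₁ := hw.congr (S₁.arr 4 (by decide))
    have r10 := (S₁.reg 10 (by decide)).trans h10
    have r11 := (S₁.reg 11 (by decide)).trans h11
    have r12 := (S₁.reg 12 (by decide)).trans h12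
    have hpw : (Ex.get 9 (.reg 10)).eval s₁ = (2 ^ x : ℕ) := by
      rw [eval_get_nat (i := x) (by simpa using r10), H₁.pw x hx]
    have g1 : (Ex.get 5 (.reg 13 * .reg 4 + .reg 11)).eval s₁
        = wt h a b (bits S) (q / m) (q % m) := by
      rw [eval_get_nat (i := q * 2 ^ w + S) (by simp [x₁, H₁.W_eq, r11])]
      exact h₁.1 q hq S (by have := Nat.two_pow_pos x; omega)
    have g2 : (Ex.get 4 (.reg 13 * (.reg 3 + 1) + .reg 10)).eval s₁ = b (q / m) (q % m) x := by
      rw [eval_get_nat (i := q * (w + 1) + x) (by simp [x₁, H₁.w_eq, r10])]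
      exact hw₁.vertex q hq x hx
    have g3 : (Ex.get 5 (.reg 13 * .reg 4 + .reg 12)).eval s₁
        = wt h a b (bits M) (q / m) (q % m) := by
      rw [eval_get_nat (i := q * 2 ^ w + M) (by simp [x₁, H₁.W_eq, r12])]
      exact h₁.1 q hq M (by omega)
    refine Tri.put (q * 2 ^ w + (2 ^ x + S)) (wt h a b (bits (2 ^ x + S)) (q / m) (q % m))
      ?_ ?_ (hbd q hq _ (bits_subset.2 (by omega))) ⟨fun p hp S' hS' => ?_, fun p hp => ?_⟩
    · simp only [eval_add, eval_mul, eval_reg, hpw, x₁, H₁.W_eq, r11]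
      push_cast; ring
    · rw [eval_add, eval_mul, g1, g2, g3, hrec]
    · rw [setArr_arr_self, if_neg]
      · exact h₁.1 p hp S' hS'
      · intro e
        have := (index_inj (by omega) (by omega) e).2
        omega
    · rw [setArr_arr_self]
      split_ifs with e
      · rw [(index_inj (by omega) (by omega) e).1]
      · have : p ≠ q := by rintro rfl; exact e rfl
        exact h₁.2 p (by omega)
  · rcases Nat.lt_succ_iff_lt_or_eq.1 hS' with hS' | rfl
    · exact h'.1 q hq S' hS'
    · exact h'.2 q hq

theorem tri_tables {st : St} (H : Setup h n w m s st) (hw : Weights w m a b st) (hwn : w ≤ n)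
    (hLm : m * m < 2 ^ L) (hLw : 2 ^ w < 2 ^ L)
    (hbd : ∀ q < m * m, ∀ s ⊆ range w, |wt h a b s (q / m) (q % m)| < 2 ^ L) :
    Tri L ω tables st ((1 + m * m * (1 + 1)) + (1 + w * (1 + (1 + 2 ^ w * (1 +
      ((1 + (1 + w * 2)) + (1 + m * m * (1 + 1)))))))) (Table h w m a b (2 ^ w)) := by
  refine Tri.seq (tri_tableBase H hw hLm hbd) fun s₁ S₁ h₁ => ?_
  have H₁ := H.same S₁ (by decide) (by decide)
  have hw₁ := hw.congr (S₁.arr 4 (by decide))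
  refine Tri.loop (e := .reg 3) (fun i s' => Table h w m a b (2 ^ i) s') w _ H₁.w_eq
    (Nat.lt_two_pow_self.le.trans hLw.le) h₁ (fun i s z h => h) fun x hx s₂ S₂ x₂ h₂ => ?_
  have H₂ := H₁.same S₂ (by decide) (by decide)
  have hw₂ := hw₁.congr (S₂.arr 4 (by decide))
  have hxw : 2 ^ x ≤ 2 ^ w := Nat.pow_le_pow_right (by norm_num) hx.le
  refine (Tri.loop (fun i s' => Table h w m a b (2 ^ x + i) s') (2 ^ x) _ ?_
    (hxw.trans hLw.le) h₂ (fun i s z h => h) fun S hS s₃ S₃ x₃ h₃ => ?_).mono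
    (by gcongr) fun s' _ h' => ?_
  · rw [eval_get_nat (i := x) (by simpa using x₂), H₂.pw x hx]
  · have H₃ := H₂.same S₃ (by decide) (by decide)
    have hw₃ := hw₂.congr (S₃.arr 4 (by decide))
    have r10 := (S₃.reg 10 (by decide)).trans x₂
    refine Tri.seq (tri_mask H₃ r10 x₃ hx hwn hLw hS) fun s₄ S₄ h₄ => ?_
    refine tri_tableColumn (H₃.same S₄ (by decide) (by decide)) (hw₃.congr (S₄.arr 4 (by decide)))
      ((S₄.reg 10 (by decide)).trans r10) ((S₄.reg 11 (by decide)).trans x₃) h₄ hx hS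
      (fun q hq S' hS' => ?_) hLm hbd
    rw [S₄.arr 5 (by decide)]
    exact h₃ q hq S' hS'
  · rwa [← two_mul, ← pow_succ'] at h'

end DualColoring

/-! The sum of the determinants over all subsets. -/

namespace DualColoring

open StructuredRAM CliqueCover Finset FaddeevLeVerrier

/-- The array `k` holds the matrix `A` row by row. -/
def Holds {m : ℕ} (k : ℕ) (A : Matrix (Fin m) (Fin m) ℤ) (st : St) : Prop :=
  ∀ u v : Fin m, st.arr k (u * m + v) = A u v

theorem Holds.congr {m k : ℕ} {A : Matrix (Fin m) (Fin m) ℤ} {st st' : St} (h : Holds k A st)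
    (e : st'.arr k = st.arr k) : Holds k A st' := by unfold Holds; rw [e]; exact h

theorem index_lt {m u v : ℕ} (hu : u < m) (hv : v < m) : u * m + v < m * m := by nlinarith

theorem index_div {m v : ℕ} (u : ℕ) (hv : v < m) : (u * m + v) / m = u := by
  rw [Nat.add_comm, Nat.add_mul_div_right _ _ (by omega), Nat.div_eq_of_lt hv, zero_add]

theorem index_mod {m v : ℕ} (u : ℕ) (hv : v < m) : (u * m + v) % m = v := by
  rw [Nat.add_comm, Nat.add_mul_mod_self_right, Nat.mod_eq_of_lt hv]

theorem div_lt_and_mod_lt {m q : ℕ} (hq : q < m * m) : q / m < m ∧ q % m < m := by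
  have hm : 0 < m := Nat.pos_of_ne_zero (by rintro rfl; simp at hq)
  exact ⟨(Nat.div_lt_iff_lt_mul hm).2 hq, Nat.mod_lt _ hm⟩

variable {L : ℕ} {ω : ℕ → Bool} {n m : ℕ}

/-- `1` on the diagonal, `0` elsewhere. -/
def diagonal : Ex := (Ex.reg 11 / .reg 2).eq (.reg 11 % .reg 2)

theorem eval_diagonal {st : St} {q : ℕ} (h2 : st.reg 2 = m) (h11 : st.reg 11 = q) :
    diagonal.eval st = if q / m = q % m then 1 else 0 := by
  have : diagonal.eval st = eqZ (q / m : ℕ) (q % m : ℕ) := by simp [diagonal, h2, h11]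
  rw [this, eqZ_nat]

def identity : Cmd := .loop 11 (.reg 2 * .reg 2) (.put 7 (.reg 11) diagonal)

theorem tri_identity {st : St} (h2 : st.reg 2 = m) (hLm : m * m < 2 ^ L) (hL0 : 0 < L) :
    Tri L ω identity st (1 + m * m * 2) (Holds 7 (1 : Matrix (Fin m) (Fin m) ℤ)) := by
  have hL1 : (1 : ℤ) < 2 ^ L := one_lt_pow₀ (by norm_num) hL0.ne'
  refine (Tri.fill (m * m) (fun q => if q / m = q % m then 1 else 0) (by simp [h2]) hLm.le
    (fun q _ s' h1 _ h3 _ _ => eval_diagonal ((h1 2 (by decide)).trans h2) h3) fun q _ => ?_).conseq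
    fun s' _ h' u v => ?_
  · split_ifs <;> simp [hL1]
  · rw [h'.1 _ (index_lt u.2 v.2), index_div _ v.2, index_mod _ v.2, Matrix.one_apply]
    simp only [Fin.ext_iff]

def product : Cmd :=
  .loop 11 (.reg 2 * .reg 2) (.seq (.set 14 0) (.seq
    (.loop 12 (.reg 2) (.set 14 (.reg 14 + .get 6 (.reg 11 / .reg 2 * .reg 2 + .reg 12) *
      .get 7 (.reg 12 * .reg 2 + .reg 11 % .reg 2))))
    (.put 8 (.reg 11) (.reg 14))))

theorem tri_product {A M : Matrix (Fin m) (Fin m) ℤ} {α μ : ℤ} {st : St} (h2 : st.reg 2 = m)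
    (hA : Holds 6 A st) (hM : Holds 7 M st) (bA : ∀ u v, |A u v| ≤ α) (bM : ∀ u v, |M u v| ≤ μ)
    (hα : 0 ≤ α) (hμ : 0 ≤ μ) (hLm : m * m < 2 ^ L) (hL : m * (α * μ) < 2 ^ L) :
    Tri L ω product st (1 + m * m * (1 + (1 + ((1 + m * 2) + 1)))) (Holds 8 (A * M)) := by
  set F : ℕ → ℕ → ℤ := fun q l => st.arr 6 (q / m * m + l) * st.arr 7 (l * m + q % m) with hF
  have bF : ∀ q < m * m, ∀ l < m, |F q l| ≤ α * μ := fun q hq l hl => by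
    obtain ⟨hu, hv⟩ := div_lt_and_mod_lt hq
    have e1 := hA ⟨q / m, hu⟩ ⟨l, hl⟩
    have e2 := hM ⟨l, hl⟩ ⟨q % m, hv⟩
    simp only [hF, abs_mul]
    simp only at e1 e2
    rw [e1, e2]
    exact mul_le_mul (bA _ _) (bM _ _) (abs_nonneg _) hα
  have bS : ∀ q < m * m, ∀ i ≤ m, |∑ l ∈ range i, F q l| < 2 ^ L := fun q hq i hi => by
    refine lt_of_le_of_lt ((abs_sum_le_sum_abs _ _).trans (sum_le_sum (g := fun _ => α * μ)
      fun l hl => bF q hq l (by rw [mem_range] at hl; omega))) (lt_of_le_of_lt ?_ hL)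
    rw [sum_const, card_range, nsmul_eq_mul]
    gcongr
  have hm2 : m ≤ 2 ^ L := by nlinarith
  have hL0 : (0 : ℤ) < 2 ^ L := by positivity
  refine (Tri.loop (fun i s' => ∀ q < i, s'.arr 8 q = ∑ l ∈ range m, F q l) (m * m) _
    (by simp [h2]) hLm.le (by simp) (fun i s z h => h) fun q hq s₁ S₁ x₁ h₁ => ?_).conseq
    fun s' _ h' u v => ?_
  · have e1 : Tri L ω (.set 14 0) s₁ 1 (· = s₁.setReg 14 0) := Tri.set 0 (by simp) (by simp) rfl
    refine Tri.seq e1 fun s₂ S₂ hs₂ => ?_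
    have r2 : s₂.reg 2 = m := (S₂.reg 2 (by decide)).trans ((S₁.reg 2 (by decide)).trans h2)
    have r11 : s₂.reg 11 = q := (S₂.reg 11 (by decide)).trans x₁
    have r14 : s₂.reg 14 = 0 := by subst hs₂; simp
    refine Tri.seq (Tri.sumLoop (e := .reg 2) m (F q) (by decide) r2 hm2
      (fun l hl s₃ g1 g2 g3 => ?_) fun i hi => ?_) fun s₃ S₃ h₃ => ?_
    · have t2 : s₃.reg 2 = m := (g1 2 (by decide) (by decide)).trans r2
      have t11 : s₃.reg 11 = q := (g1 11 (by decide) (by decide)).trans r11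
      rw [eval_mul, eval_get_nat (i := q / m * m + l) (by simp [t2, t11, g3]),
        eval_get_nat (i := l * m + q % m) (by simp [t2, t11, g3]), g2, S₂.arr 6 (by decide),
        S₂.arr 7 (by decide), S₁.arr 6 (by decide), S₁.arr 7 (by decide)]
    · rw [r14, zero_add]
      exact bS q hq i hi
    · refine Tri.put q (∑ l ∈ range m, F q l) (by simpa using (S₃.reg 11 (by decide)).trans r11)
        (by simp [h₃, r14]) (bS q hq m le_rfl) fun p hp => ?_
      rw [setArr_arr_self]
      split_ifs with e
      · rw [e]
      · rw [S₃.arr 8 (by decide), S₂.arr 8 (by decide)]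
        exact h₁ p (by omega)
  · rw [h' _ (index_lt u.2 v.2), Matrix.mul_apply, sum_range]
    simp only [hF, index_div _ v.2, index_mod _ v.2]
    exact sum_congr rfl fun l _ => by rw [hA u l, hM l v]

def trace : Cmd :=
  .seq (.set 14 0) (.loop 11 (.reg 2) (.set 14 (.reg 14 + .get 8 (.reg 11 * .reg 2 + .reg 11))))

theorem tri_trace {A : Matrix (Fin m) (Fin m) ℤ} {α : ℤ} {st : St} (h2 : st.reg 2 = m)
    (hA : Holds 8 A st) (bA : ∀ u v, |A u v| ≤ α) (hα : 0 ≤ α) (hLm : m * m < 2 ^ L)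
    (hL : m * α < 2 ^ L) :
    Tri L ω trace st (1 + (1 + m * 2)) fun s' => s'.reg 14 = A.trace := by
  have hm2 : m ≤ 2 ^ L := by nlinarith
  have hL0 : (0 : ℤ) < 2 ^ L := by positivity
  have e1 : Tri L ω (.set 14 0) st 1 (· = st.setReg 14 0) := Tri.set 0 (by simp) (by simp) rfl
  refine Tri.seq e1 fun s₂ S₂ hs₂ => ?_
  have r2 : s₂.reg 2 = m := (S₂.reg 2 (by decide)).trans h2
  have r14 : s₂.reg 14 = 0 := by subst hs₂; simp
  refine (Tri.sumLoop (e := .reg 2) m (fun l => st.arr 8 (l * m + l)) (by decide) r2 hm2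
    (fun l hl s₃ g1 g2 g3 => ?_) fun i hi => ?_).conseq fun s₃ S₃ h₃ => ?_
  · have t2 : s₃.reg 2 = m := (g1 2 (by decide) (by decide)).trans r2
    rw [eval_get_nat (i := l * m + l) (by simp [t2, g3]), g2, S₂.arr 8 (by decide)]
  · rw [r14, zero_add]
    refine lt_of_le_of_lt ((abs_sum_le_sum_abs _ _).trans (sum_le_sum (g := fun _ => α)
      fun l hl => ?_)) (lt_of_le_of_lt ?_ hL)
    · rw [mem_range] at hl
      have := hA ⟨l, by omega⟩ ⟨l, by omega⟩
      simp only at this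
      rw [this]
      exact bA _ _
    · rw [sum_const, card_range, nsmul_eq_mul]
      gcongr
  · rw [h₃, r14, zero_add, sum_range, Matrix.trace]
    exact sum_congr rfl fun l _ => hA l l

def addScalar : Cmd :=
  .loop 11 (.reg 2 * .reg 2) (.put 7 (.reg 11) (.get 8 (.reg 11) + .reg 19 * diagonal))

theorem tri_addScalar {A : Matrix (Fin m) (Fin m) ℤ} {c : ℤ} {st : St} (h2 : st.reg 2 = m)
    (h19 : st.reg 19 = c) (hA : Holds 8 A st) (hLm : m * m < 2 ^ L)
    (hL : ∀ u v, |(A + c • (1 : Matrix (Fin m) (Fin m) ℤ)) u v| < 2 ^ L) :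
    Tri L ω addScalar st (1 + m * m * 2) (Holds 7 (A + c • (1 : Matrix (Fin m) (Fin m) ℤ))) := by
  have key : ∀ u v : Fin m, st.arr 8 (u * m + v) +
      c * (if (u * m + v : ℕ) / m = (u * m + v : ℕ) % m then 1 else 0)
      = (A + c • (1 : Matrix (Fin m) (Fin m) ℤ)) u v := fun u v => by
    rw [index_div _ v.2, index_mod _ v.2, hA, Matrix.add_apply, Matrix.smul_apply,
      Matrix.one_apply, smul_eq_mul]
    simp only [Fin.ext_iff]
  refine (Tri.fill (m * m) (fun q => st.arr 8 q + c * (if q / m = q % m then 1 else 0))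
    (by simp [h2]) hLm.le (fun q _ s' h1 h4 h3 _ _ => ?_) fun q hq => ?_).conseq
    fun s' _ h' u v => ?_
  · rw [eval_add, eval_mul, eval_diagonal ((h1 2 (by decide)).trans h2) h3,
      eval_get_nat (i := q) (by simpa using h3), h4 8 (by decide), eval_reg, h1 19 (by decide), h19]
  · obtain ⟨hu, hv⟩ := div_lt_and_mod_lt hq
    have := key ⟨q / m, hu⟩ ⟨q % m, hv⟩
    simp only [Nat.div_add_mod'] at this
    rw [this]
    exact hL _ _
  · rw [h'.1 _ (index_lt u.2 v.2)]
    exact key u v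

def charStep : Cmd :=
  .seq product (.seq trace (.seq (.set 19 ((0 - .reg 14) / (.reg 20 + 1))) addScalar))

def charCoeff : Cmd :=
  .seq identity (.seq (.set 19 1) (.loop 20 (.reg 2) charStep))

theorem tri_charCoeff {A : Matrix (Fin m) (Fin m) ℤ} {α : ℤ} {st : St} (h2 : st.reg 2 = m)
    (hA : Holds 6 A st) (hα : 1 ≤ α) (bA : ∀ u v, |A u v| ≤ α) (hLm : m * m < 2 ^ L)
    (hL0 : 0 < L) (hL : (2 * (m + 1) ^ 2 * α) ^ m < 2 ^ L) :
    Tri L ω charCoeff st ((1 + m * m * 2) + (1 + (1 + m * (1 +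
      ((1 + m * m * (1 + (1 + ((1 + m * 2) + 1)))) + ((1 + (1 + m * 2)) + (1 + (1 + m * m * 2))))))))
      fun s' => s'.reg 19 = (-1) ^ m * A.det := by
  set Q : ℤ := 2 * (m + 1) ^ 2 * α with hQ
  have hm1 : (1 : ℤ) ≤ (m + 1) ^ 2 := one_le_pow₀ (by omega)
  have hQ1 : 1 ≤ Q := by nlinarith
  have hL1 : (1 : ℤ) < 2 ^ L := one_lt_pow₀ (by norm_num) hL0.ne'
  have bst := abs_state_le A hα bA
  simp only [← hQ] at bst
  rw [← state_snd]
  refine Tri.seq (tri_identity h2 hLm hL0) fun s₁ S₁ h₁ => ?_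
  have e2 : Tri L ω (.set 19 1) s₁ 1 (· = s₁.setReg 19 1) :=
    Tri.set 1 (by simp) (by simpa using hL1) rfl
  refine Tri.seq e2 fun s₂ S₂ hs₂ => ?_
  have r2 : s₂.reg 2 = m := (S₂.reg 2 (by decide)).trans ((S₁.reg 2 (by decide)).trans h2)
  have hA₂ : Holds 6 A s₂ := (hA.congr (S₁.arr 6 (by decide))).congr (S₂.arr 6 (by decide))
  refine (Tri.loop (e := .reg 2) (fun i s' => Holds 7 (state A i).1 s' ∧ s'.reg 19 = (state A i).2)
    m _ r2 (by nlinarith) ⟨h₁.congr (S₂.arr 7 (by decide)), by subst hs₂; simp [state]⟩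
    (fun i s z h => ⟨h.1, by simpa using h.2⟩) fun k hk s₃ S₃ x₃ h₃ => ?_).conseq
    fun s' _ h' => h'.2
  have r3 : s₃.reg 2 = m := (S₃.reg 2 (by decide)).trans r2
  have hQk : 0 ≤ Q ^ k := by positivity
  have hQk1 : Q ^ (k + 1) < 2 ^ L := (pow_le_pow_right₀ hQ1 hk).trans_lt hL
  -- Every partial sum in the product and in the trace stays below the next power of `Q`.
  have hmm : (m : ℤ) * (m * (α * Q ^ k)) ≤ Q ^ (k + 1) := by
    rw [pow_succ', hQ]
    have : (0 : ℤ) ≤ α * Q ^ k := by positivity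
    have h2 : (m : ℤ) * m ≤ 2 * (m + 1) ^ 2 := by nlinarith
    calc (m : ℤ) * (m * (α * Q ^ k)) = (m * m) * (α * Q ^ k) := by ring
      _ ≤ (2 * (m + 1) ^ 2) * (α * Q ^ k) := by gcongr
      _ = _ := by ring
  have hm0 : (1 : ℤ) ≤ m := by exact_mod_cast (by omega : 1 ≤ m)
  have hαQ : 0 ≤ α * Q ^ k := by positivity
  have hmαQ : (m : ℤ) * (α * Q ^ k) ≤ m * (m * (α * Q ^ k)) := by
    have : 0 ≤ (m : ℤ) * (α * Q ^ k) := by positivity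
    nlinarith
  refine Tri.seq (tri_product r3 (hA₂.congr (S₃.arr 6 (by decide))) h₃.1 bA (bst k).1 (by omega)
    hQk hLm (by omega)) fun s₄ S₄ h₄ => ?_
  have r4 : s₄.reg 2 = m := (S₄.reg 2 (by decide)).trans r3
  have bT := abs_mul_le bA (bst k).1
  refine Tri.seq (tri_trace r4 h₄ bT (by positivity) hLm (by omega)) fun s₅ S₅ h₅ => ?_
  have r5 : s₅.reg 2 = m := (S₅.reg 2 (by decide)).trans r4
  have x₅ : s₅.reg 20 = k := (S₅.reg 20 (by decide)).trans ((S₄.reg 20 (by decide)).trans x₃)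
  have e6 : Tri L ω (.set 19 ((0 - .reg 14) / (.reg 20 + 1))) s₅ 1
      (· = s₅.setReg 19 (state A (k + 1)).2) :=
    Tri.set _ (by simp [x₅, h₅, state]) ((bst (k + 1)).2.trans_lt hQk1) rfl
  refine Tri.seq e6 fun s₆ S₆ hs₆ => ?_
  have h19 : s₆.reg 19 = (state A (k + 1)).2 := by subst hs₆; simp
  refine (tri_addScalar ((S₆.reg 2 (by decide)).trans r5) h19
    ((h₄.congr (S₅.arr 8 (by decide))).congr (S₆.arr 8 (by decide))) hLm
    fun u v => ((bst (k + 1)).1 u v).trans_lt hQk1).conseq fun s₇ S₇ h₇ => ⟨h₇, ?_⟩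
  rw [S₇.reg 19 (by decide), h19]

def fillMatrix : Cmd :=
  .loop 11 (.reg 2 * .reg 2) (.put 6 (.reg 11) (.get 5 (.reg 11 * .reg 4 + .reg 10) *
    .get 5 ((.reg 11 % .reg 2 * .reg 2 + .reg 11 / .reg 2) * .reg 4 + .reg 10)))

def sumDets : Cmd :=
  .loop 10 (.reg 4) (.seq fillMatrix (.seq charCoeff
    (.set 18 (.reg 18 + .reg 19 * (1 - 2 * (.reg 2 % 2))))))

variable {h : ℕ → ℕ → Prop} {w s : ℕ} {a : ℕ → ℕ → ℤ} {b : ℕ → ℕ → ℕ → ℤ}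

theorem tri_fillMatrix {st : St} {S : ℕ} (h2 : st.reg 2 = m) (h4 : st.reg 4 = (2 ^ w : ℕ))
    (h10 : st.reg 10 = S) (hS : S < 2 ^ w) (hT : Table h w m a b (2 ^ w) st)
    (hLm : m * m < 2 ^ L) (hL : ∀ u v, |wtMatrix h m a b (bits S) u v| < 2 ^ L) :
    Tri L ω fillMatrix st (1 + m * m * 2) (Holds 6 (wtMatrix h m a b (bits S))) := by
  set F : ℕ → ℤ := fun q => wt h a b (bits S) (q / m) (q % m) * wt h a b (bits S) (q % m) (q / m)
    with hF
  refine (Tri.fill (m * m) F (by simp [h2]) hLm.le (fun q hq s' h1 h5 h3 _ _ => ?_)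
    fun q hq => ?_).conseq fun s' _ h' u v => ?_
  · obtain ⟨hu, hv⟩ := div_lt_and_mod_lt hq
    have r2 := (h1 2 (by decide)).trans h2
    have r4 := (h1 4 (by decide)).trans h4
    have r10 := (h1 10 (by decide)).trans h10
    have := hT (q % m * m + q / m) (index_lt hv hu) S hS
    rw [index_div _ hu, index_mod _ hu] at this
    rw [eval_mul, eval_get_nat (i := q * 2 ^ w + S) (by simp [r4, r10, h3]),
      eval_get_nat (i := (q % m * m + q / m) * 2 ^ w + S) (by simp [r2, r4, r10, h3]),
      h5 5 (by decide), hT q hq S hS, this]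
  · obtain ⟨hu, hv⟩ := div_lt_and_mod_lt hq
    exact hL ⟨q / m, hu⟩ ⟨q % m, hv⟩
  · rw [h'.1 _ (index_lt u.2 v.2)]
    simp only [hF, index_div _ v.2, index_mod _ v.2]
    rfl

theorem tri_sumDets {α : ℤ} {st : St} (H : Setup h n w m s st) (h18 : st.reg 18 = 0)
    (hT : Table h w m a b (2 ^ w) st) (hLm : m * m < 2 ^ L) (hLw : 2 ^ w < 2 ^ L) (hα : 1 ≤ α)
    (bA : ∀ s ⊆ range w, ∀ u v : Fin m, |wtMatrix h m a b s u v| ≤ α) (hLα : α < 2 ^ L)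
    (hL : 2 ^ w * (2 * (m + 1) ^ 2 * α) ^ m < 2 ^ L) :
    Tri L ω sumDets st (1 + 2 ^ w * (1 + ((1 + m * m * 2) + (((1 + m * m * 2) + (1 + (1 + m * (1 +
      ((1 + m * m * (1 + (1 + ((1 + m * 2) + 1)))) + ((1 + (1 + m * 2)) +
        (1 + (1 + m * m * 2)))))))) + 1))))
      fun s' => s'.reg 18 = detSum h w m a b := by
  set Q : ℤ := 2 * (m + 1) ^ 2 * α with hQ
  have hm1 : (1 : ℤ) ≤ (m + 1) ^ 2 := one_le_pow₀ (by omega)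
  have hQ1 : 1 ≤ Q := by nlinarith
  have hQm : 1 ≤ Q ^ m := one_le_pow₀ hQ1
  have h2w : (1 : ℤ) ≤ 2 ^ w := one_le_pow₀ (by norm_num)
  have hL0 : 0 < L := by
    rcases Nat.eq_zero_or_pos L with rfl | h
    · have := Nat.one_le_two_pow (n := w); omega
    · exact h
  -- The determinant is, up to sign, the last coefficient of the recursion, so it inherits that
  -- bound.
  have bdet : ∀ s ⊆ range w, |(wtMatrix h m a b s).det| ≤ Q ^ m := fun s hs => by
    have := (abs_state_le _ hα (bA s hs) m).2
    rwa [state_snd, abs_mul, abs_pow, abs_neg, abs_one, one_pow, one_mul] at this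
  refine (Tri.loop (e := .reg 4) (fun i s' => s'.reg 18
      = ∑ S ∈ range i, (wtMatrix h m a b (bits S)).det) (2 ^ w) _ H.W_eq hLw.le (by simp [h18])
    (fun i s z h => by simpa using h) fun S hS s₁ S₁ x₁ h₁ => ?_).conseq fun s' _ h' => ?_
  · have H₁ := H.same S₁ (by decide) (by decide)
    have hT₁ : Table h w m a b (2 ^ w) s₁ := by
      unfold Table; rw [S₁.arr 5 (by decide)]; exact hT
    have hbS := bits_subset.2 hS
    refine Tri.seq (tri_fillMatrix H₁.m_eq H₁.W_eq x₁ hS hT₁ hLm fun u v =>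
      (bA _ hbS u v).trans_lt hLα) fun s₂ S₂ h₂ => ?_
    have H₂ := H₁.same S₂ (by decide) (by decide)
    refine Tri.seq (tri_charCoeff H₂.m_eq h₂ hα (bA _ hbS) hLm hL0 (by nlinarith))
      fun s₃ S₃ h₃ => ?_
    have H₃ := H₂.same S₃ (by decide) (by decide)
    have r18 : s₃.reg 18 = ∑ S ∈ range S, (wtMatrix h m a b (bits S)).det := by
      rw [S₃.reg 18 (by decide), S₂.reg 18 (by decide), h₁]
    -- Undoes the sign between the constant coefficient of the characteristic polynomial and the
    -- determinant.
    have hsign : (-1 : ℤ) ^ m * (1 - 2 * ((m : ℤ) % 2)) = 1 := by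
      rcases Nat.even_or_odd m with hm | hm
      · have : (m : ℤ) % 2 = 0 := by exact_mod_cast Nat.even_iff.1 hm
        rw [hm.neg_one_pow, this]; norm_num
      · have : (m : ℤ) % 2 = 1 := by exact_mod_cast Nat.odd_iff.1 hm
        rw [hm.neg_one_pow, this]; norm_num
    refine Tri.set (∑ S ∈ range (S + 1), (wtMatrix h m a b (bits S)).det) ?_ ?_ (by simp)
    · simp only [eval_add, eval_mul, eval_sub, eval_mod, eval_reg, eval_one, eval_ofNat, r18, h₃,
        H₃.m_eq, sum_range_succ]
      congr 1
      rw [mul_right_comm, mul_comm, hsign, mul_one]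
    · refine lt_of_le_of_lt ((abs_sum_le_sum_abs _ _).trans (sum_le_sum (g := fun _ => Q ^ m)
        fun S' hS' => bdet _ (bits_subset.2 ?_))) (lt_of_le_of_lt ?_ hL)
      · rw [mem_range] at hS'; omega
      · rw [sum_const, card_range, nsmul_eq_mul]
        gcongr
        exact_mod_cast hS
  · rw [h']
    exact sum_range_two_pow w fun s => (wtMatrix h m a b s).det

end DualColoring

/-! The randomized part of the algorithm. -/

namespace StructuredRAM

/-- Allows the deterministic part to be analysed with one fixed coin sequence, so that the sizes it
computes do not depend on the coins. -/
theorem coinFree_congr {L : ℕ} (ω ω' : ℕ → Bool) {c : Cmd} (hc : c.coinFree = true) (s : St) :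
    c.run ω s = c.run ω' s ∧ c.steps ω s = c.steps ω' s ∧ (c.Safe L ω s ↔ c.Safe L ω' s) := by
  induction c generalizing s with
  | skip | set | put => exact ⟨rfl, rfl, Iff.rfl⟩
  | flip => simp [Cmd.coinFree] at hc
  | seq p q ihp ihq =>
    simp only [Cmd.coinFree, Bool.and_eq_true] at hc
    obtain ⟨h1, h2, h3⟩ := ihp hc.1 s
    obtain ⟨h4, h5, h6⟩ := ihq hc.2 (p.run ω' s)
    simp only [Cmd.run, Cmd.steps, Cmd.Safe, h1, h2, h3, h4, h5, h6, and_self]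
  | ite e p q ihp ihq =>
    simp only [Cmd.coinFree, Bool.and_eq_true] at hc
    obtain ⟨h1, h2, h3⟩ := ihp hc.1 s
    obtain ⟨h4, h5, h6⟩ := ihq hc.2 s
    simp only [Cmd.run, Cmd.steps, Cmd.Safe, h1, h2, h3, h4, h5, h6, and_self]
  | loop x e p ih =>
    simp only [Cmd.coinFree] at hc
    have h1 : (fun (i : ℕ) (s : St) => p.run ω (s.setReg x i)) = fun i s => p.run ω' (s.setReg x i) := by
      funext i s; exact (ih hc _).1
    simp only [Cmd.run, Cmd.steps, Cmd.Safe, h1, (ih hc _).2.1, (ih hc _).2.2, and_self]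

/-- A deterministic program ends in the same state for all coin tosses. -/
theorem Tri.congr_coins {L T : ℕ} {ω : ℕ → Bool} {c : Cmd} {s : St} {Q : St → Prop}
    (h : Tri L ω c s T Q) (hc : c.coinFree = true) (ω' : ℕ → Bool) :
    Tri L ω' c s T (· = c.run ω s) := by
  obtain ⟨h1, h2, h3⟩ := coinFree_congr (L := L) ω ω' hc s
  exact ⟨h3.1 h.1, h2 ▸ h.2.1, h1.symm⟩

end StructuredRAM

namespace DualColoring

open StructuredRAM CliqueCover Finset

variable {L : ℕ} {ω : ℕ → Bool}

def oddDigit : Cmd :=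
  .seq (.set 23 0) (.seq (.loop 10 (2 * .reg 2 * (.reg 3 + 1) * .reg 5 + 1)
    (.seq (.ite (.reg 18 % 2) (.set 23 1) .skip) (.set 18 ((.reg 18 + .reg 7) / .reg 6))))
    (.set 0 (.reg 23)))

/-- The interval `[-M, M]` is mapped into itself, so removing digits never leads to larger numbers.
-/
theorem abs_balanced_div_le {x β M : ℤ} (hβ : 1 ≤ β) (hM : β ≤ M) (hx : |x| ≤ M) :
    |(x + β) / (2 * β)| ≤ M := by
  rw [abs_le] at hx ⊢
  constructor
  · rw [Int.le_ediv_iff_mul_le (by omega)]; nlinarith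
  · refine Int.ediv_le_of_le_mul (by omega) ?_
    nlinarith

theorem tri_oddDigit {n w m s : ℕ} {β D M : ℤ} {st : St} (H : Sizes n w m s st)
    (h6 : st.reg 6 = 2 * β) (h7 : st.reg 7 = β) (h18 : st.reg 18 = D) (hβ : 1 ≤ β) (hM : β ≤ M)
    (hD : |D| ≤ M) (hL : M < 2 ^ L) (hK : 2 * m * (w + 1) * s + 1 ≤ 2 ^ L) :
    Tri L ω oddDigit st (1 + ((1 + (2 * m * (w + 1) * s + 1) * (1 + ((1 + 1) + 1))) + 1)) fun s' =>
      (s'.reg 0 ≠ 0 ↔ ∃ i < 2 * m * (w + 1) * s + 1, digits β D i % 2 ≠ 0) := by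
  set K := 2 * m * (w + 1) * s + 1 with hKdef
  have hL1 : (1 : ℤ) < 2 ^ L := by omega
  have bd : ∀ i, |digits β D i| ≤ M := fun i => by
    induction i with
    | zero => exact hD
    | succ i ih => exact abs_balanced_div_le hβ hM ih
  have e1 : Tri L ω (.set 23 0) st 1 (· = st.setReg 23 0) := Tri.set 0 (by simp) (by simp) rfl
  refine Tri.seq e1 fun s₁ S₁ hs₁ => ?_
  have H₁ := H.congr (S₁.regs (by decide))
  refine Tri.seq (Q' := fun s' => (s'.reg 23 = 0 ∨ s'.reg 23 = 1) ∧
      (s'.reg 23 ≠ 0 ↔ ∃ i < K, digits β D i % 2 ≠ 0)) ?_ fun s₂ _ h₂ => ?_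
  · refine (Tri.loop (fun i s' => s'.reg 18 = digits β D i ∧ (s'.reg 23 = 0 ∨ s'.reg 23 = 1) ∧
      (s'.reg 23 ≠ 0 ↔ ∃ j < i, digits β D j % 2 ≠ 0)) K _
      (by simp [H₁.m_eq, H₁.w_eq, H₁.s_eq, hKdef]) hK ?_ (fun i s z h => by simpa using h)
      fun i hi s₂ S₂ x₂ h₂ => ?_).conseq fun s' _ h' => h'.2
    · subst hs₁; simp [h18, digits]
    · obtain ⟨g1, g2, g3⟩ := h₂
      have r6 : s₂.reg 6 = 2 * β :=
        (S₂.reg 6 (by decide)).trans ((S₁.reg 6 (by decide)).trans h6)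
      have r7 : s₂.reg 7 = β := (S₂.reg 7 (by decide)).trans ((S₁.reg 7 (by decide)).trans h7)
      refine Tri.seq (Q' := fun s' => (s'.reg 23 = 0 ∨ s'.reg 23 = 1) ∧
        (s'.reg 23 ≠ 0 ↔ ∃ j < i + 1, digits β D j % 2 ≠ 0)) ?_ fun s₃ S₃ h₃ => ?_
      · refine Tri.ite (fun hne => ?_) fun hz => ?_
        · refine Tri.set 1 (by simp) (by simpa using hL1) ⟨by simp, ?_⟩
          simp only [eval_mod, eval_reg, eval_ofNat, g1] at hne
          simp only [setReg_reg, if_true, ne_eq, one_ne_zero, not_false_eq_true, true_iff]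
          exact ⟨i, by omega, hne⟩
        · refine Tri.skip ⟨g2, g3.trans ⟨fun ⟨j, hj, e⟩ => ⟨j, by omega, e⟩, fun ⟨j, hj, e⟩ => ?_⟩⟩
          simp only [eval_mod, eval_reg, eval_ofNat, g1] at hz
          rcases Nat.lt_succ_iff_lt_or_eq.1 hj with hj | rfl
          · exact ⟨j, hj, e⟩
          · exact absurd hz e
      · refine Tri.set (digits β D (i + 1)) ?_ ((bd _).trans_lt hL) (by simpa using h₃)
        simp [S₃.reg 18 (by decide), S₃.reg 7 (by decide), S₃.reg 6 (by decide), g1, r6, r7, digits]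
  · refine Tri.set (s₂.reg 23) (by simp) ?_ (by simpa using h₂.2)
    rcases h₂.1 with h | h <;> rw [h] <;> simp [hL1]

def randomized : Cmd := .seq drawWeights (.seq tables (.seq sumDets oddDigit))

/-- The number of steps of the randomized part. -/
def randomizedSteps (w m s : ℕ) : ℕ :=
  (1 + m * m * (w + 1) * (1 + ((1 + (1 + s * (1 + 2))) + (1 + (1 + (1 + (1 + 1))))))) +
  (((1 + m * m * (1 + 1)) + (1 + w * (1 + (1 + 2 ^ w * (1 +
    ((1 + (1 + w * 2)) + (1 + m * m * (1 + 1)))))))) +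
  ((1 + 2 ^ w * (1 + ((1 + m * m * 2) + (((1 + m * m * 2) + (1 + (1 + m * (1 +
    ((1 + m * m * (1 + (1 + ((1 + m * 2) + 1)))) + ((1 + (1 + m * 2)) +
      (1 + (1 + m * m * 2)))))))) + 1)))) +
  (1 + ((1 + (2 * m * (w + 1) * s + 1) * (1 + ((1 + 1) + 1))) + 1))))

/-- A bound on the entries of the matrices. -/
def entryBound (w m s : ℕ) : ℕ := (2 * (2 * 2 ^ bigExp w m s) ^ s) ^ (2 * (w + 1))

/-- A bound on all numbers that occur. -/
def valueBound (w m s : ℕ) : ℕ := 2 ^ w * (2 * (m + 1) ^ 2 * entryBound w m s) ^ (m + 1)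

/-- The exponent `m + 1` in `valueBound`, where `m` would do for the determinants, makes it dominate
`entryBound` even for `m = 0`. -/
theorem bigExp_lt_valueBound (w m s : ℕ) (hs : 1 ≤ s) :
    2 ^ (bigExp w m s + 1) ≤ entryBound w m s ∧
      (2 * 2 ^ bigExp w m s) ^ s ≤ entryBound w m s ∧ entryBound w m s ≤ valueBound w m s := by
  set B := 2 * 2 ^ bigExp w m s with hB
  have hB1 : 1 ≤ B := by have := Nat.one_le_two_pow (n := bigExp w m s); omega
  have hρ : 1 ≤ B ^ s := Nat.one_le_pow _ _ hB1
  have h2 : B ^ s ≤ entryBound w m s := by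
    unfold entryBound
    calc B ^ s ≤ 2 * B ^ s := by omega
      _ ≤ _ := Nat.le_self_pow (by omega) _
  have hE : 1 ≤ entryBound w m s := hρ.trans h2
  refine ⟨?_, h2, ?_⟩
  · refine le_trans ?_ h2
    rw [pow_succ', ← hB]
    exact Nat.le_self_pow (by omega) _
  · unfold valueBound
    have h3 : entryBound w m s ≤ 2 * (m + 1) ^ 2 * entryBound w m s :=
      Nat.le_mul_of_pos_left _ (by positivity)
    calc entryBound w m s ≤ (2 * (m + 1) ^ 2 * entryBound w m s) ^ (m + 1) :=
        h3.trans (Nat.le_self_pow (by omega) _)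
      _ ≤ _ := Nat.le_mul_of_pos_left _ (by positivity)

open Polynomial in
-- The sizes form a chain: `B ^ s` bounds the weights, `E` the table and the matrix entries, `Q ^ m`
-- the determinants, and `2 ^ w * Q ^ m` their sum.
theorem tri_randomized {h : ℕ → ℕ → Prop} {n w m s : ℕ} {st : St} (H : Setup h n w m s st)
    (hpos : st.pos = 0) (h18 : st.reg 18 = 0) (hwn : w ≤ n) (hs : 1 ≤ s) (hLs : s < 2 ^ L)
    (hLN : m * m * (w + 1) < 2 ^ L) (hL : valueBound w m s < 2 ^ L) :
    Tri L ω randomized st (randomizedSteps w m s) fun s' => (s'.reg 0 ≠ 0 ↔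
      coverSum h n w m (rand (X : (ZMod 2)[X]) s (m * m * (w + 1)) ω) ≠ 0) := by
  obtain ⟨h1, h2, h3⟩ := bigExp_lt_valueBound w m s hs
  set β : ℕ := 2 ^ bigExp w m s with hβ
  set B : ℕ := 2 * β with hB
  set E := entryBound w m s with hE
  set Q : ℕ := 2 * (m + 1) ^ 2 * E with hQ
  have hβ1 : 1 ≤ β := Nat.one_le_two_pow
  have hρ1 : 1 ≤ B ^ s := Nat.one_le_pow _ _ (by omega)
  have hE1 : 1 ≤ E := hρ1.trans h2
  have hβE : β ≤ E := by rw [pow_succ] at h1; omega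
  have hQ1 : 1 ≤ Q := Nat.mul_pos (by positivity) hE1
  have hQm : Q ^ m ≤ Q ^ (m + 1) := Nat.pow_le_pow_right hQ1 (by omega)
  have hval : 2 ^ w * Q ^ m ≤ valueBound w m s := Nat.mul_le_mul_left _ hQm
  have hLw : 2 ^ w < 2 ^ L :=
    ((Nat.le_mul_of_pos_right _ (Nat.pos_of_ne_zero (by positivity))).trans hval).trans_lt hL
  have hLm : m * m < 2 ^ L := (Nat.le_mul_of_pos_right _ (by omega)).trans_lt hLN
  have hBB : ((B : ℕ) : ℤ) = 2 * 2 ^ bigExp w m s := by rw [hB, hβ]; push_cast; ring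
  set N := m * m * (w + 1) with hN
  set r := rand (B : ℤ) s N ω with hr
  set a := slotWeight h n w m r with ha
  set b := vertexWeight h n w m r with hb
  have hr1 : ∀ q, |r q| ≤ ((B ^ s : ℕ) : ℤ) := fun q => by
    rw [hr, rand]
    split_ifs
    · have := abs_horner_le (B := (B : ℤ)) (by omega) (fun j => ω (q * s + j)) s
      push_cast
      omega
    · simp
  have hz : |(0 : ℤ)| ≤ ((B ^ s : ℕ) : ℤ) := by simp
  have ha1 : ∀ u v, |a u v| ≤ ((B ^ s : ℕ) : ℤ) := fun u v => by
    rw [ha, slotWeight]; split_ifs <;> [exact hr1 _; exact hz]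
  have hb1 : ∀ u v x, |b u v x| ≤ ((B ^ s : ℕ) : ℤ) := fun u v x => by
    rw [hb, vertexWeight]; split_ifs <;> [exact hr1 _; exact hz]
  have hρ1' : (1 : ℤ) ≤ ((B ^ s : ℕ) : ℤ) := by exact_mod_cast hρ1
  have hEc : (E : ℤ) = (2 * ((B ^ s : ℕ) : ℤ)) ^ (2 * (w + 1)) := by
    rw [hE, entryBound]; push_cast; rfl
  have hwt : ∀ s' ⊆ range w, ∀ u v, |wt h a b s' u v| ≤ (E : ℤ) := fun s' hs' u v => by
    refine (gauge_int.wt h hρ1' hs' (ha1 u v) fun x _ => hb1 u v x).trans ?_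
    rw [hEc]
    exact pow_le_pow_right₀ (by omega) (by omega)
  have hmat : ∀ s' ⊆ range w, ∀ u v : Fin m, |wtMatrix h m a b s' u v| ≤ (E : ℤ) :=
    fun s' hs' u v => by
    rw [hEc]
    exact gauge_int.wtMatrix h hρ1' hs' (fun u _ v _ => ha1 u v) (fun u _ v _ x _ => hb1 u v x) u v
  have hLE : (E : ℤ) < 2 ^ L := by exact_mod_cast h3.trans_lt hL
  have hLQ : 2 ^ w * (2 * ((m : ℤ) + 1) ^ 2 * E) ^ m < 2 ^ L := by
    exact_mod_cast hval.trans_lt hL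
  refine Tri.seq (tri_drawWeights hBB H hpos hwn hLs hLN (by exact_mod_cast (h2.trans h3).trans_lt hL))
    fun s₁ S₁ h₁ => ?_
  have H₁ := H.same S₁ (by decide) (by decide)
  refine Tri.seq (tri_tables H₁ h₁ hwn hLm hLw fun q _ s' hs' => (hwt s' hs' _ _).trans_lt hLE)
    fun s₂ S₂ h₂ => ?_
  have H₂ := H₁.same S₂ (by decide) (by decide)
  refine Tri.seq (tri_sumDets H₂ ?_ h₂ hLm hLw (by exact_mod_cast hE1) hmat hLE hLQ)
    fun s₃ S₃ h₃ => ?_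
  · rw [S₂.reg 18 (by decide), S₁.reg 18 (by decide), h18]
  have H₃ := H₂.same S₃ (by decide) (by decide)
  have hD : |detSum h w m a b| ≤ ((valueBound w m s : ℕ) : ℤ) := by
    refine le_trans (b := ∑ s' ∈ (range w).powerset, ((Q ^ m : ℕ) : ℤ)) ?_ ?_
    · refine (abs_sum_le_sum_abs _ _).trans (sum_le_sum fun s' hs' => ?_)
      have := (FaddeevLeVerrier.abs_state_le _ (by exact_mod_cast hE1)
        (hmat s' (mem_powerset.1 hs')) m).2
      rw [FaddeevLeVerrier.state_snd, abs_mul, abs_pow, abs_neg, abs_one, one_pow, one_mul] at this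
      rw [hQ]; push_cast; exact this
    · rw [sum_const, card_powerset, card_range, nsmul_eq_mul]
      exact_mod_cast hval
  refine (tri_oddDigit (β := (β : ℤ)) H₃.toSizes ?_ ?_ h₃ (by exact_mod_cast hβ1)
    (by exact_mod_cast hβE.trans h3) hD (by exact_mod_cast hL) ?_).conseq fun s' _ h' => ?_
  · rw [H₃.B_eq, ← hBB, hB]; push_cast; ring
  · rw [H₃.β_eq, hβ]; push_cast; rfl
  · refine le_trans ?_ ((hβE.trans h3).trans hL.le)
    refine le_trans ?_ (Nat.lt_two_pow_self (n := bigExp w m s)).le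
    unfold bigExp
    have : 2 * m * (w + 1) * s = 2 * s * (w + 1) * m := by ring
    omega
  · rw [h', ← exists_digits_odd_coverSum_iff h n w m s N hs ω, ← hBB, hβ]
    push_cast
    rfl

end DualColoring

/-! Polynomial bounds. -/

namespace DualColoring

open CliqueCover

/-- `f` is bounded by a polynomial in `N`, times `g`. -/
def PolyBounded {ι : Type*} (N g f : ι → ℕ) : Prop :=
  ∃ A d : ℕ, ∀ i, f i ≤ A * (N i + 1) ^ d * g i

namespace PolyBounded

variable {ι : Type*} {N g f f' : ι → ℕ}

theorem const (a : ℕ) : PolyBounded N 1 fun _ => a := ⟨a, 0, fun i => by simp⟩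

theorem of_le (h : ∀ i, f i ≤ N i) : PolyBounded N 1 f :=
  ⟨1, 1, fun i => by have := h i; simp; omega⟩

theorem add (h : PolyBounded N g f) (h' : PolyBounded N g f') :
    PolyBounded N g fun i => f i + f' i := by
  obtain ⟨A, d, H⟩ := h
  obtain ⟨A', d', H'⟩ := h'
  refine ⟨A + A', d + d', fun i => (Nat.add_le_add (H i) (H' i)).trans ?_⟩
  have h1 : (N i + 1) ^ d ≤ (N i + 1) ^ (d + d') := Nat.pow_le_pow_right (by omega) (by omega)
  have h2 : (N i + 1) ^ d' ≤ (N i + 1) ^ (d + d') := Nat.pow_le_pow_right (by omega) (by omega)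
  rw [add_mul, add_mul]
  gcongr

theorem mul (h : PolyBounded N 1 f) (h' : PolyBounded N g f') :
    PolyBounded N g fun i => f i * f' i := by
  obtain ⟨A, d, H⟩ := h
  obtain ⟨A', d', H'⟩ := h'
  refine ⟨A * A', d + d', fun i => (Nat.mul_le_mul (H i) (H' i)).trans (le_of_eq ?_)⟩
  simp only [Pi.one_apply, mul_one]
  ring

theorem weight (h : PolyBounded N 1 f) : PolyBounded N g fun i => g i * f i := by
  obtain ⟨A, d, H⟩ := h
  refine ⟨A, d, fun i => ?_⟩
  rw [mul_comm (A * _)]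
  exact Nat.mul_le_mul_left _ (by simpa using H i)

theorem of_one (hg : ∀ i, 1 ≤ g i) (h : PolyBounded N 1 f) : PolyBounded N g f := by
  obtain ⟨A, d, H⟩ := h
  exact ⟨A, d, fun i => (H i).trans (Nat.mul_le_mul_left _ (hg i))⟩

end PolyBounded

/-- The sizes that occur for graphs with `n` vertices. -/
structure Shape where
  n : ℕ
  w : ℕ
  m : ℕ
  hw : w ≤ n
  hm : m ≤ n

/-- The bit length of the numbers that occur. -/
def bitBound (c n w m : ℕ) : ℕ :=
  w + (1 + 2 * m + (1 + (bigExp w m ((c + 3) * (n + 2)) + 1) * ((c + 3) * (n + 2))) *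
    (2 * (w + 1))) * (m + 1) + (c + 3) * (n + 2) + m * m * (w + 1) + n * n + n + 3
    + bigExp w m ((c + 3) * (n + 2)) + 2

theorem valueBound_le (w m s : ℕ) : valueBound w m s ≤
    2 ^ (w + (1 + 2 * m + (1 + (bigExp w m s + 1) * s) * (2 * (w + 1))) * (m + 1)) := by
  have h1 : entryBound w m s = 2 ^ ((1 + (bigExp w m s + 1) * s) * (2 * (w + 1))) := by
    unfold entryBound
    rw [← pow_succ', ← pow_mul, ← pow_succ', ← pow_mul]
    congr 1; ring
  have h2 : 2 * (m + 1) ^ 2 ≤ 2 ^ (1 + 2 * m) := by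
    rw [pow_add, pow_one, mul_comm 2 m, pow_mul]
    gcongr
    exact Nat.lt_two_pow_self
  unfold valueBound
  rw [h1, pow_add 2 w, pow_mul 2 _ (m + 1), pow_add 2 (1 + 2 * m)]
  gcongr

variable {c n w m : ℕ}

theorem valueBound_lt : valueBound w m ((c + 3) * (n + 2)) < 2 ^ bitBound c n w m := by
  refine (valueBound_le _ _ _).trans_lt (Nat.pow_lt_pow_right (by norm_num) ?_)
  unfold bitBound
  omega

theorem lt_two_pow_bitBound {x : ℕ} (hx : x ≤ bitBound c n w m) : x < 2 ^ bitBound c n w m :=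
  hx.trans_lt Nat.lt_two_pow_self

open PolyBounded in
theorem polyBounded_bitBound (c : ℕ) :
    PolyBounded Shape.n 1 fun i : Shape => bitBound c i.n i.w i.m := by
  unfold bitBound bigExp
  have hn : PolyBounded Shape.n 1 fun i : Shape => i.n := of_le fun i => le_rfl
  have hw : PolyBounded Shape.n 1 fun i : Shape => i.w := of_le fun i => i.hw
  have hm : PolyBounded Shape.n 1 fun i : Shape => i.m := of_le fun i => i.hm
  repeat' with_reducible first | exact hn | exact hw | exact hm | exact const _ | apply add | apply mul

/-- The number of steps before the randomized part. -/
def deterministicSteps (c n w m : ℕ) : ℕ :=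
  (1 + n * (1 + (1 + n * (1 + (1 + n * (1 + 10)))))) +
  (5 + ((1 + n * (1 + 4)) + ((1 + (1 + w * (1 + 2))) +
      ((1 + ((1 + bigExp w m ((c + 3) * (n + 2)) * (1 + 1)) + 1)) + (1 + n * n * 2)))))

open PolyBounded in
theorem polyBounded_deterministicSteps (c : ℕ) :
    PolyBounded Shape.n 1 fun i : Shape => deterministicSteps c i.n i.w i.m := by
  unfold deterministicSteps bigExp
  have hn : PolyBounded Shape.n 1 fun i : Shape => i.n := of_le fun i => le_rfl
  have hw : PolyBounded Shape.n 1 fun i : Shape => i.w := of_le fun i => i.hw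
  have hm : PolyBounded Shape.n 1 fun i : Shape => i.m := of_le fun i => i.hm
  repeat' with_reducible first | exact hn | exact hw | exact hm | exact const _ | apply add | apply mul

open PolyBounded in
-- Only the table and the sum of determinants carry the factor `2 ^ w`, and each only once.
theorem polyBounded_randomizedSteps (c : ℕ) :
    PolyBounded Shape.n (fun i => 2 ^ i.w)
      fun i : Shape => randomizedSteps i.w i.m ((c + 3) * (i.n + 2)) := by
  unfold randomizedSteps
  have hn : PolyBounded Shape.n 1 fun i : Shape => i.n := of_le fun i => le_rfl
  have hw : PolyBounded Shape.n 1 fun i : Shape => i.w := of_le fun i => i.hw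
  have hm : PolyBounded Shape.n 1 fun i : Shape => i.m := of_le fun i => i.hm
  have h1 : ∀ i : Shape, 1 ≤ 2 ^ i.w := fun i => Nat.one_le_two_pow
  have h2 : PolyBounded Shape.n (fun i : Shape => 2 ^ i.w) fun _ => 1 := of_one h1 (const 1)
  refine add (of_one h1 ?_) (add (add (of_one h1 ?_) (add h2 (mul hw (add h2 (add h2 (weight ?_))))))
    (add (add h2 (weight ?_)) (of_one h1 ?_)))
  all_goals
    repeat' with_reducible first | exact hn | exact hw | exact hm | exact const _ | apply add | apply mul

end DualColoring

/-! The algorithm and its correctness. -/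

namespace DualColoring

open StructuredRAM CliqueCover

variable {n : ℕ}

/-- Two distinct vertices that are not adjacent. -/
def compl (G : SimpleGraph (Fin n)) (a b : ℕ) : Prop :=
  ∃ (ha : a < n) (hb : b < n), a ≠ b ∧ ¬ G.Adj ⟨a, ha⟩ ⟨b, hb⟩

theorem compl_irrefl (G : SimpleGraph (Fin n)) (a : ℕ) : ¬ compl G a a := fun ⟨_, _, h, _⟩ => h rfl

theorem compl_symm {G : SimpleGraph (Fin n)} {a b : ℕ} (h : compl G a b) : compl G b a := by
  obtain ⟨ha, hb, h1, h2⟩ := h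
  exact ⟨hb, ha, h1.symm, fun h => h2 h.symm⟩

theorem colorable_iff_coverable (G : SimpleGraph (Fin n)) (m : ℕ) :
    G.Colorable m ↔ Coverable (compl G) n m := by
  constructor
  · rintro ⟨C⟩
    refine ⟨fun i => if h : i < n then C ⟨i, h⟩ else 0, fun i hi => ?_, fun i hi j hj hij e => ?_⟩
    · simp [hi]
    · simp only [hi, hj, dif_pos] at e
      refine ⟨hi, hj, hij, fun hadj => C.valid hadj (Fin.ext e)⟩
  · rintro ⟨f, h1, h2⟩
    refine ⟨SimpleGraph.Coloring.mk (fun v => ⟨f v, h1 v v.2⟩) fun {v w} hadj e => ?_⟩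
    have hne : (v : ℕ) ≠ w := fun h => hadj.ne (Fin.ext h)
    obtain ⟨_, _, _, h⟩ := h2 v v.2 w w.2 hne (Fin.ext_iff.1 e)
    exact h hadj

theorem coverable_relabel {H : ℕ → ℕ → Prop} {V : ℕ → ℕ} {m : ℕ} (lt : ∀ i < n, V i < n)
    (inj : ∀ i < n, ∀ j < n, V i = V j → i = j) :
    Coverable (fun a b => H (V a) (V b)) n m ↔ Coverable H n m := by
  constructor
  · rintro ⟨f, h1, h2⟩
    have himg : (Finset.range n).image V = Finset.range n := by
      refine Finset.eq_of_subset_of_card_le (fun v hv => ?_) ?_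
      · obtain ⟨i, hi, rfl⟩ := Finset.mem_image.1 hv
        simpa using lt i (by simpa using hi)
      · rw [Finset.card_image_of_injOn]
        exact fun i hi j hj e => inj i (by simpa using hi) j (by simpa using hj) e
    have hsurj : ∀ v < n, ∃ i < n, V i = v := fun v hv => by
      have : v ∈ (Finset.range n).image V := by rw [himg]; simpa using hv
      simpa using this
    choose! g hg hVg using hsurj
    refine ⟨fun v => f (g v), fun v hv => h1 _ (hg v hv), fun v hv u hu hvu e => ?_⟩
    have := h2 (g v) (hg v hv) (g u) (hg u hu)
      (fun e => hvu (by rw [← hVg v hv, e, hVg u hu])) e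
    simp only [hVg v hv, hVg u hu] at this
    exact this
  · rintro ⟨f, h1, h2⟩
    exact ⟨fun i => f (V i), fun i hi => h1 _ (lt i hi), fun i hi j hj hij e =>
      h2 _ (lt i hi) _ (lt j hj) (fun e' => hij (inj i hi j hj e')) e⟩

/-- Disjoint triangles give a cover with few cliques. -/
theorem coverable_of_triangles {h : ℕ → ℕ → Prop} (hsymm : ∀ a b, h a b → h b a) {τ m : ℕ}
    (hτ : 3 * τ ≤ n) (hm : n ≤ m + 2 * τ)
    (tri : ∀ t < τ, h (3 * t) (3 * t + 1) ∧ h (3 * t) (3 * t + 2) ∧ h (3 * t + 1) (3 * t + 2)) :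
    Coverable h n m := by
  have key : ∀ i j, i < j → i < 3 * τ → j < 3 * τ → i / 3 = j / 3 → h i j := by
    intro i j hij hi hj e
    obtain ⟨t, ht⟩ : ∃ t, t = i / 3 := ⟨_, rfl⟩
    obtain ⟨h1, h2, h3⟩ := tri t (by omega)
    have hi' : i = 3 * t ∨ i = 3 * t + 1 := by omega
    have hj' : j = 3 * t + 1 ∨ j = 3 * t + 2 := by omega
    rcases hi' with rfl | rfl <;> rcases hj' with rfl | rfl
    · exact h1
    · exact h2
    · omega
    · exact h3
  refine ⟨fun i => if i < 3 * τ then i / 3 else i - 2 * τ, fun i hi => ?_,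
    fun i hi j hj hij e => ?_⟩
  · simp only; split_ifs <;> omega
  · simp only at e
    split_ifs at e with h1 h2 h2
    · rcases lt_or_gt_of_ne hij with hlt | hlt
      · exact key i j hlt h1 h2 e
      · exact hsymm _ _ (key j i hlt h2 h1 e.symm)
    · omega
    · omega
    · omega

/-- The initial state for the structured program. -/
noncomputable def start (G : SimpleGraph (Fin n)) (k : ℕ) : St where
  reg := (RAM.graphInput G k).reg
  arr a i := if a = 0 then (RAM.graphInput G k).mem i else 0
  pos := 0

theorem mem_neg (G : SimpleGraph (Fin n)) (k : ℕ) {a : ℤ} (ha : a < 0) :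
    (RAM.graphInput G k).mem a = 0 := by
  simp only [RAM.graphInput, ite_eq_right_iff, one_ne_zero, imp_false]
  rintro ⟨i, j, _, rfl⟩
  have : (0 : ℤ) ≤ (i : ℤ) * n + j := by positivity
  omega

theorem rep_start (G : SimpleGraph (Fin n)) (k : ℕ) : Rep (start G k) (RAM.graphInput G k) where
  reg x := by
    simp only [start, RAM.graphInput, rho]
    split_ifs <;> first | rfl | omega
  mem a i := by
    cases a with
    | zero => simp [addr, start]
    | succ a =>
      have : (0 : ℤ) < 2 ^ a * (2 * i + 1) := by positivity
      rw [addr, mem_neg G k (by omega)]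
      simp [start]
  pos := rfl

theorem bdd_start (G : SimpleGraph (Fin n)) (k : ℕ) {L : ℕ} (hn : n < 2 ^ L) (hk : k < 2 ^ L)
    (hL : 0 < L) : (start G k).Bdd L := by
  have hL1 : (1 : ℤ) < 2 ^ L := one_lt_pow₀ (by norm_num) hL.ne'
  refine ⟨fun x => ?_, fun a i => ?_⟩
  · simp only [start, RAM.graphInput]
    split_ifs
    · rw [Nat.abs_cast]; exact_mod_cast hn
    · rw [Nat.abs_cast]; exact_mod_cast hk
    · simp
  · simp only [start, RAM.graphInput]
    split_ifs <;> simp [hL1]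

theorem input_start (G : SimpleGraph (Fin n)) (k : ℕ) : Input (compl G) n (start G k) where
  size := by simp [start, RAM.graphInput]
  adj a ha b hb _ h := by
    simp only [start, if_true, RAM.graphInput, ite_eq_right_iff, one_ne_zero, imp_false]
    rintro ⟨i, j, hadj, e⟩
    obtain ⟨rfl, rfl⟩ := index_inj hb j.2 (by exact_mod_cast e)
    obtain ⟨_, _, _, h⟩ := h
    exact h hadj
  nonadj a ha b hb hab h := by
    simp only [start, if_true, RAM.graphInput, ite_eq_left_iff, zero_ne_one, imp_false, not_not]
    refine ⟨⟨a, ha⟩, ⟨b, hb⟩, ?_, by push_cast; rfl⟩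
    by_contra hadj
    exact h ⟨ha, hb, hab, hadj⟩

/-- For `w = max(3τ, k)`, the inequality `2w ≥ 3k` forces `2τ ≥ k`, in which case the packing itself
proves the answer yes. -/
def dualColoring (c : ℕ) : Cmd :=
  .ite ((Ex.reg 0).lt (.reg 1)) (.set 0 0)
    (.seq packTriangles (.seq (setup c)
      (.ite ((2 * Ex.reg 3).lt (3 * .reg 1)) randomized (.set 0 1))))

/-- The bound for the error probability. -/
theorem error_le {c n w m : ℕ} (hw : w ≤ n) (hm : m ≤ n) :
    ((2 * m * (w + 1) : ℕ) : ℝ) / 2 ^ ((c + 3) * (n + 2)) ≤ 1 / ((n : ℝ) + 2) ^ c := by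
  rw [div_le_div_iff₀ (by positivity) (by positivity), one_mul]
  have h : 2 * m * (w + 1) * (n + 2) ^ c ≤ 2 ^ ((c + 3) * (n + 2)) := by
    calc 2 * m * (w + 1) * (n + 2) ^ c ≤ (n + 2) * (n + 2) * (n + 2) * (n + 2) ^ c := by
          gcongr <;> omega
      _ = (n + 2) ^ (c + 3) := by ring
      _ ≤ (2 ^ (n + 2)) ^ (c + 3) := by gcongr; exact Nat.lt_two_pow_self.le
      _ = _ := by rw [← pow_mul]; ring_nf
  exact_mod_cast h

/-- The runs of the program: the time, and the probability of the right answer. -/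
structure Works (c : ℕ) (s : St) (L T : ℕ) (answer : Prop) (ε : ℝ) : Prop where
  halts : ∀ ω, ∃ Q : St → Prop, Tri L ω (dualColoring c) s T Q
  correct : ∃ E : Set (ℕ → Bool), 1 - ε ≤ RAM.coins.real E ∧
    ∀ ω ∈ E, Tri L ω (dualColoring c) s T fun s' => (s'.reg 0 ≠ 0 ↔ answer)

instance : IsProbabilityMeasure RAM.coins := by unfold RAM.coins; infer_instance

theorem Works.of_forall {c : ℕ} {s : St} {L T : ℕ} {answer : Prop} {ε : ℝ} (hε : 0 ≤ ε)
    (h : ∀ ω, Tri L ω (dualColoring c) s T fun s' => (s'.reg 0 ≠ 0 ↔ answer)) :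
    Works c s L T answer ε :=
  ⟨fun ω => ⟨_, h ω⟩, Set.univ, by simpa using hε, fun ω _ => h ω⟩

/-- The error is one-sided. Subadditivity on a set and its complement gives the lower bound without
any measurability. -/
theorem Works.of_randomized {c : ℕ} {s : St} {L T : ℕ} {answer : Prop} {ε : ℝ}
    {P : (ℕ → Bool) → Prop} (hε : 0 ≤ ε)
    (h : ∀ ω, Tri L ω (dualColoring c) s T fun s' => (s'.reg 0 ≠ 0 ↔ P ω))
    (h0 : ¬ answer → ∀ ω, ¬ P ω) (h1 : answer → RAM.coins.real {ω | ¬ P ω} ≤ ε) :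
    Works c s L T answer ε := by
  by_cases ha : answer
  · refine ⟨fun ω => ⟨_, h ω⟩, {ω | P ω}, ?_, fun ω hω => ?_⟩
    · have h2 := measureReal_union_le (μ := RAM.coins) {ω | P ω} {ω | ¬ P ω}
      have h3 : {ω | P ω} ∪ {ω | ¬ P ω} = Set.univ := Set.eq_univ_of_forall fun ω => em (P ω)
      rw [h3, probReal_univ] at h2
      linarith [h1 ha]
    · exact (h ω).conseq fun s' _ h' => h'.trans (iff_of_true hω ha)
  · exact Works.of_forall hε fun ω => (h ω).conseq fun s' _ h' =>
      h'.trans (iff_of_false (h0 ha ω) ha)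

theorem works_of_lt {c k L : ℕ} (G : SimpleGraph (Fin n)) (hk : n < k) {ε : ℝ} (hε : 0 ≤ ε) :
    Works c (start G k) L 2 (DualColorable G k) ε := by
  refine Works.of_forall hε fun ω => (Tri.ite (fun _ => ?_) fun h => ?_ : Tri L ω _ _ (1 + 1) _)
  · exact Tri.set 0 (by simp) (by simp) (by simp [DualColorable]; omega)
  · have e : ((Ex.reg 0).lt (.reg 1)).eval (start G k) = ltZ n k := by
      simp [start, RAM.graphInput]
    rw [e] at h
    exact absurd h (ltZ_ne_zero.2 (by exact_mod_cast hk))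

/-- For `k ≤ n` the time is polynomial, unless `2 ^ w` is small enough. -/
theorem exists_works (c k : ℕ) (G : SimpleGraph (Fin n)) (hk : k ≤ n) :
    ∃ w m T : ℕ, w ≤ n ∧ m ≤ n ∧
      (T = 2 + (deterministicSteps c n w m + 1) ∨ (2 * w ≤ 3 * k ∧ T = 2 + (deterministicSteps c n w m +
        randomizedSteps w m ((c + 3) * (n + 2))))) ∧
      Works c (start G k) (bitBound c n w m) T (DualColorable G k) (1 / ((n : ℝ) + 2) ^ c) := by
  have hε : (0 : ℝ) ≤ 1 / ((n : ℝ) + 2) ^ c := by positivity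
  have hin := input_start G k
  have e0 : ((Ex.reg 0).lt (.reg 1)).eval (start G k) = 0 := by
    have e : ((Ex.reg 0).lt (.reg 1)).eval (start G k) = ltZ n k := by
      simp [start, RAM.graphInput]
    rw [e, ltZ_of_le (by exact_mod_cast hk)]
  -- Reference coins for the deterministic part; `Tri.congr_coins` transfers its final state to all
  -- `ω`.
  set ω₀ : ℕ → Bool := fun _ => false
  have hpack : ∀ L, n + 3 < 2 ^ L → _ := fun L hL =>
    tri_packTriangles (L := L) (ω := ω₀) (compl_irrefl G) hL hin
      (by simp [start, RAM.graphInput]) (by simp [start])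
  obtain ⟨τ, V, hV, hhit⟩ := (hpack (n + 3) Nat.lt_two_pow_self).2.2
  have S₁ := same_run ω₀ packTriangles (start G k)
  set s₁ := packTriangles.run ω₀ (start G k)
  have hτ : 3 * τ ≤ n := le_of_inj hV.lt hV.inj
  obtain ⟨w, hw⟩ : ∃ w, w = max (3 * τ) k := ⟨_, rfl⟩
  obtain ⟨m, hm⟩ : ∃ m, m = n - k := ⟨_, rfl⟩
  obtain ⟨s, hs⟩ : ∃ s, s = (c + 3) * (n + 2) := ⟨_, rfl⟩
  set L := bitBound c n w m with hL
  have hLn : n + 3 < 2 ^ L := lt_two_pow_bitBound (by unfold bitBound; omega)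
  have hLs : s < 2 ^ L := lt_two_pow_bitBound (by unfold bitBound; omega)
  have hLN : m * m * (w + 1) < 2 ^ L := lt_two_pow_bitBound (by unfold bitBound; omega)
  have hLn2 : n * n < 2 ^ L := lt_two_pow_bitBound (by unfold bitBound; omega)
  have hLb : bigExp w m s + 1 < L := by rw [hL, hs]; unfold bitBound; omega
  have hLw : 2 ^ w < 2 ^ L :=
    Nat.pow_lt_pow_right (by norm_num) (by rw [hL]; unfold bitBound; omega)
  have hLv : valueBound w m s < 2 ^ L := by rw [hs]; exact valueBound_lt
  have r₁ : s₁.reg 1 = k := by rw [S₁.reg 1 (by decide)]; simp [start, RAM.graphInput]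
  have hsetup := tri_setup (ω := ω₀) (c := c) (compl_irrefl G)
    (hin.congr (S₁.reg 0 (by decide)) (S₁.arr 0 (by decide))) r₁ hV.toListing hk hw hm hs hLn hLs
    hLN hLw hLb hLn2
  obtain ⟨V', hV', hVV, H⟩ := hsetup.2.2
  have S₂ := same_run ω₀ (setup c) s₁
  set s₂ := (setup c).run ω₀ s₁
  have hsub : ∀ i < 3 * τ, V' i = V i := hVV
  set h : ℕ → ℕ → Prop := fun a b => compl G (V' a) (V' b) with hh
  have hans : DualColorable G k ↔ Coverable h n m := by
    rw [coverable_relabel hV'.lt hV'.inj, ← colorable_iff_coverable, hm]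
    exact and_iff_right hk
  have hsymm : ∀ a b, h a b → h b a := fun a b => compl_symm
  have hwn : w ≤ n := by omega
  have hmn : m ≤ n := by omega
  have r₂ : s₂.reg 1 = k := (S₂.reg 1 (by simp [setup, setSizes, appendRest, push, powers, base,
    reorder, Cmd.regs])).trans r₁
  have e1 : ((2 * Ex.reg 3).lt (3 * .reg 1)).eval s₂ = ltZ (2 * w : ℕ) (3 * k : ℕ) := by
    simp [H.w_eq, r₂]
  have run : ∀ {T : ℕ} {Q : (ℕ → Bool) → St → Prop},
      (∀ ω, Tri L ω (.ite ((2 * Ex.reg 3).lt (3 * .reg 1)) randomized (.set 0 1)) s₂ (1 + T)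
        (Q ω)) → ∀ ω, Tri L ω (dualColoring c) (start G k) (2 + (deterministicSteps c n w m + T))
          (Q ω) := by
    intro T Q hT ω
    have t₁ := Tri.seq (hsetup.congr_coins rfl ω) fun _ _ e => by
      subst e; exact hT ω
    have t₂ := Tri.seq ((hpack L hLn).congr_coins rfl ω) fun _ _ e => by
      subst e; exact t₁
    refine Tri.mono (Tri.ite (fun hne => absurd e0 hne) fun _ => t₂) ?_ fun _ _ h => h
    unfold deterministicSteps
    rw [← hs]
    omega
  by_cases hc : 2 * w < 3 * k
  · refine ⟨w, m, _, hwn, hmn, Or.inr ⟨hc.le, rfl⟩, ?_⟩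
    rw [← hs]
    refine Works.of_randomized hε (run fun ω => Tri.ite (fun _ => tri_randomized H ?_ ?_ hwn ?_ hLs
      hLN hLv) fun h0 => ?_) (fun hno ω => ?_) fun hyes => ?_
    · rw [S₂.pos rfl, S₁.pos rfl]; rfl
    · rw [S₂.reg 18 (by simp [setup, setSizes, appendRest, push, powers, base, reorder, Cmd.regs]),
        S₁.reg 18 (by decide)]
      simp [start, RAM.graphInput]
    · rw [hs]; exact Nat.mul_pos (by omega) (by omega)
    · exact absurd h0 (by rw [e1]; exact ltZ_ne_zero.2 (by exact_mod_cast hc))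
    · rw [not_not]
      exact coverSum_eq_zero hsymm (by omega) (fun h' => hno (hans.2 h')) _
    · simp only [not_not]
      -- Here `n ≤ w + m` because `k ≤ w`, and `0 < n` because `2w < 3k` excludes `k = 0`.
      refine (coins_coverSum_eq_zero_le s hwn (by omega) (by omega) (hans.1 hyes) ?_).trans
        (by rw [hs]; exact error_le hwn hmn)
      rintro i j l hi hij hjl hln ⟨g1, g2, g3⟩
      -- Positions from `w ≥ 3τ` on hold unpacked vertices; a triangle among them would contradict
      -- maximality.
      have hfar : ∀ x, w ≤ x → x < n → s₁.arr 1 (V' x) ≠ 1 := by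
        intro x hx hxn h1
        have : ∀ t < 3 * τ, V t ≠ V' x := fun t ht e => by
          have := hV'.inj t (by omega) x hxn (by rw [hsub t ht, e])
          omega
        rw [hV.unmark _ this] at h1
        exact absurd h1 (by norm_num)
      rcases hhit _ (hV'.lt i (by omega)) _ (hV'.lt j (by omega)) _ (hV'.lt l hln) g1 g2 g3
        with h1 | h1 | h1
      · exact hfar i hi (by omega) h1
      · exact hfar j (by omega) (by omega) h1
      · exact hfar l (by omega) hln h1
  · refine ⟨w, m, _, hwn, hmn, Or.inl rfl, Works.of_forall hε (run fun ω => Tri.ite (fun hne => ?_)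
      fun _ => Tri.set 1 (by simp) ?_ ?_)⟩
    · rw [e1, ltZ_ne_zero] at hne
      exact absurd (by exact_mod_cast hne) hc
    · have : (1 : ℤ) < 2 ^ L := one_lt_pow₀ (by norm_num) (by omega)
      simpa using this
    · simp only [setReg_reg, if_true, ne_eq, one_ne_zero, not_false_eq_true, true_iff]
      -- From `2w ≥ 3k` follows `k ≤ 2τ`, that is, `n ≤ m + 2τ`.
      refine hans.2 (coverable_of_triangles hsymm hτ (by omega) fun t ht => ?_)
      have := hV.tri t ht
      simp only [hh]
      rwa [hsub _ (by omega), hsub _ (by omega), hsub _ (by omega)]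

/-- The constant of the compilation depends on the program only, hence on `c` but not on the graph.
-/
theorem Works.decides {c : ℕ} : ∃ κ : ℕ, ∀ {n : ℕ} (G : SimpleGraph (Fin n)) (k L T : ℕ)
    (answer : Prop) (ε B : ℝ), n < 2 ^ L → k < 2 ^ L → 0 < L →
    Works c (start G k) L T answer ε → ((κ * (L + 1) * T : ℕ) : ℝ) ≤ B →
    RAM.Decides ((dualColoring c).toRAM 0) (RAM.graphInput G k) answer B ε := by
  obtain ⟨κ, hκ⟩ := (dualColoring c).exists_exec
  refine ⟨κ, fun {n} G k L T answer ε B hn hk hL hW hB => ?_⟩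
  have key : ∀ {ω : ℕ → Bool} {Q : St → Prop}, Tri L ω (dualColoring c) (start G k) T Q →
      ∃ t s', RAM.Exec ω ((dualColoring c).toRAM 0) (RAM.graphInput G k) t s' ∧ (t : ℝ) ≤ B ∧
        ∃ s'', Q s'' ∧ s'.reg 0 = s''.reg 0 := by
    intro ω Q h
    obtain ⟨t, s', h1, h2, h3, -⟩ :=
      hκ ω L 0 _ _ (rep_start G k) (bdd_start G k hn hk hL) h.1
    refine ⟨t, s', h1, le_trans ?_ hB, _, h.2.2, h3.reg 0⟩
    exact_mod_cast h2.trans (Nat.mul_le_mul_left _ h.2.1)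
  refine ⟨fun ω => ?_, ?_⟩
  · obtain ⟨Q, h⟩ := hW.halts ω
    obtain ⟨t, s', h1, h2, -⟩ := key h
    exact ⟨t, s', h1, h2⟩
  · obtain ⟨E, hE, h⟩ := hW.correct
    refine hE.trans (measureReal_mono fun ω hω => ?_)
    obtain ⟨t, s', h1, -, s'', h2, h3⟩ := key (h ω hω)
    exact ⟨t, s', h1, by rwa [h3]⟩

end DualColoring

/-! ### Assembly of the time bounds. -/

open DualColoring in
theorem theorem1 (c : ℕ) :
    ∃ (p : RAM.Prog) (A d : ℕ), ∀ (n : ℕ) (G : SimpleGraph (Fin n)) (k : ℕ),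
      RAM.Decides p (RAM.graphInput G k) (DualColorable G k)
        ((A : ℝ) * ((n : ℝ) + 1) ^ d * (2 : ℝ) ^ (3 * (k : ℝ) / 2))
        (1 / ((n : ℝ) + 2) ^ c) := by
  obtain ⟨κ, hκ⟩ := Works.decides (c := c)
  have hL : PolyBounded Shape.n 1 fun i : Shape => κ * (bitBound c i.n i.w i.m + 1) :=
    (PolyBounded.const κ).mul ((polyBounded_bitBound c).add (.const 1))
  obtain ⟨A₁, d₁, h₁⟩ := hL.mul
    ((PolyBounded.const 2).add ((polyBounded_deterministicSteps c).add (.const 1)))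
  have hw : ∀ i : Shape, 1 ≤ 2 ^ i.w := fun i => Nat.one_le_two_pow
  obtain ⟨A₂, d₂, h₂⟩ := hL.mul ((PolyBounded.of_one hw (.const 2)).add
    ((PolyBounded.of_one hw (polyBounded_deterministicSteps c)).add (polyBounded_randomizedSteps c)))
  -- One constant and one exponent for three cases: yes by packing, the randomized part, and `k >
  -- n`, which accounts for `4 * κ`.
  refine ⟨(dualColoring c).toRAM 0, A₁ + A₂ + 4 * κ, d₁ + d₂ + 1, fun n G k => ?_⟩
  have h2k : (2 : ℝ) ^ k ≤ (2 : ℝ) ^ (3 * (k : ℝ) / 2) := by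
    rw [← Real.rpow_natCast]
    exact Real.rpow_le_rpow_of_exponent_le (by norm_num) (by linarith [Nat.cast_nonneg (α := ℝ) k])
  have hpow : ∀ {a d x : ℕ} {y : ℝ}, a ≤ A₁ + A₂ + 4 * κ → d ≤ d₁ + d₂ + 1 → (x : ℝ) ≤ y →
      ((a * (n + 1) ^ d * x : ℕ) : ℝ) ≤
        ((A₁ + A₂ + 4 * κ : ℕ) : ℝ) * ((n : ℝ) + 1) ^ (d₁ + d₂ + 1) * y := by
    intro a d x y ha hd hx
    push_cast
    have h1 : (a : ℝ) ≤ (A₁ : ℝ) + A₂ + 4 * κ := by exact_mod_cast ha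
    have h2 : ((n : ℝ) + 1) ^ d ≤ ((n : ℝ) + 1) ^ (d₁ + d₂ + 1) :=
      pow_le_pow_right₀ (by linarith [Nat.cast_nonneg (α := ℝ) n]) hd
    gcongr
  rcases lt_or_ge n k with hk | hk
  -- Only two elementary steps, but `k` is arbitrarily long; its length is absorbed by `k + 1 ≤ 2 ^
  -- k`.
  · refine hκ G k (n + k + 1) 2 _ _ _ ?_ ?_ (by omega) (works_of_lt G hk (by positivity)) ?_
    · exact Nat.lt_two_pow_self.trans_le (Nat.pow_le_pow_right (by norm_num) (by omega))
    · exact Nat.lt_two_pow_self.trans_le (Nat.pow_le_pow_right (by norm_num) (by omega))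
    · refine le_trans ?_ (hpow (a := 4 * κ) (d := 1) (x := 2 ^ k) (by omega) (by omega)
        (by exact_mod_cast h2k))
      have : k + 1 ≤ 2 ^ k := Nat.lt_two_pow_self
      have h3 : κ * (n + k + 1 + 1) * 2 ≤ 4 * κ * (n + 1) ^ 1 * 2 ^ k := by
        calc κ * (n + k + 1 + 1) * 2 ≤ κ * (2 * ((n + 1) * (k + 1))) * 2 := by gcongr; nlinarith
          _ = 4 * κ * (n + 1) ^ 1 * (k + 1) := by ring
          _ ≤ _ := by gcongr
      exact_mod_cast h3
  · obtain ⟨w, m, T, hwn, hmn, hT, hW⟩ := exists_works c k G hk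
    have hLn : n < 2 ^ bitBound c n w m := lt_two_pow_bitBound (by unfold bitBound; omega)
    refine hκ G k _ T _ _ _ hLn (hk.trans_lt hLn) (by unfold bitBound; omega) hW ?_
    rcases hT with rfl | ⟨hwk, rfl⟩
    · have := h₁ ⟨n, w, m, hwn, hmn⟩
      refine le_trans (by exact_mod_cast this) (hpow (x := 1) (by omega) (by omega) ?_)
      -- Polynomial time suffices here, so the exponential factor is only bounded below by 1.
      exact_mod_cast Real.one_le_rpow (by norm_num) (by positivity)
    · have := h₂ ⟨n, w, m, hwn, hmn⟩
      refine le_trans (by exact_mod_cast this) (hpow (x := 2 ^ w) (by omega) (by omega) ?_)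
      push_cast
      rw [← Real.rpow_natCast]
      refine Real.rpow_le_rpow_of_exponent_le (by norm_num) ?_
      -- The only place where the exponent `3k/2` is needed in full: `w ≤ 3k/2`.
      have : (2 : ℝ) * w ≤ 3 * k := by exact_mod_cast hwk
      linarith
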